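/- There are a randomized program $\mathsf S$ and absolute constants $C, c$ such that the following holds for all integers $n, k \ge 0$ and $d \ge d_0 \ge 1$ and all reals $\epsilon, \delta, \gamma > 0$. Say that $f : \{0,1\}^n \to \mathbb{R}^d$ is $(\epsilon,\delta)$-concentrated at $\mu \in \mathbb{R}^d$ if $\Pr_{X}[\|f(X) - \mu\|_\infty > \epsilon] \le \delta$ for uniform $X \in \{0,1\}^n$. Let $\mathsf S$, on input $(n,k,d,d_0,\epsilon,\delta,\gamma)$, interact with an arbitrary, possibly randomized, owner $\mathsf O$ for $k$ rounds. In round $i$, $\mathsf O$ chooses, depending on $Y_1,\dots,Y_{i-1}$ and on its own randomness, a function $f_i : \{0,1\}^n \to \mathbb{R}^d$ that is $(\epsilon,\delta)$-concentrated at some point $\mu_i \in \mathbb{R}^d$; then $\mathsf S$ queries $f_i$ at a single point $X_i \in \{0,1\}^n$ of its choice, which $\mathsf O$ does not see; $\mathsf S$ learns $f_i(X_i)$ and nothing else about $f_i$, and gives a vector $Y_i \in \mathbb{R}^d$ to $\mathsf O$. Then $$\Pr\Big[\max_{i} \|Y_i - \mu_i\|_\infty > C \epsilon d_0\Big] \le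 k\delta + \gamma,$$ where the probability is over the randomness of $\mathsf S$ and of $\mathsf O$. Moreover $\mathsf S$ uses at most $$n + C\left(\frac{k d \log_2 (d_0+1)}{d_0} + (\log_2 k) \cdot \max\{0, \log_2 (1/\gamma)\}\right)$$ uniform random bits, and its total running time is at most $C\,(n + k + d + \max\{0,\log_2(1/\epsilon)\} + \max\{0,\log_2(1/\gamma)\} + 1)^c$ (with $\log_2 0$ read as $0$ if $k = 0$). Here a program is a program of a unit-cost random access machine with natural-number registers (operations: constants, $+$, truncated $-$, comparison) and real registers (operations: natural constants, $+$, $-$, comparison, and rounding a number down to an integer multiple of another); a random bit costs one step, a query $n+d+1$ steps and an answer $d+1$ steps. -/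

import Mathlib

open MeasureTheory

noncomputable section

namespace RandomnessSteward

/-! ### Concentrated functions and owners -/

/-- Bit strings of length `n`, i.e. elements of `{0,1}^n`. -/
abbrev Bits (n : ℕ) : Type := Fin n → Bool

/-- The probability that a uniformly random element of the finite type `α` lies in `E`. -/
def uniformProb {α : Type} [Fintype α] (E : Set α) : ℝ :=
  (E.ncard : ℝ) / (Fintype.card α : ℝ)

/-- `f : {0,1}^n → ℝ^d` is `(ε, δ)`-concentrated at `μ`: for uniform `X`,
`Pr[‖f X - μ‖_∞ > ε] ≤ δ`. (The norm of `Fin d → ℝ` is the sup norm.) -/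
def Concentrated {n d : ℕ} (ε δ : ℝ) (f : Bits n → Fin d → ℝ) (μ : Fin d → ℝ) : Prop :=
  uniformProb {x : Bits n | ε < ‖f x - μ‖} ≤ δ

/-- A deterministic owner. After having received the answers `h = [Y_1, …, Y_{i-1}]` it chooses
the function `f_i = func h`, which is `(ε, δ)`-concentrated at the point `μ_i = point h`.
(A randomized owner is a family of these, indexed by the points of a probability space.) -/
structure Owner (n d : ℕ) (ε δ : ℝ) where
  func : List (Fin d → ℝ) → Bits n → Fin d → ℝ
  point : List (Fin d → ℝ) → Fin d → ℝ
  concentrated : ∀ h, Concentrated ε δ (func h) (point h)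

/-! ### The machine model

Programs of a unit-cost random access machine with two memories, one of natural numbers and one of
real numbers, both with indirect addressing.

* On natural numbers the operations are constants, `+`, truncated `-` and comparison. There is no
  multiplication, so one assignment lengthens numbers by only `O(1)` bits, and `t` steps can be
  simulated in time polynomial in `t` and in the length of the input on a Turing machine.
* On real numbers the operations are natural constants, `+`, `-`, comparison, and rounding `x` down
  to a multiple of `y`. They map multiples of `1 / D` to multiples of `1 / D`, and the absolute
  value of the result is at most the sum of those of the arguments, so the preceding remark applies
  to rational data as well.

Program constants are natural numbers: there are no real numbers in a program. -/

/-- Expressions of type natural number. `mem a` is the content of the natural register with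
address `a`; `sub` is truncated subtraction. -/
inductive NExpr : Type
  | const (c : ℕ)
  | mem (a : NExpr)
  | add (a b : NExpr)
  | sub (a b : NExpr)

/-- Expressions of type real number. `mem a` is the content of the real register with
address `a`; `roundDown x y` is `x` rounded down to an integer multiple of `y`. -/
inductive RExpr : Type
  | const (c : ℕ)
  | mem (a : NExpr)
  | add (x y : RExpr)
  | sub (x y : RExpr)
  | roundDown (x y : RExpr)

/-- Tests. -/
inductive Test : Type
  | ltN (a b : NExpr)
  | ltR (x y : RExpr)
  | not (b : Test)

/-- Programs of a randomized machine that interacts with an owner. -/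
inductive Prog : Type
  | skip
  /-- Store the value of `e` in the natural register with address `a`. -/
  | setN (a e : NExpr)
  /-- Store the value of `x` in the real register with address `a`. -/
  | setR (a : NExpr) (x : RExpr)
  /-- Store a fresh random bit in the natural register with address `a`. -/
  | coin (a : NExpr)
  /-- Query the current function `f_i` at the point stored in the `n` natural registers from
  address `a` on, and store the result in the `d` real registers from address `b` on. -/
  | query (a b : NExpr)
  /-- Give to the owner the vector `Y_i` stored in the `d` real registers from address `a` on. -/
  | answer (a : NExpr)
  | seq (p q : Prog)
  | ite (b : Test) (p q : Prog)
  | loop (b : Test) (p : Prog)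

/-- A state of the machine during an interaction: the two memories, the random bits that have not
been used yet, the answers given so far (in chronological order), and whether the current function
has been queried. -/
structure State (d : ℕ) where
  nat : ℕ → ℕ
  real : ℕ → ℝ
  coins : List Bool
  answers : List (Fin d → ℝ)
  queried : Bool

/-- The value of a natural expression. -/
def NExpr.val {d : ℕ} (s : State d) : NExpr → ℕ
  | .const c => c
  | .mem a => s.nat (a.val s)
  | .add a b => a.val s + b.val s
  | .sub a b => a.val s - b.val s

/-- The value of a real expression. -/
def RExpr.val {d : ℕ} (s : State d) : RExpr → ℝ
  | .const c => (c : ℝ)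
  | .mem a => s.real (a.val s)
  | .add x y => x.val s + y.val s
  | .sub x y => x.val s - y.val s
  | .roundDown x y => (⌊x.val s / y.val s⌋ : ℝ) * y.val s

/-- The truth value of a test. -/
def Test.Holds {d : ℕ} (s : State d) : Test → Prop
  | .ltN a b => a.val s < b.val s
  | .ltR x y => x.val s < y.val s
  | .not b => ¬ b.Holds s

/-- The bit string in the `n` natural registers from address `a` on (nonzero means `1`). -/
def State.readBits {d : ℕ} (s : State d) (n a : ℕ) : Bits n :=
  fun j => decide (s.nat (a + j) ≠ 0)

/-- The vector in the `d` real registers from address `a` on. -/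
def State.readVec {d : ℕ} (s : State d) (a : ℕ) : Fin d → ℝ :=
  fun j => s.real (a + j)

/-- The real memory after the vector `w` is stored in the `d` registers from address `a` on. -/
def State.storeVec {d : ℕ} (s : State d) (a : ℕ) (w : Fin d → ℝ) : ℕ → ℝ :=
  fun b => if h : a ≤ b ∧ b - a < d then w ⟨b - a, h.2⟩ else s.real b

/-- `Exec k f p s t s'`: in an interaction of `k` rounds with an owner that chooses `f h` after the
answers `h`, program `p`, started in state `s`, halts after `t` steps in state `s'`.

In every round there is exactly one query, and it comes before the answer. A program that wants to
make another query, that gives an answer without having made the query, that goes on after the last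
round, or that asks for more random bits than there are, gets stuck and does not halt. -/
inductive Exec {n d : ℕ} (k : ℕ) (f : List (Fin d → ℝ) → Bits n → Fin d → ℝ) :
    Prog → State d → ℕ → State d → Prop
  | skip (s : State d) : Exec k f .skip s 1 s
  | setN (s : State d) (a e : NExpr) :
      Exec k f (.setN a e) s 1 { s with nat := Function.update s.nat (a.val s) (e.val s) }
  | setR (s : State d) (a : NExpr) (x : RExpr) :
      Exec k f (.setR a x) s 1 { s with real := Function.update s.real (a.val s) (x.val s) }
  | coin (s : State d) (a : NExpr) (b : Bool) (l : List Bool) (hs : s.coins = b :: l) :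
      Exec k f (.coin a) s 1
        { s with nat := Function.update s.nat (a.val s) b.toNat, coins := l }
  | query (s : State d) (a b : NExpr) (hk : s.answers.length < k) (hq : s.queried = false) :
      Exec k f (.query a b) s (n + d + 1)
        { s with
          real := s.storeVec (b.val s) (f s.answers (s.readBits n (a.val s)))
          queried := true }
  | answer (s : State d) (a : NExpr) (hk : s.answers.length < k) (hq : s.queried = true) :
      Exec k f (.answer a) s (d + 1)
        { s with
          answers := s.answers ++ [s.readVec (a.val s)]
          queried := false }
  | seq (p q : Prog) (s s₁ s₂ : State d) (t₁ t₂ : ℕ)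
      (h₁ : Exec k f p s t₁ s₁) (h₂ : Exec k f q s₁ t₂ s₂) :
      Exec k f (.seq p q) s (t₁ + t₂) s₂
  | iteTrue (b : Test) (p q : Prog) (s s₁ : State d) (t : ℕ)
      (hb : b.Holds s) (h : Exec k f p s t s₁) : Exec k f (.ite b p q) s (t + 1) s₁
  | iteFalse (b : Test) (p q : Prog) (s s₁ : State d) (t : ℕ)
      (hb : ¬ b.Holds s) (h : Exec k f q s t s₁) : Exec k f (.ite b p q) s (t + 1) s₁
  | loopTrue (b : Test) (p : Prog) (s s₁ s₂ : State d) (t₁ t₂ : ℕ)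
      (hb : b.Holds s) (h₁ : Exec k f p s t₁ s₁) (h₂ : Exec k f (.loop b p) s₁ t₂ s₂) :
      Exec k f (.loop b p) s (t₁ + t₂ + 1) s₂
  | loopFalse (b : Test) (p : Prog) (s : State d) (hb : ¬ b.Holds s) :
      Exec k f (.loop b p) s 1 s

/-- The initial state on natural inputs `ns`, real inputs `rs` and random bits `z`: the inputs are
in the first registers, all other registers contain `0`. -/
def State.init (d : ℕ) (ns : List ℕ) (rs : List ℝ) {m : ℕ} (z : Bits m) : State d where
  nat := fun a => ns.getD a 0
  real := fun a => rs.getD a 0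
  coins := List.ofFn z
  answers := []
  queried := false

/-! ### One-query stewards -/

/-- In the interaction of `O` with the program `p` on inputs `ns`, `rs` and random bits `z`, the
program halts after `t` steps, after having given exactly the `k` answers `Y_1, …, Y_k`. -/
def Transcript {n d m k : ℕ} {ε δ : ℝ} (p : Prog) (ns : List ℕ) (rs : List ℝ)
    (O : Owner n d ε δ) (z : Bits m) (t : ℕ) (Y : Fin k → Fin d → ℝ) : Prop :=
  ∃ s : State d, Exec k O.func p (State.init d ns rs z) t s ∧ s.answers = List.ofFn Y

/-- `max_i ‖Y_i - μ_i‖_∞ > ε'` when the owner `O` receives the answers `Y_1, …, Y_k`. -/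
def Fails {n d k : ℕ} {ε δ : ℝ} (ε' : ℝ) (O : Owner n d ε δ) (Y : Fin k → Fin d → ℝ) : Prop :=
  ∃ i : Fin k, ε' < ‖Y i - O.point ((List.ofFn Y).take i)‖

/-- On inputs `ns`, `rs`, the program `p` is a one-query `(ε', δ')`-steward for `k` adaptively chosen
`(ε, δ)`-concentrated functions `{0,1}^n → ℝ^d` that uses at most `m` random bits and runs in total
time at most `T`. -/
structure IsOneQuerySteward (p : Prog) (ns : List ℕ) (rs : List ℝ) (n k d : ℕ) (ε δ ε' δ' : ℝ)
    (m : ℕ) (T : ℝ) : Prop where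
  /-- Against every owner and for all random bits, the machine completes the `k` rounds, with
  one query in each, in time `T`. -/
  halts : ∀ (O : Owner n d ε δ) (z : Bits m),
    ∃ (t : ℕ) (Y : Fin k → Fin d → ℝ), Transcript p ns rs O z t Y ∧ (t : ℝ) ≤ T
  /-- Against every randomized owner, the failure probability, over the randomness `ω` of the owner
  and the independent uniform random bits `z` of the steward, is at most `δ'`. -/
  correct : ∀ (Ω : Type) [MeasurableSpace Ω] (P : Measure Ω) [IsProbabilityMeasure P]
    (O : Ω → Owner n d ε δ),
    ∫⁻ ω, ENNReal.ofReal (uniformProb {z : Bits m |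
        ∃ (t : ℕ) (Y : Fin k → Fin d → ℝ), Transcript p ns rs (O ω) z t Y ∧ Fails ε' (O ω) Y}) ∂P
      ≤ ENNReal.ofReal δ'

/-- `max (0, log₂ (1 / x))`. -/
def logInv (x : ℝ) : ℝ := max 0 (Real.logb 2 (1 / x))

end RandomnessSteward

end

/-! Independent uniform queries would fail with probability at most `k * δ` by a union bound, but
they cost `n * k` bits. Randomness is saved in two moves. The answers are rounded so that they
reveal little about the queries, and the queries are then taken from a generator that fools every
adaptive process with few branches.

Rounding. The coordinates are cut into blocks of length `d₀`. Cells have width `2ε(d₀ + 1)`, and a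
block may be shifted by `2εD` with `0 ≤ D ≤ d₀`. A coordinate spoils at most one of these shifts
(`not_two_bad_shifts`), so by pigeonhole some shift keeps the `ε`-neighbourhood of every observed
coordinate of the block inside one cell (`exists_goodShift`). If the observed value is within `ε` of
the point of concentration, both are then rounded to the same vector (`roundVec_eq_roundLike`). Such
an answer depends on the query only through the shifts, so it takes at most `(d₀ + 1) ^ numBlocks d
d₀` values (`exists_roundLike_range`), and it is accurate to `6εd₀`. In the ideal process the chosen
shifts are always applied to the point of concentration. It agrees with the real interaction as long
as no query is bad (`endState_eq_answersTo`), and every one of its rounds has few outcomes. It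
remains to bound the probability that the ideal process ever meets a bad query.

Generator. Level `i + 1` runs level `i` on a seed `x`, then again on the endpoint of an expander
walk from `x`. For each state `v` reachable at the middle, the seeds leading to `v` and the seeds
that are bad when started from `v` are two fixed sets, so expander mixing bounds the pairs that hit
both. There are at most `2 ^ (D * 2 ^ i)` states, and `8 * (D * 2 ^ i + e)` walk steps make the
errors of all states together at most `2⁻ᵉ`, because `(73/80)⁸ < 1/2` (`generator_everBad_card_le`).
With `l = ⌈log₂ k⌉` levels the seed has `n + O(D 2ˡ + e l)` bits. Taking `e = l + ⌈log₂ (1/γ)⌉` (no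
second term if `γ ≥ 1`) makes the total error at most `γ`, and the term `l²` is absorbed since `l² ≤
4k`.

Expander. The graph is that of Margulis and Gabber–Galil on `(ℤ/2ʰ)²`. The Fourier transform turns
its averaging operator into weighted shears of the frequencies. A Schur test with weights that
favour edges leading away from zero (`pairWeight_add_le`, `sum_sq_le_of_edge_bound`) gives norm at
most `73/80` on functions of mean zero.

Machine. The steward is an explicit program. Each routine has a Hoare-style specification `Runs`
with a time bound of the form `N ^ e`. `Exec.deterministic` identifies every transcript with the
computed one, and `stewardProg_isOneQuerySteward` puts the parts together. -/

noncomputable section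

namespace RandomnessSteward

/-! ### The Fourier transform on `(ℤ/N)²` -/

/-- The vertex set of the Margulis–Gabber–Galil graph. -/
abbrev Torus (N : ℕ) : Type := ZMod N × ZMod N

/-- The discrete Fourier transform on `(ℤ/N)²`. -/
def torusFT {N : ℕ} [NeZero N] (f : Torus N → ℂ) (u : Torus N) : ℂ :=
  ∑ z : Torus N, f z * ZMod.stdAddChar (-(u.1 * z.1 + u.2 * z.2))

section Torus

variable {N : ℕ} [NeZero N]

theorem sum_stdAddChar_torus (w : Torus N) :
    ∑ u : Torus N, (ZMod.stdAddChar (u.1 * w.1 + u.2 * w.2) : ℂ) =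
      if w = 0 then (N : ℂ) ^ 2 else 0 := by
  have h : ∀ a : ZMod N, ∑ x : ZMod N, (ZMod.stdAddChar (x * a) : ℂ) =
      if a = 0 then (N : ℂ) else 0 := by
    intro a
    rw [AddChar.sum_mulShift a (ZMod.isPrimitive_stdAddChar N), ZMod.card]
    split_ifs <;> simp
  rw [Fintype.sum_prod_type]
  simp only [AddChar.map_add_eq_mul, ← Finset.mul_sum, ← Finset.sum_mul, h]
  rcases w with ⟨a, b⟩
  by_cases ha : a = 0 <;> by_cases hb : b = 0 <;> simp [ha, hb, sq]

/-- Parseval: expand the square and sum over the frequencies first; orthogonality of characters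
leaves only the diagonal terms. -/
theorem sum_norm_sq_torusFT (f : Torus N → ℂ) :
    ∑ u, ‖torusFT f u‖ ^ 2 = (N : ℝ) ^ 2 * ∑ z, ‖f z‖ ^ 2 := by
  have key : ∑ u, torusFT f u * (starRingEnd ℂ) (torusFT f u) =
      (N : ℂ) ^ 2 * ∑ z, f z * (starRingEnd ℂ) (f z) := by
    have h1 : ∀ u : Torus N, torusFT f u * (starRingEnd ℂ) (torusFT f u) =
        ∑ z, ∑ w, (f z * (starRingEnd ℂ) (f w)) *
          ZMod.stdAddChar (u.1 * (w - z).1 + u.2 * (w - z).2) := by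
      intro u
      simp only [torusFT, map_sum, map_mul, Finset.sum_mul_sum]
      refine Finset.sum_congr rfl fun z _ => Finset.sum_congr rfl fun w _ => ?_
      rw [← AddChar.map_neg_eq_conj, neg_neg]
      have : (u.1 * (w - z).1 + u.2 * (w - z).2) =
          -(u.1 * z.1 + u.2 * z.2) + (u.1 * w.1 + u.2 * w.2) := by
        simp only [Prod.fst_sub, Prod.snd_sub]; ring
      rw [this, AddChar.map_add_eq_mul _ (-(u.1 * z.1 + u.2 * z.2))]
      ring
    simp only [h1]
    rw [Finset.sum_comm, Finset.mul_sum]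
    refine Finset.sum_congr rfl fun z _ => ?_
    rw [Finset.sum_comm]
    simp only [← Finset.mul_sum, sum_stdAddChar_torus, sub_eq_zero]
    simp
    ring
  have := congrArg Complex.re key
  simp only [Complex.mul_conj] at this
  rw [← Complex.ofReal_sum, ← Complex.ofReal_sum] at this
  simp only [Complex.normSq_eq_norm_sq] at this
  exact_mod_cast this

/-- A change of variables moves the shear to the frequencies as its inverse transpose, and the
translation by `c` survives only as a phase. Hence two labels with the same shear and different `c`
combine into one multiplier. -/
theorem torusFT_shear_fst (f : Torus N → ℂ) (k c : ZMod N) (u : Torus N) :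
    torusFT (fun z => f (z.1 + k * z.2 + c, z.2)) u =
      ZMod.stdAddChar (c * u.1) * torusFT f (u.1, u.2 - k * u.1) := by
  simp only [torusFT, Finset.mul_sum]
  refine Finset.sum_nbij' (fun z => (z.1 + k * z.2 + c, z.2)) (fun z => (z.1 - k * z.2 - c, z.2))
    (by simp) (by simp) (fun z _ => by ext <;> simp; ring)
    (fun z _ => by ext <;> simp; ring) ?_
  intro z _
  rw [mul_left_comm, ← AddChar.map_add_eq_mul]
  congr 2
  ring

theorem torusFT_shear_snd (f : Torus N → ℂ) (k c : ZMod N) (u : Torus N) :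
    torusFT (fun z => f (z.1, z.2 + k * z.1 + c)) u =
      ZMod.stdAddChar (c * u.2) * torusFT f (u.1 - k * u.2, u.2) := by
  simp only [torusFT, Finset.mul_sum]
  refine Finset.sum_nbij' (fun z => (z.1, z.2 + k * z.1 + c)) (fun z => (z.1, z.2 - k * z.1 - c))
    (by simp) (by simp) (fun z _ => by ext <;> simp; ring)
    (fun z _ => by ext <;> simp; ring) ?_
  intro z _
  rw [mul_left_comm, ← AddChar.map_add_eq_mul]
  congr 2
  ring

/-- Half of `‖1 + e(a)‖`. -/
def cosWeight (a : ZMod N) : ℝ := ‖(1 + ZMod.stdAddChar a : ℂ)‖ / 2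

/-- Take out the half angle: `1 + exp(2iθ) = exp(iθ) * 2 cos θ`. -/
theorem cosWeight_eq (a : ZMod N) :
    cosWeight a = |Real.cos (Real.pi * a.valMinAbs / N)| := by
  have h : (ZMod.stdAddChar a : ℂ) = Complex.exp (2 * Real.pi * Complex.I * a.valMinAbs / N) := by
    rw [← ZMod.stdAddChar_coe, ZMod.coe_valMinAbs]
  set θ : ℝ := Real.pi * a.valMinAbs / N with hθ
  have h2 : (1 + ZMod.stdAddChar a : ℂ) = Complex.exp (θ * Complex.I) * (2 * Complex.cos θ) := by
    rw [h, Complex.two_cos, mul_add, ← Complex.exp_add, ← Complex.exp_add]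
    rw [show (θ : ℂ) * Complex.I + -(θ : ℂ) * Complex.I = 0 by ring, Complex.exp_zero, add_comm]
    congr 2
    rw [hθ]; push_cast; ring
  rw [cosWeight, h2, norm_mul, Complex.norm_exp_ofReal_mul_I, norm_mul, ← Complex.ofReal_cos,
    Complex.norm_real, Real.norm_eq_abs]
  simp

theorem cosWeight_nonneg (a : ZMod N) : 0 ≤ cosWeight a := by unfold cosWeight; positivity

theorem cosWeight_le_one (a : ZMod N) : cosWeight a ≤ 1 := by
  rw [cosWeight_eq]; exact Real.abs_cos_le_one _

/-- Sum-to-product: the mean of the two angles lies in `[π/4, π/2]`. This serves the frequencies far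
from zero, where the phases alone already contract. -/
theorem cosWeight_add_le (a b : ZMod N)
    (h : N ≤ 2 * (a.valMinAbs.natAbs + b.valMinAbs.natAbs)) :
    cosWeight a + cosWeight b ≤ Real.sqrt 2 := by
  have hN : (0 : ℝ) < N := by exact_mod_cast NeZero.pos N
  have hc : ∀ x : ZMod N, cosWeight x = Real.cos (Real.pi * x.valMinAbs.natAbs / N) := by
    intro x
    have hx : (x.valMinAbs.natAbs : ℝ) ≤ N / 2 := by
      have := x.natAbs_valMinAbs_le
      rw [le_div_iff₀ (by norm_num)]
      exact_mod_cast (by omega : x.valMinAbs.natAbs * 2 ≤ N)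
    have h1 : ((x.valMinAbs.natAbs : ℕ) : ℝ) = |(x.valMinAbs : ℝ)| := by
      rw [Nat.cast_natAbs, Int.cast_abs]
    rw [cosWeight_eq, ← abs_of_nonneg (a := Real.cos (Real.pi * x.valMinAbs.natAbs / N))]
    · rw [h1]
      rcases abs_choice (x.valMinAbs : ℝ) with h | h <;> rw [h]
      rw [mul_neg, neg_div, Real.cos_neg]
    · apply Real.cos_nonneg_of_neg_pi_div_two_le_of_le
      · have : 0 ≤ Real.pi * x.valMinAbs.natAbs / N := by positivity
        linarith [Real.pi_pos]
      · rw [div_le_iff₀ hN]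
        nlinarith [Real.pi_pos]
  have hle : ∀ x : ZMod N, (x.valMinAbs.natAbs : ℝ) ≤ N / 2 := by
    intro x
    have := x.natAbs_valMinAbs_le
    rw [le_div_iff₀ (by norm_num)]
    exact_mod_cast (by omega : x.valMinAbs.natAbs * 2 ≤ N)
  have ha := hle a
  have hb := hle b
  have hs : (N : ℝ) / 2 ≤ a.valMinAbs.natAbs + b.valMinAbs.natAbs := by
    rw [div_le_iff₀ (by norm_num)]
    have : (N : ℝ) ≤ 2 * (a.valMinAbs.natAbs + b.valMinAbs.natAbs) := by exact_mod_cast h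
    linarith
  rw [hc, hc]
  generalize ((a.valMinAbs.natAbs : ℕ) : ℝ) = p at *
  generalize ((b.valMinAbs.natAbs : ℕ) : ℝ) = q at *
  rw [Real.cos_add_cos]
  set s := (Real.pi * p / N + Real.pi * q / N) / 2 with hsd
  have hs1 : Real.pi / 4 ≤ s := by
    rw [hsd, ← add_div, ← mul_add, div_div, le_div_iff₀ (by positivity)]
    nlinarith [Real.pi_pos]
  have hs2 : s ≤ Real.pi / 2 := by
    rw [hsd, ← add_div, ← mul_add, div_div, div_le_iff₀ (by positivity)]
    nlinarith [Real.pi_pos]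
  have c1 : Real.cos s ≤ Real.sqrt 2 / 2 := by
    rw [← Real.cos_pi_div_four]
    exact Real.cos_le_cos_of_nonneg_of_le_pi (by positivity) (by linarith [Real.pi_pos]) hs1
  have c0 : 0 ≤ Real.cos s :=
    Real.cos_nonneg_of_neg_pi_div_two_le_of_le (by linarith [Real.pi_pos]) hs2
  have := Real.cos_le_one ((Real.pi * p / N - Real.pi * q / N) / 2)
  nlinarith

end Torus

section Torus

variable {N : ℕ} [NeZero N]

/-! ### The spectral gap of the Margulis–Gabber–Galil graph -/

/-- The displacement of a coordinate in the step with label `l`, given the other coordinate. -/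
def displacement {R : Type*} [Ring R] (l : ℕ) (y : R) : R :=
  match l with
  | 0 => 2 * y
  | 1 => 2 * y + 1
  | 2 => -(2 * y)
  | _ => -(2 * y + 1)

/-- The neighbour with label `l < 8` in the Margulis–Gabber–Galil graph. -/
def torusStep {R : Type*} [Ring R] (l : ℕ) (z : R × R) : R × R :=
  if l < 4 then (z.1 + displacement l z.2, z.2) else (z.1, z.2 + displacement (l - 4) z.1)

/-- The averaging operator of the Margulis–Gabber–Galil graph. -/
def torusAvg (f : Torus N → ℝ) (z : Torus N) : ℝ := (∑ l ∈ Finset.range 8, f (torusStep l z)) / 8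

/-- The absolute value of the representative of `a` of least absolute value. -/
def torusAbs (a : ZMod N) : ℕ := a.valMinAbs.natAbs

/-- The weight in the Schur test of an edge along which the changing coordinate has the absolute
values `p` and `q` at the ends. -/
def edgeWeight (p q : ℕ) : ℝ := if p < q then 4 / 5 else if q < p then 5 / 4 else 1

theorem edgeWeight_pos (p q : ℕ) : 0 < edgeWeight p q := by
  unfold edgeWeight; split_ifs <;> norm_num

theorem edgeWeight_le (p q : ℕ) : edgeWeight p q ≤ 5 / 4 := by
  unfold edgeWeight; split_ifs <;> norm_num

theorem edgeWeight_mul (p q : ℕ) : edgeWeight p q * edgeWeight q p = 1 := by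
  unfold edgeWeight; split_ifs <;> first | omega | norm_num

/-- The difference is a multiple of `N` of absolute value less than `2 * N`. This turns statements
about least residues into linear integer arithmetic. -/
theorem valMinAbs_intCast_sub (x : ZMod N) (X : ℤ) (hx : (X : ZMod N) = x)
    (hX : -(N : ℤ) < X ∧ X < N) :
    x.valMinAbs = X ∨ x.valMinAbs = X + N ∨ x.valMinAbs = X - N := by
  obtain ⟨q, hq⟩ : (N : ℤ) ∣ x.valMinAbs - X := by
    rw [← ZMod.intCast_zmod_eq_zero_iff_dvd]; push_cast; simp [hx]
  have hN : (0 : ℤ) < N := by exact_mod_cast NeZero.pos N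
  obtain ⟨h1, h2⟩ := x.valMinAbs_mem_Ioc
  have hq1 : q < 2 := by nlinarith
  have hq2 : -2 < q := by nlinarith
  obtain rfl | rfl | rfl : q = 0 ∨ q = 1 ∨ q = -1 := by omega
  all_goals simp at hq; omega

/-- Under `h`, a move by `± 2 * y` that wraps around still ends farther from zero than it began, so
only the sizes of `x` and `y` matter. The smaller coordinate always moves outward; the larger one
does so for at least one sign, unless the move is trivial. -/
theorem torusAbs_cases (x y : ZMod N) (h : 2 * (torusAbs x + torusAbs y) < N) :
    (torusAbs x < torusAbs y → torusAbs x < torusAbs (x - 2 * y) ∧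
      torusAbs x < torusAbs (x + 2 * y)) ∧
    (torusAbs x = torusAbs y → torusAbs x ≠ 0 →
      (torusAbs x < torusAbs (x - 2 * y) ∧ torusAbs x = torusAbs (x + 2 * y)) ∨
      (torusAbs x = torusAbs (x - 2 * y) ∧ torusAbs x < torusAbs (x + 2 * y))) ∧
    (torusAbs y < torusAbs x →
      (torusAbs x < torusAbs (x - 2 * y) ∨ torusAbs x < torusAbs (x + 2 * y)) ∨
      (torusAbs x = torusAbs (x - 2 * y) ∧ torusAbs x = torusAbs (x + 2 * y))) := by
  unfold torusAbs at *
  have h1 := valMinAbs_intCast_sub (x - 2 * y) (x.valMinAbs - 2 * y.valMinAbs) (by simp) (by omega)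
  have h2 := valMinAbs_intCast_sub (x + 2 * y) (x.valMinAbs + 2 * y.valMinAbs) (by simp) (by omega)
  have h3 := (x - 2 * y).valMinAbs_mem_Ioc
  have h4 := (x + 2 * y).valMinAbs_mem_Ioc
  rw [Set.mem_Ioc] at h3 h4
  generalize (x - 2 * y).valMinAbs = P at *
  generalize (x + 2 * y).valMinAbs = Q at *
  generalize x.valMinAbs = X at *
  generalize y.valMinAbs = Y at *
  refine ⟨?_, ?_, ?_⟩ <;> omega

/-- The sum of the weights of the two edges that change `x` by `± 2 y`. -/
def pairWeight (x y : ZMod N) : ℝ :=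
  edgeWeight (torusAbs x) (torusAbs (x - 2 * y)) + edgeWeight (torusAbs x) (torusAbs (x + 2 * y))

omit [NeZero N] in
theorem pairWeight_nonneg (x y : ZMod N) : 0 ≤ pairWeight x y :=
  add_nonneg (edgeWeight_pos _ _).le (edgeWeight_pos _ _).le

/-- Near zero the cosines are bounded by 1 and the weights gain: the smaller coordinate contributes
`4/5 + 4/5` and the larger at most `4/5 + 5/4`, which add up to `73/20`, while equal sizes give
`9/5` twice. Far from zero every edge may cost `5/4`, but the cosines sum to at most `√2`. The gain
is that `73/20 < 4`. -/
theorem pairWeight_add_le (u : Torus N) (hu : u ≠ 0) :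
    cosWeight u.1 * pairWeight u.2 u.1 + cosWeight u.2 * pairWeight u.1 u.2 ≤ 73 / 20 := by
  obtain ⟨a, b⟩ := u
  have ca := cosWeight_nonneg a
  have cb := cosWeight_nonneg b
  simp only
  rcases Nat.lt_or_ge (2 * (torusAbs a + torusAbs b)) N with h | h
  · have hb := torusAbs_cases b a (by omega)
    have ha := torusAbs_cases a b (by omega)
    have key : pairWeight b a + pairWeight a b ≤ 73 / 20 := by
      have hne : torusAbs a ≠ 0 ∨ torusAbs b ≠ 0 := by
        by_contra! hc
        apply hu
        simpa [torusAbs, ZMod.valMinAbs_eq_zero] using hc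
      have e1 : ∀ p q, p < q → edgeWeight p q = 4 / 5 := fun p q h => by simp [edgeWeight, h]
      have e2 : ∀ p, edgeWeight p p = 1 := fun p => by simp [edgeWeight]
      have l1 := edgeWeight_le (torusAbs a) (torusAbs (a - 2 * b))
      have l2 := edgeWeight_le (torusAbs a) (torusAbs (a + 2 * b))
      have l3 := edgeWeight_le (torusAbs b) (torusAbs (b - 2 * a))
      have l4 := edgeWeight_le (torusAbs b) (torusAbs (b + 2 * a))
      unfold pairWeight
      have big : ∀ x y : ZMod N, torusAbs x < torusAbs (x - 2 * y) ∨
          torusAbs x < torusAbs (x + 2 * y) →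
          edgeWeight (torusAbs x) (torusAbs (x - 2 * y)) +
            edgeWeight (torusAbs x) (torusAbs (x + 2 * y)) ≤ 41 / 20 := by
        intro x y h
        have l1 := edgeWeight_le (torusAbs x) (torusAbs (x - 2 * y))
        have l2 := edgeWeight_le (torusAbs x) (torusAbs (x + 2 * y))
        rcases h with h | h
        · rw [e1 _ _ h]; linarith
        · rw [e1 _ _ h]; linarith
      rcases lt_trichotomy (torusAbs a) (torusAbs b) with hab | hab | hab
      · obtain ⟨q1, q2⟩ := ha.1 hab
        rw [e1 _ _ q1, e1 _ _ q2]
        rcases hb.2.2 hab with h | ⟨h1, h2⟩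
        · linarith [big _ _ h]
        · rw [← h1, ← h2, e2]; norm_num
      · have eq : ∀ x y : ZMod N, (torusAbs x < torusAbs (x - 2 * y) ∧
            torusAbs x = torusAbs (x + 2 * y)) ∨ (torusAbs x = torusAbs (x - 2 * y) ∧
            torusAbs x < torusAbs (x + 2 * y)) → edgeWeight (torusAbs x) (torusAbs (x - 2 * y)) +
            edgeWeight (torusAbs x) (torusAbs (x + 2 * y)) = 9 / 5 := by
          rintro x y (⟨h, h'⟩ | ⟨h', h⟩) <;> rw [e1 _ _ h, ← h', e2] <;> norm_num
        rw [eq _ _ (ha.2.1 hab (by omega)), eq _ _ (hb.2.1 hab.symm (by omega))]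
        norm_num
      · obtain ⟨q1, q2⟩ := hb.1 hab
        rw [e1 _ _ q1, e1 _ _ q2]
        rcases ha.2.2 hab with h | ⟨h1, h2⟩
        · linarith [big _ _ h]
        · rw [← h1, ← h2, e2]; norm_num
    have p1 := pairWeight_nonneg b a
    have p2 := pairWeight_nonneg a b
    have := mul_le_of_le_one_left p1 (cosWeight_le_one a)
    have := mul_le_of_le_one_left p2 (cosWeight_le_one b)
    linarith
  · have hs := cosWeight_add_le a b h
    have hp : ∀ x y : ZMod N, pairWeight x y ≤ 5 / 2 := fun x y => by
      unfold pairWeight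
      linarith [edgeWeight_le (torusAbs x) (torusAbs (x - 2 * y)),
        edgeWeight_le (torusAbs x) (torusAbs (x + 2 * y))]
    -- The number `1.46` is `73/20` divided by the bound `5/2` on `pairWeight`.
    have h2 : Real.sqrt 2 ≤ 1.46 := by
      rw [Real.sqrt_le_left (by norm_num)]; norm_num
    have := mul_le_mul_of_nonneg_left (hp b a) ca
    have := mul_le_mul_of_nonneg_left (hp a b) cb
    linarith

/-- Schur's test. -/
theorem sum_sq_le_of_edge_bound (P Q : Torus N → ℝ) (hQ : ∀ u, 0 ≤ Q u)
    (hP0 : P 0 = 0)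
    (h : ∀ u, Q u ≤ (cosWeight u.1 * (P (u.1, u.2 - 2 * u.1) + P (u.1, u.2 + 2 * u.1)) +
      cosWeight u.2 * (P (u.1 - 2 * u.2, u.2) + P (u.1 + 2 * u.2, u.2))) / 4) :
    ∑ u, Q u ^ 2 ≤ (73 / 80) ^ 2 * ∑ u, P u ^ 2 := by
  let A (u v : Torus N) : ℝ := edgeWeight (torusAbs u.1) (torusAbs v.1)
  let B (u v : Torus N) : ℝ := edgeWeight (torusAbs u.2) (torusAbs v.2)
  let t₁ (u : Torus N) : Torus N := (u.1, u.2 - 2 * u.1)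
  let t₂ (u : Torus N) : Torus N := (u.1, u.2 + 2 * u.1)
  let t₃ (u : Torus N) : Torus N := (u.1 - 2 * u.2, u.2)
  let t₄ (u : Torus N) : Torus N := (u.1 + 2 * u.2, u.2)
  have row : ∀ u, Q u ^ 2 ≤ 73 / 320 *
      (cosWeight u.1 * B (t₁ u) u * P (t₁ u) ^ 2 + cosWeight u.1 * B (t₂ u) u * P (t₂ u) ^ 2 +
        cosWeight u.2 * A (t₃ u) u * P (t₃ u) ^ 2 + cosWeight u.2 * A (t₄ u) u * P (t₄ u) ^ 2) := by
    intro u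
    have ca := cosWeight_nonneg u.1
    have cb := cosWeight_nonneg u.2
    have Apos : ∀ u v, 0 ≤ A u v := fun u v => (edgeWeight_pos _ _).le
    have Bpos : ∀ u v, 0 ≤ B u v := fun u v => (edgeWeight_pos _ _).le
    have hS0 : 0 ≤ cosWeight u.1 * B (t₁ u) u * P (t₁ u) ^ 2 +
        cosWeight u.1 * B (t₂ u) u * P (t₂ u) ^ 2 +
        cosWeight u.2 * A (t₃ u) u * P (t₃ u) ^ 2 + cosWeight u.2 * A (t₄ u) u * P (t₄ u) ^ 2 := by
      have := Bpos (t₁ u) u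
      have := Bpos (t₂ u) u
      have := Apos (t₃ u) u
      have := Apos (t₄ u) u
      positivity
    -- The weight bound fails at frequency zero, where the four terms sum to 4. There, however, all
    -- four neighbours are zero too and `P` vanishes.
    by_cases hu : u = 0
    · have hq : Q u ≤ 0 := by
        refine (h u).trans (le_of_eq ?_)
        rw [hu]
        simp [show ((0, 0) : Torus N) = 0 from rfl, hP0]
      rw [le_antisymm hq (hQ u)]
      norm_num
      linarith
    · have hr := pairWeight_add_le u hu
      -- Weighted Cauchy–Schwarz: the weights of an edge in its two directions multiply to 1, so one
      -- is put on the row sum and the other on the squares.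
      have hcs := Finset.sum_sq_le_sum_mul_sum_of_sq_le_mul (Finset.univ : Finset (Fin 4))
        (r := ![cosWeight u.1 * P (t₁ u), cosWeight u.1 * P (t₂ u), cosWeight u.2 * P (t₃ u),
          cosWeight u.2 * P (t₄ u)])
        (f := ![cosWeight u.1 * B u (t₁ u), cosWeight u.1 * B u (t₂ u), cosWeight u.2 * A u (t₃ u),
          cosWeight u.2 * A u (t₄ u)])
        (g := ![cosWeight u.1 * B (t₁ u) u * P (t₁ u) ^ 2, cosWeight u.1 * B (t₂ u) u * P (t₂ u) ^ 2,
          cosWeight u.2 * A (t₃ u) u * P (t₃ u) ^ 2, cosWeight u.2 * A (t₄ u) u * P (t₄ u) ^ 2])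
        (by
          intro i _
          fin_cases i
          · exact mul_nonneg ca (Bpos _ _)
          · exact mul_nonneg ca (Bpos _ _)
          · exact mul_nonneg cb (Apos _ _)
          · exact mul_nonneg cb (Apos _ _))
        (by
          intro i _
          fin_cases i
          · exact mul_nonneg (mul_nonneg ca (Bpos _ _)) (sq_nonneg _)
          · exact mul_nonneg (mul_nonneg ca (Bpos _ _)) (sq_nonneg _)
          · exact mul_nonneg (mul_nonneg cb (Apos _ _)) (sq_nonneg _)
          · exact mul_nonneg (mul_nonneg cb (Apos _ _)) (sq_nonneg _))
        (by
          have hA : ∀ u v, A u v * A v u = 1 := fun u v => edgeWeight_mul _ _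
          have hB : ∀ u v, B u v * B v u = 1 := fun u v => edgeWeight_mul _ _
          intro i _
          fin_cases i
          · refine le_of_eq (show (_ * _) ^ 2 = (_ * _) * (_ * _ * _) from ?_)
            linear_combination (-(cosWeight u.1 * P (t₁ u)) ^ 2) * hB u (t₁ u)
          · refine le_of_eq (show (_ * _) ^ 2 = (_ * _) * (_ * _ * _) from ?_)
            linear_combination (-(cosWeight u.1 * P (t₂ u)) ^ 2) * hB u (t₂ u)
          · refine le_of_eq (show (_ * _) ^ 2 = (_ * _) * (_ * _ * _) from ?_)
            linear_combination (-(cosWeight u.2 * P (t₃ u)) ^ 2) * hA u (t₃ u)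
          · refine le_of_eq (show (_ * _) ^ 2 = (_ * _) * (_ * _ * _) from ?_)
            linear_combination (-(cosWeight u.2 * P (t₄ u)) ^ 2) * hA u (t₄ u))
      simp only [Fin.sum_univ_four, Matrix.cons_val] at hcs
      have hR : cosWeight u.1 * B u (t₁ u) + cosWeight u.1 * B u (t₂ u) +
          cosWeight u.2 * A u (t₃ u) + cosWeight u.2 * A u (t₄ u) ≤ 73 / 20 := by
        refine le_trans (le_of_eq ?_) hr
        simp only [pairWeight, A, B, t₁, t₂, t₃, t₄]
        ring
      have hq : Q u ^ 2 ≤ ((cosWeight u.1 * P (t₁ u) + cosWeight u.1 * P (t₂ u) +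
          cosWeight u.2 * P (t₃ u) + cosWeight u.2 * P (t₄ u)) / 4) ^ 2 := by
        refine pow_le_pow_left₀ (hQ u) ((h u).trans (le_of_eq ?_)) 2
        simp only [t₁, t₂, t₃, t₄]
        ring
      have := mul_le_mul_of_nonneg_right hR hS0
      linarith
  refine (Finset.sum_le_sum fun u _ => row u).trans ?_
  rw [← Finset.mul_sum]
  simp only [Finset.sum_add_distrib]
  -- Each shear fixes the coordinate that enters its cosine, and its inverse is the opposite shear.
  -- Reindexing therefore turns the column sums into row sums, to which `pairWeight_add_le` applies
  -- again.
  have s₁ : ∑ u, cosWeight u.1 * B (t₁ u) u * P (t₁ u) ^ 2 =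
      ∑ v, cosWeight v.1 * B v (t₂ v) * P v ^ 2 :=
    Finset.sum_nbij' t₁ t₂ (by simp) (by simp) (by simp [t₁, t₂]) (by simp [t₁, t₂])
      (by simp [t₁, t₂])
  have s₂ : ∑ u, cosWeight u.1 * B (t₂ u) u * P (t₂ u) ^ 2 =
      ∑ v, cosWeight v.1 * B v (t₁ v) * P v ^ 2 :=
    Finset.sum_nbij' t₂ t₁ (by simp) (by simp) (by simp [t₁, t₂]) (by simp [t₁, t₂])
      (by simp [t₁, t₂])
  have s₃ : ∑ u, cosWeight u.2 * A (t₃ u) u * P (t₃ u) ^ 2 =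
      ∑ v, cosWeight v.2 * A v (t₄ v) * P v ^ 2 :=
    Finset.sum_nbij' t₃ t₄ (by simp) (by simp) (by simp [t₃, t₄]) (by simp [t₃, t₄])
      (by simp [t₃, t₄])
  have s₄ : ∑ u, cosWeight u.2 * A (t₄ u) u * P (t₄ u) ^ 2 =
      ∑ v, cosWeight v.2 * A v (t₃ v) * P v ^ 2 :=
    Finset.sum_nbij' t₄ t₃ (by simp) (by simp) (by simp [t₃, t₄]) (by simp [t₃, t₄])
      (by simp [t₃, t₄])
  rw [s₁, s₂, s₃, s₄, ← Finset.sum_add_distrib, ← Finset.sum_add_distrib, ← Finset.sum_add_distrib,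
    Finset.mul_sum, Finset.mul_sum]
  refine Finset.sum_le_sum fun v _ => ?_
  by_cases hv : v = 0
  · simp [hv, hP0]
  · have hr := mul_le_mul_of_nonneg_right (pairWeight_add_le v hv) (sq_nonneg (P v))
    simp only [pairWeight] at hr
    simp only [A, B, t₁, t₂, t₃, t₄]
    linarith

/-- The eight labels form four pairs that share a shear and differ by a unit translation. A pair
acts on the Fourier side by a multiplier `1 + e(± a)` of absolute value `2 * cosWeight a`. Mean zero
makes the frequency 0 vanish, and Parseval transfers the bound back. -/
theorem sum_sq_torusAvg_le (f : Torus N → ℝ) (hf : ∑ z, f z = 0) :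
    ∑ z, torusAvg f z ^ 2 ≤ (73 / 80) ^ 2 * ∑ z, f z ^ 2 := by
  let F : Torus N → ℂ := fun z => (f z : ℂ)
  have hFT : ∀ u, torusFT (fun z => (torusAvg f z : ℂ)) u =
      ((1 + ZMod.stdAddChar u.1) * torusFT F (u.1, u.2 - 2 * u.1) +
        (1 + ZMod.stdAddChar (-u.1)) * torusFT F (u.1, u.2 + 2 * u.1) +
        (1 + ZMod.stdAddChar u.2) * torusFT F (u.1 - 2 * u.2, u.2) +
        (1 + ZMod.stdAddChar (-u.2)) * torusFT F (u.1 + 2 * u.2, u.2)) / 8 := by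
    intro u
    have a₁ := torusFT_shear_fst F 2 0 u
    have a₂ := torusFT_shear_fst F 2 1 u
    have a₃ := torusFT_shear_fst F (-2) 0 u
    have a₄ := torusFT_shear_fst F (-2) (-1) u
    have b₁ := torusFT_shear_snd F 2 0 u
    have b₂ := torusFT_shear_snd F 2 1 u
    have b₃ := torusFT_shear_snd F (-2) 0 u
    have b₄ := torusFT_shear_snd F (-2) (-1) u
    simp only [zero_mul, one_mul, neg_mul, sub_neg_eq_add, AddChar.map_zero_eq_one, add_zero] at *
    rw [add_mul, add_mul, add_mul, add_mul, one_mul, one_mul, one_mul, one_mul, ← a₂, ← a₁, ← a₄,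
      ← a₃, ← b₂, ← b₁, ← b₄, ← b₃]
    simp only [torusFT, ← Finset.sum_add_distrib, Finset.sum_div]
    refine Finset.sum_congr rfl fun z _ => ?_
    simp only [torusAvg, Finset.sum_range_succ, Finset.sum_range_zero, torusStep, displacement, F]
    norm_num
    simp only [← sub_eq_add_neg, sub_sub]
    simp only [← add_assoc]
    ring_nf
  have hN : (0 : ℝ) < (N : ℝ) ^ 2 := by
    have := NeZero.pos N
    positivity
  have hmain := sum_sq_le_of_edge_bound (fun u => ‖torusFT F u‖)
    (fun u => ‖torusFT (fun z => (torusAvg f z : ℂ)) u‖) (fun u => norm_nonneg _)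
    (by
      simp only [torusFT, F, Prod.fst_zero, Prod.snd_zero, zero_mul, add_zero, neg_zero,
        AddChar.map_zero_eq_one, mul_one, norm_eq_zero]
      exact_mod_cast hf)
    (by
      intro u
      have hneg : ∀ a : ZMod N, ‖(1 + ZMod.stdAddChar (-a) : ℂ)‖ = 2 * cosWeight a := by
        intro a
        rw [AddChar.map_neg_eq_conj, cosWeight, ← Complex.norm_conj]
        simp
        ring
      have hpos : ∀ a : ZMod N, ‖(1 + ZMod.stdAddChar a : ℂ)‖ = 2 * cosWeight a := by
        intro a
        rw [cosWeight]; ring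
      simp only [hFT]
      rw [norm_div]
      have h8 : ‖(8 : ℂ)‖ = 8 := by norm_num
      rw [h8]
      have e := norm_add₄_le (a := (1 + ZMod.stdAddChar u.1) * torusFT F (u.1, u.2 - 2 * u.1))
        (b := (1 + ZMod.stdAddChar (-u.1)) * torusFT F (u.1, u.2 + 2 * u.1))
        (c := (1 + ZMod.stdAddChar u.2) * torusFT F (u.1 - 2 * u.2, u.2))
        (d := (1 + ZMod.stdAddChar (-u.2)) * torusFT F (u.1 + 2 * u.2, u.2))
      rw [norm_mul, norm_mul, norm_mul, norm_mul, hneg, hneg, hpos, hpos] at e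
      linarith)
  rw [sum_norm_sq_torusFT, sum_norm_sq_torusFT] at hmain
  simp only [F, Complex.norm_real, Real.norm_eq_abs, sq_abs] at hmain
  rw [mul_left_comm] at hmain
  exact le_of_mul_le_mul_left hmain hN

end Torus

/-! ### Random walks and mixing -/

/-- The walk of `t` steps from `z` whose labels are the base-8 digits of `y`, the last one first. -/
def torusWalk {R : Type*} [Ring R] : ℕ → ℕ → R × R → R × R
  | 0, _, z => z
  | t + 1, y, z => torusWalk t (y / 8) (torusStep (y % 8) z)

theorem sum_range_mul_eq {M : Type*} [AddCommMonoid M] (a b : ℕ) (f : ℕ → M) :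
    ∑ y ∈ Finset.range (a * b), f y =
      ∑ l ∈ Finset.range a, ∑ y ∈ Finset.range b, f (a * y + l) := by
  rcases Nat.eq_zero_or_pos a with rfl | ha
  · simp
  rw [← Finset.sum_product']
  refine Finset.sum_nbij' (fun y => (y % a, y / a)) (fun p => a * p.2 + p.1) ?_ ?_ ?_ ?_ ?_
  · intro y hy
    simp only [Finset.mem_range, Finset.mem_product] at *
    exact ⟨Nat.mod_lt _ ha, Nat.div_lt_of_lt_mul hy⟩
  · rintro ⟨l, y⟩ hp
    simp only [Finset.mem_range, Finset.mem_product] at *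
    calc a * y + l < a * y + a := by omega
      _ = a * (y + 1) := by ring
      _ ≤ a * b := Nat.mul_le_mul_left _ hp.2
  · intro y _
    exact Nat.div_add_mod y a
  · rintro ⟨l, y⟩ hp
    simp only [Finset.mem_range, Finset.mem_product] at *
    rw [Nat.mul_add_mod, Nat.mod_eq_of_lt hp.1, Nat.mul_add_div ha, Nat.div_eq_of_lt hp.1, add_zero]
  · intro y _
    simp only [Nat.div_add_mod]

/-- Peeling off the lowest digit, which is the first label, shows that averaging over all label
strings iterates the averaging operator, so the spectral gap can be used. -/
theorem sum_torusWalk {N : ℕ} [NeZero N] (t : ℕ) (f : Torus N → ℝ) (z : Torus N) :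
    ∑ y ∈ Finset.range (8 ^ t), f (torusWalk t y z) = 8 ^ t * (torusAvg^[t] f) z := by
  induction t generalizing z with
  | zero => simp [torusWalk]
  | succ t ih =>
    rw [pow_succ', sum_range_mul_eq, Function.iterate_succ_apply', torusAvg, pow_succ',
      mul_div_assoc']
    have : ∀ l ∈ Finset.range 8, ∑ y ∈ Finset.range (8 ^ t), f (torusWalk (t + 1) (8 * y + l) z) =
        8 ^ t * (torusAvg^[t] f) (torusStep l z) := by
      intro l hl
      rw [← ih]
      refine Finset.sum_congr rfl fun y _ => ?_
      rw [Finset.mem_range] at hl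
      rw [torusWalk, Nat.mul_add_mod, Nat.mod_eq_of_lt hl, Nat.mul_add_div (by norm_num),
        Nat.div_eq_of_lt hl, add_zero]
    rw [Finset.sum_congr rfl this, ← Finset.mul_sum]
    ring

theorem sum_comp_torusStep {N : ℕ} [NeZero N] (l : ℕ) (f : Torus N → ℝ) :
    ∑ z, f (torusStep l z) = ∑ z, f z := by
  by_cases hl : l < 4
  · simp only [torusStep, hl, if_true]
    rw [Fintype.sum_prod_type_right, Fintype.sum_prod_type_right]
    refine Finset.sum_congr rfl fun y _ => ?_
    exact Equiv.sum_comp (Equiv.addRight (displacement l y)) (fun x => f (x, y))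
  · simp only [torusStep, hl, if_false]
    rw [Fintype.sum_prod_type, Fintype.sum_prod_type]
    refine Finset.sum_congr rfl fun x _ => ?_
    exact Equiv.sum_comp (Equiv.addRight (displacement (l - 4) x)) (fun y => f (x, y))

theorem sum_torusAvg {N : ℕ} [NeZero N] (f : Torus N → ℝ) : ∑ z, torusAvg f z = ∑ z, f z := by
  simp only [torusAvg, ← Finset.sum_div]
  rw [Finset.sum_comm]
  simp only [sum_comp_torusStep]
  simp

theorem sum_sq_torusAvg_iterate_le {N : ℕ} [NeZero N] (t : ℕ) (f : Torus N → ℝ)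
    (hf : ∑ z, f z = 0) :
    ∑ z, (torusAvg^[t] f) z = 0 ∧
      ∑ z, (torusAvg^[t] f) z ^ 2 ≤ ((73 / 80) ^ t) ^ 2 * ∑ z, f z ^ 2 := by
  induction t with
  | zero => simpa using hf
  | succ t ih =>
    rw [Function.iterate_succ_apply']
    refine ⟨by rw [sum_torusAvg]; exact ih.1, (sum_sq_torusAvg_le _ ih.1).trans ?_⟩
    calc _ ≤ (73 / 80 : ℝ) ^ 2 * (((73 / 80) ^ t) ^ 2 * ∑ z, f z ^ 2) :=
          mul_le_mul_of_nonneg_left ih.2 (by norm_num)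
      _ = _ := by ring

open Classical in
-- The spectral gap is applied to the indicator of `B` minus its density, followed by Cauchy–Schwarz
-- on `A`. Both `A.card` and the squared norm are bounded crudely by `N ^ 2`, which is harmless
-- because the error only has to be small against the number of all vertices.
theorem torusWalk_mixing {N : ℕ} [NeZero N] (t : ℕ) (A B : Finset (Torus N)) :
    ∑ z ∈ A, (((Finset.range (8 ^ t)).filter fun y => torusWalk t y z ∈ B).card : ℝ) ≤
      8 ^ t * (A.card * B.card / (N : ℝ) ^ 2 + (73 / 80) ^ t * (N : ℝ) ^ 2) := by
  have hN : (0 : ℝ) < N := by exact_mod_cast NeZero.pos N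
  have hcard : (Fintype.card (Torus N) : ℝ) = (N : ℝ) ^ 2 := by
    rw [Fintype.card_prod, ZMod.card]; push_cast; ring
  set β : ℝ := B.card / (N : ℝ) ^ 2 with hβ
  have hcB : (B.card : ℝ) ≤ (N : ℝ) ^ 2 := by rw [← hcard]; exact_mod_cast B.card_le_univ
  have hcA : (A.card : ℝ) ≤ (N : ℝ) ^ 2 := by rw [← hcard]; exact_mod_cast A.card_le_univ
  have hβ0 : 0 ≤ β := by positivity
  have hβ1 : β ≤ 1 := by rw [hβ, div_le_one (by positivity)]; exact hcB
  let f : Torus N → ℝ := fun z => (if z ∈ B then 1 else 0) - β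
  have hf : ∑ z, f z = 0 := by
    simp only [f, Finset.sum_sub_distrib, Finset.sum_const, Finset.card_univ, nsmul_eq_mul, hcard]
    rw [hβ, mul_div_cancel₀ _ (by positivity)]
    simp
  obtain ⟨-, hsq⟩ := sum_sq_torusAvg_iterate_le t f hf
  have hcount : ∀ z, (((Finset.range (8 ^ t)).filter fun y => torusWalk t y z ∈ B).card : ℝ) =
      8 ^ t * (torusAvg^[t] f) z + 8 ^ t * β := by
    intro z
    rw [← sum_torusWalk]
    simp [f]
  simp only [hcount, Finset.sum_add_distrib, ← Finset.mul_sum, Finset.sum_const, nsmul_eq_mul]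
  have hsqf : ∑ z, f z ^ 2 ≤ (N : ℝ) ^ 2 := by
    rw [← hcard, ← Finset.card_univ, ← nsmul_one, ← Finset.sum_const]
    refine Finset.sum_le_sum fun z _ => ?_
    simp only [f]
    split_ifs <;> nlinarith
  have hcs : (∑ z ∈ A, (torusAvg^[t] f) z) ^ 2 ≤ ((73 / 80) ^ t * (N : ℝ) ^ 2) ^ 2 := by
    calc _ ≤ (A.card : ℝ) * ∑ z ∈ A, (torusAvg^[t] f) z ^ 2 := sq_sum_le_card_mul_sum_sq
      _ ≤ (N : ℝ) ^ 2 * (((73 / 80) ^ t) ^ 2 * (N : ℝ) ^ 2) := by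
        refine mul_le_mul hcA ?_ (Finset.sum_nonneg fun _ _ => sq_nonneg _) (by positivity)
        refine (Finset.sum_le_sum_of_subset_of_nonneg A.subset_univ
          fun _ _ _ => sq_nonneg _).trans (hsq.trans ?_)
        exact mul_le_mul_of_nonneg_left hsqf (by positivity)
      _ = _ := by ring
  have hle := abs_le_of_sq_le_sq' hcs (by positivity)
  have h8 : (0 : ℝ) < 8 ^ t := by positivity
  have := mul_le_mul_of_nonneg_left hle.2 h8.le
  rw [mul_add, mul_div_assoc, ← hβ]
  linarith

/-! ### Walks on natural numbers -/

/-- A natural number that is congruent to `displacement l y` modulo `N`. -/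
def natDisplacement (N l y : ℕ) : ℕ :=
  match l with
  | 0 => 2 * y
  | 1 => 2 * y + 1
  | 2 => 2 * N - 2 * y
  | _ => 2 * N - (2 * y + 1)

/-- The step with label `l`, on representatives in `{0, …, N - 1}`. -/
def natStep (N l : ℕ) (p : ℕ × ℕ) : ℕ × ℕ :=
  if l < 4 then ((p.1 + natDisplacement N l p.2) % N, p.2)
  else (p.1, (p.2 + natDisplacement N (l - 4) p.1) % N)

/-- `torusWalk` on representatives in `{0, …, N - 1}`. -/
def natWalk (N : ℕ) : ℕ → ℕ → ℕ × ℕ → ℕ × ℕ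
  | 0, _, p => p
  | t + 1, y, p => natWalk N t (y / 8) (natStep N (y % 8) p)

/-- The walk on the numbers below `2 ^ (2 * h)`, regarded as pairs of numbers below `2 ^ h`. -/
def numWalk (h t y x : ℕ) : ℕ :=
  (natWalk (2 ^ h) t y (x / 2 ^ h, x % 2 ^ h)).1 * 2 ^ h +
    (natWalk (2 ^ h) t y (x / 2 ^ h, x % 2 ^ h)).2

/-- Since `2 * y + 1 ≤ 2 * N`, the truncated subtractions in `natDisplacement` are exact. -/
theorem natDisplacement_cast {N l y : ℕ} (hy : y < N) :
    (natDisplacement N l y : ZMod N) = displacement l (y : ZMod N) := by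
  unfold natDisplacement displacement
  split
  · simp
  · simp
  · rw [Nat.cast_sub (by omega)]; simp
  · rw [Nat.cast_sub (by omega)]; simp

theorem natStep_lt {N l : ℕ} {p : ℕ × ℕ} (hp : p.1 < N ∧ p.2 < N) :
    (natStep N l p).1 < N ∧ (natStep N l p).2 < N := by
  have hN : 0 < N := by omega
  unfold natStep
  split_ifs
  · exact ⟨Nat.mod_lt _ hN, hp.2⟩
  · exact ⟨hp.1, Nat.mod_lt _ hN⟩

theorem natStep_cast {N l : ℕ} {p : ℕ × ℕ} (hp : p.1 < N ∧ p.2 < N) :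
    (((natStep N l p).1 : ZMod N), ((natStep N l p).2 : ZMod N)) =
      torusStep l ((p.1 : ZMod N), (p.2 : ZMod N)) := by
  unfold natStep torusStep
  split_ifs
  · simp [natDisplacement_cast hp.2]
  · simp [natDisplacement_cast hp.1]

theorem natWalk_lt {N : ℕ} (t y : ℕ) {p : ℕ × ℕ} (hp : p.1 < N ∧ p.2 < N) :
    (natWalk N t y p).1 < N ∧ (natWalk N t y p).2 < N := by
  induction t generalizing y p with
  | zero => exact hp
  | succ t ih => exact ih _ (natStep_lt hp)

theorem natWalk_cast {N : ℕ} (t y : ℕ) {p : ℕ × ℕ} (hp : p.1 < N ∧ p.2 < N) :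
    (((natWalk N t y p).1 : ZMod N), ((natWalk N t y p).2 : ZMod N)) =
      torusWalk t y ((p.1 : ZMod N), (p.2 : ZMod N)) := by
  induction t generalizing y p with
  | zero => rfl
  | succ t ih => rw [natWalk, torusWalk, ih _ (natStep_lt hp), natStep_cast hp]

/-- The number below `2 ^ (2 * h)` that corresponds to a point of the torus. -/
def torusCode {h : ℕ} (z : Torus (2 ^ h)) : ℕ := z.1.val * 2 ^ h + z.2.val

theorem div_mod_lt {h x : ℕ} (hx : x < 2 ^ (2 * h)) : x / 2 ^ h < 2 ^ h ∧ x % 2 ^ h < 2 ^ h := by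
  refine ⟨Nat.div_lt_of_lt_mul ?_, Nat.mod_lt _ (by positivity)⟩
  rwa [← pow_add, ← two_mul]

theorem torusCode_cast {h : ℕ} {a b : ℕ} (ha : a < 2 ^ h) (hb : b < 2 ^ h) :
    torusCode (((a : ZMod (2 ^ h)), (b : ZMod (2 ^ h)))) = a * 2 ^ h + b := by
  simp only [torusCode]
  rw [ZMod.val_natCast_of_lt ha, ZMod.val_natCast_of_lt hb]

theorem numWalk_eq {h t y x : ℕ} (hx : x < 2 ^ (2 * h)) :
    numWalk h t y x =
      torusCode (torusWalk t y (((x / 2 ^ h : ℕ) : ZMod (2 ^ h)), ((x % 2 ^ h : ℕ) : ZMod (2 ^ h)))) := by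
  have h1 := natWalk_cast t y (p := (x / 2 ^ h, x % 2 ^ h)) (div_mod_lt hx)
  have h2 := natWalk_lt t y (p := (x / 2 ^ h, x % 2 ^ h)) (div_mod_lt hx)
  rw [← h1, torusCode_cast h2.1 h2.2, numWalk]

theorem torusCode_lt {h : ℕ} (z : Torus (2 ^ h)) : torusCode z < 2 ^ (2 * h) := by
  have h1 := ZMod.val_lt z.1
  have h2 := ZMod.val_lt z.2
  unfold torusCode
  calc _ < z.1.val * 2 ^ h + 2 ^ h := by omega
    _ = (z.1.val + 1) * 2 ^ h := by ring
    _ ≤ 2 ^ h * 2 ^ h := Nat.mul_le_mul_right _ h1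
    _ = 2 ^ (2 * h) := by rw [← pow_add, two_mul]

theorem numWalk_lt {h t y x : ℕ} (hx : x < 2 ^ (2 * h)) : numWalk h t y x < 2 ^ (2 * h) := by
  rw [numWalk_eq hx]; exact torusCode_lt _

theorem decode_torusCode {h : ℕ} (z : Torus (2 ^ h)) :
    (((torusCode z / 2 ^ h : ℕ) : ZMod (2 ^ h)), ((torusCode z % 2 ^ h : ℕ) : ZMod (2 ^ h))) = z := by
  have h2 := ZMod.val_lt z.2
  unfold torusCode
  rw [mul_comm, Nat.mul_add_div (by positivity), Nat.mul_add_mod, Nat.div_eq_of_lt h2,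
    Nat.mod_eq_of_lt h2, add_zero, ZMod.natCast_zmod_val, ZMod.natCast_zmod_val]

open Classical in
-- The mixing bound on the torus, transported along the bijection between its points and the numbers
-- below `2 ^ (2 * h)`, which serve as seeds.
theorem numWalk_mixing (h t : ℕ) (A B : ℕ → Prop) :
    ∑ x ∈ (Finset.range (2 ^ (2 * h))).filter A,
        (((Finset.range (8 ^ t)).filter fun y => B (numWalk h t y x)).card : ℝ) ≤
      8 ^ t * (((Finset.range (2 ^ (2 * h))).filter A).card *
        ((Finset.range (2 ^ (2 * h))).filter B).card / 2 ^ (2 * h) +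
          (73 / 80) ^ t * 2 ^ (2 * h)) := by
  let dec : ℕ → Torus (2 ^ h) := fun x =>
    (((x / 2 ^ h : ℕ) : ZMod (2 ^ h)), ((x % 2 ^ h : ℕ) : ZMod (2 ^ h)))
  have hcode : ∀ x, x < 2 ^ (2 * h) → torusCode (dec x) = x := fun x hx => by
    rw [torusCode_cast (div_mod_lt hx).1 (div_mod_lt hx).2, mul_comm, Nat.div_add_mod]
  have hcard : ∀ P : ℕ → Prop, ((Finset.range (2 ^ (2 * h))).filter P).card =
      (Finset.univ.filter fun z : Torus (2 ^ h) => P (torusCode z)).card := by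
    intro P
    refine Finset.card_nbij' dec torusCode ?_ ?_ ?_ ?_
    · intro x hx
      simp only [Finset.coe_filter, Finset.mem_range, Set.mem_ofPred_eq, Finset.mem_univ,
        true_and] at *
      rw [hcode x hx.1]; exact hx.2
    · intro z hz
      simp only [Finset.coe_filter, Finset.mem_range, Set.mem_ofPred_eq, Finset.mem_univ,
        true_and] at *
      exact ⟨torusCode_lt z, hz⟩
    · intro x hx
      simp only [Finset.coe_filter, Finset.mem_range, Set.mem_ofPred_eq] at hx
      exact hcode x hx.1
    · intro z _
      exact decode_torusCode z
  have hmix := torusWalk_mixing t (Finset.univ.filter fun z : Torus (2 ^ h) => A (torusCode z))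
    (Finset.univ.filter fun z : Torus (2 ^ h) => B (torusCode z))
  rw [hcard A, hcard B]
  have h2 : ((2 ^ h : ℕ) : ℝ) ^ 2 = 2 ^ (2 * h) := by push_cast; rw [← pow_mul, mul_comm]
  rw [h2] at hmix
  refine le_trans (le_of_eq ?_) hmix
  refine Finset.sum_nbij' dec torusCode ?_ ?_ ?_ ?_ ?_
  · intro x hx
    simp only [Finset.mem_filter, Finset.mem_range, Finset.mem_univ, true_and] at *
    rw [hcode x hx.1]; exact hx.2
  · intro z hz
    simp only [Finset.mem_filter, Finset.mem_range, Finset.mem_univ, true_and] at *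
    exact ⟨torusCode_lt z, hz⟩
  · intro x hx
    simp only [Finset.mem_filter, Finset.mem_range] at hx
    exact hcode x hx.1
  · intro z _
    exact decode_torusCode z
  · intro x hx
    simp only [Finset.mem_filter, Finset.mem_range] at hx
    simp only [Finset.mem_filter, Finset.mem_univ, true_and, numWalk_eq hx.1, dec]

/-! ### Adaptive processes with few branches -/

/-- The state after `r` steps from `s` on the inputs `x 0, x 1, …`. -/
def endState {S X : Type*} (step : S → X → S) : ℕ → S → (ℕ → X) → S
  | 0, s, _ => s
  | r + 1, s, x => endState step r (step s (x 0)) fun i => x (i + 1)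

/-- One of the first `r` inputs `x 0, x 1, …` is bad for the state in which it is read; the time
at the beginning is `j`. -/
def EverBad {S X : Type*} (step : S → X → S) (bad : ℕ → S → X → Prop) :
    ℕ → ℕ → S → (ℕ → X) → Prop
  | 0, _, _, _ => False
  | r + 1, j, s, x => bad j s (x 0) ∨ EverBad step bad r (j + 1) (step s (x 0)) fun i => x (i + 1)

section Adaptive

variable {S X : Type*} {step : S → X → S} {bad : ℕ → S → X → Prop}

theorem everBad_add (r r' j : ℕ) (s : S) (x : ℕ → X) :
    EverBad step bad (r + r') j s x ↔ EverBad step bad r j s x ∨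
      EverBad step bad r' (j + r) (endState step r s x) fun i => x (r + i) := by
  induction r generalizing j s x with
  | zero => simp [EverBad, endState]
  | succ r ih =>
    rw [show r + 1 + r' = (r + r') + 1 by ring, EverBad, EverBad, endState, ih, or_assoc,
      show j + 1 + r = j + (r + 1) by ring]
    simp only [show ∀ i, r + i + 1 = r + 1 + i from fun i => by ring]

theorem everBad_congr {r : ℕ} {x x' : ℕ → X} (h : ∀ i < r, x i = x' i) (j : ℕ) (s : S) :
    EverBad step bad r j s x ↔ EverBad step bad r j s x' := by
  induction r generalizing j s x x' with
  | zero => simp [EverBad]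
  | succ r ih => rw [EverBad, EverBad, h 0 (by omega), ih fun i hi => h (i + 1) (by omega)]

theorem endState_congr {r : ℕ} {x x' : ℕ → X} (h : ∀ i < r, x i = x' i) (s : S) :
    endState step r s x = endState step r s x' := by
  induction r generalizing s x x' with
  | zero => simp [endState]
  | succ r ih => rw [endState, endState, h 0 (by omega), ih fun i hi => h (i + 1) (by omega)]

open Classical in
-- This bounds the number of states over which the analysis of the generator splits the first half
-- of the rounds.
theorem exists_endStates {K : ℕ} (hstep : ∀ s, ∃ T : Finset S, T.card ≤ K ∧ ∀ x, step s x ∈ T)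
    (r : ℕ) (s : S) : ∃ T : Finset S, T.card ≤ K ^ r ∧ ∀ x, endState step r s x ∈ T := by
  induction r generalizing s with
  | zero => exact ⟨{s}, by simp, fun x => by simp [endState]⟩
  | succ r ih =>
    obtain ⟨T, hT, hs⟩ := hstep s
    choose U hU hmem using ih
    refine ⟨T.biUnion U, ?_, fun x => ?_⟩
    · calc _ ≤ T.card * K ^ r := Finset.card_biUnion_le_card_mul _ _ _ fun s _ => hU s
        _ ≤ K * K ^ r := Nat.mul_le_mul_right _ hT
        _ = K ^ (r + 1) := by ring
    · rw [endState, Finset.mem_biUnion]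
      exact ⟨_, hs _, hmem _ _⟩

end Adaptive

/-! ### The generator -/

/-- Half of the seed length at level `i` of the generator. -/
def halfLength (D e h₀ : ℕ) : ℕ → ℕ
  | 0 => h₀
  | i + 1 => halfLength D e h₀ i + 12 * (D * 2 ^ i + e)

/-- The block with index `r < 2 ^ i` of the output of the generator of level `i` on the seed `z`. -/
def generator (D e h₀ : ℕ) : ℕ → ℕ → ℕ → ℕ
  | 0, z, _ => z
  | i + 1, z, r =>
    if 2 ^ i ≤ r then
      generator D e h₀ i (numWalk (halfLength D e h₀ i) (8 * (D * 2 ^ i + e))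
        (z / 2 ^ (2 * halfLength D e h₀ i)) (z % 2 ^ (2 * halfLength D e h₀ i))) (r - 2 ^ i)
    else generator D e h₀ i (z % 2 ^ (2 * halfLength D e h₀ i)) r

/-- A level adds `8 * w` labels of three bits, where `w = D * 2 ^ i + e`. That is 24 `w` bits,
whence the 12 in `halfLength`. -/
theorem two_pow_halfLength_succ (D e h₀ i : ℕ) :
    2 ^ (2 * halfLength D e h₀ (i + 1)) =
      2 ^ (2 * halfLength D e h₀ i) * 8 ^ (8 * (D * 2 ^ i + e)) := by
  rw [show (8 : ℕ) = 2 ^ 3 by norm_num, ← pow_mul, ← pow_add, halfLength]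
  congr 1
  ring

theorem generator_lt (D e h₀ i z r : ℕ) (hz : z < 2 ^ (2 * halfLength D e h₀ i)) :
    generator D e h₀ i z r < 2 ^ (2 * h₀) := by
  induction i generalizing z r with
  | zero => exact hz
  | succ i ih =>
    have h : z % 2 ^ (2 * halfLength D e h₀ i) < 2 ^ (2 * halfLength D e h₀ i) :=
      Nat.mod_lt _ (by positivity)
    rw [generator]
    split_ifs
    · exact ih _ _ (numWalk_lt h)
    · exact ih _ _ h

open Classical in
-- Induction on the level. A bad seed is bad in the first half, or it is bad in the second half from
-- some state `v` reached by the first. For fixed `v` both conditions are about single vertices, the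
-- start and the end of the walk, so mixing makes them nearly independent. Each of the `2 ^ i - 1`
-- joins costs at most `(1 / 2) ^ e`.
theorem generator_everBad_card_le {S X : Type*} {step : S → X → S} {bad : ℕ → S → X → Prop}
    {K D : ℕ} (e h₀ : ℕ) (hK : K ≤ 2 ^ D)
    (hstep : ∀ s, ∃ T : Finset S, T.card ≤ K ∧ ∀ x, step s x ∈ T) (dec : ℕ → X) (δ : ℕ → ℝ)
    (hbad : ∀ j s, (((Finset.range (2 ^ (2 * h₀))).filter fun v => bad j s (dec v)).card : ℝ) ≤
      2 ^ (2 * h₀) * δ j) (i j : ℕ) (s : S) :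
    (((Finset.range (2 ^ (2 * halfLength D e h₀ i))).filter fun z =>
      EverBad step bad (2 ^ i) j s fun r => dec (generator D e h₀ i z r)).card : ℝ) ≤
      2 ^ (2 * halfLength D e h₀ i) *
        (∑ j' ∈ Finset.range (2 ^ i), δ (j + j') + (2 ^ i - 1) * (1 / 2) ^ e) := by
  induction i generalizing j s with
  | zero =>
    simpa [halfLength, generator, EverBad] using hbad j s
  | succ i ih =>
    set h := halfLength D e h₀ i with hh
    set w := D * 2 ^ i + e with hw
    obtain ⟨T, hTc, hT⟩ := exists_endStates hstep (2 ^ i) s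
    let G : ℕ → ℕ → X := fun z r => dec (generator D e h₀ i z r)
    let A : S → ℕ → Prop := fun v x => endState step (2 ^ i) s (G x) = v
    let B : S → ℕ → Prop := fun v x => EverBad step bad (2 ^ i) (j + 2 ^ i) v (G x)
    have hdec : ∀ x ∈ Finset.range (2 ^ (2 * h)), ∀ y,
        EverBad step bad (2 ^ (i + 1)) j s
            (fun r => dec (generator D e h₀ (i + 1) (2 ^ (2 * h) * y + x) r)) ↔
          EverBad step bad (2 ^ i) j s (G x) ∨
            B (endState step (2 ^ i) s (G x)) (numWalk h (8 * w) y x) := by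
      intro x hx y
      rw [Finset.mem_range] at hx
      have hd : (2 ^ (2 * h) * y + x) / 2 ^ (2 * h) = y := by
        rw [Nat.mul_add_div (by positivity), Nat.div_eq_of_lt hx, add_zero]
      have hm : (2 ^ (2 * h) * y + x) % 2 ^ (2 * h) = x := by
        rw [Nat.mul_add_mod, Nat.mod_eq_of_lt hx]
      have e1 : ∀ r < 2 ^ i, dec (generator D e h₀ (i + 1) (2 ^ (2 * h) * y + x) r) = G x r := by
        intro r hr
        simp only [generator, G, ← hh, hm, if_neg (not_le.2 hr)]
      have e2 : ∀ r, dec (generator D e h₀ (i + 1) (2 ^ (2 * h) * y + x) (2 ^ i + r)) =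
          G (numWalk h (8 * w) y x) r := by
        intro r
        simp only [generator, G, ← hh, ← hw, hm, hd, if_pos (Nat.le_add_right _ r),
          Nat.add_sub_cancel_left]
      rw [pow_succ, mul_two, everBad_add, everBad_congr e1, endState_congr e1]
      simp only [e2, B, G]
    -- Eight steps contract by more than a factor 2. The first `D * 2 ^ i` halvings pay for the
    -- number of states, and the other `e` are the error that is left.
    have hη : (T.card : ℝ) * (73 / 80) ^ (8 * w) ≤ (1 / 2) ^ e := by
      have h1 : (T.card : ℝ) ≤ 2 ^ (D * 2 ^ i) := by
        rw [pow_mul]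
        exact_mod_cast hTc.trans (Nat.pow_le_pow_left hK _)
      calc (T.card : ℝ) * (73 / 80) ^ (8 * w) ≤ 2 ^ (D * 2 ^ i) * (1 / 2) ^ w := by
            rw [pow_mul]
            gcongr
            norm_num
        _ = (1 / 2) ^ e := by
            rw [hw, pow_add, ← mul_assoc, ← mul_pow]
            norm_num
    -- The sets `A v` are the fibres of the end state, so the main terms of the mixing bounds add up
    -- to a single copy of `b`.
    have hdisj : ∑ v ∈ T, (((Finset.range (2 ^ (2 * h))).filter (A v)).card : ℝ) ≤
        2 ^ (2 * h) := by
      have : ∑ v ∈ T, ((Finset.range (2 ^ (2 * h))).filter (A v)).card =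
          (Finset.range (2 ^ (2 * h))).card :=
        (Finset.card_eq_sum_card_fiberwise fun x _ => hT (G x)).symm
      rw [Finset.card_range] at this
      exact_mod_cast this.le
    have hbound : (((Finset.range (2 ^ (2 * halfLength D e h₀ (i + 1)))).filter fun z =>
        EverBad step bad (2 ^ (i + 1)) j s fun r => dec (generator D e h₀ (i + 1) z r)).card : ℝ) ≤
        8 ^ (8 * w) * ((Finset.range (2 ^ (2 * h))).filter fun z =>
          EverBad step bad (2 ^ i) j s (G z)).card +
        ∑ v ∈ T, ∑ x ∈ (Finset.range (2 ^ (2 * h))).filter (A v),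
          (((Finset.range (8 ^ (8 * w))).filter fun y => B v (numWalk h (8 * w) y x)).card : ℝ) := by
      rw [two_pow_halfLength_succ, Finset.card_filter, ← hh, ← hw, sum_range_mul_eq]
      have hcomm : ∑ v ∈ T, ∑ x ∈ (Finset.range (2 ^ (2 * h))).filter (A v),
          (((Finset.range (8 ^ (8 * w))).filter fun y => B v (numWalk h (8 * w) y x)).card : ℝ) =
          ∑ x ∈ Finset.range (2 ^ (2 * h)), (((Finset.range (8 ^ (8 * w))).filter fun y =>
            B (endState step (2 ^ i) s (G x)) (numWalk h (8 * w) y x)).card : ℝ) := by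
        rw [← Finset.sum_fiberwise_of_maps_to (t := T) (g := fun x => endState step (2 ^ i) s (G x))
          fun x _ => hT (G x)]
        refine Finset.sum_congr rfl fun v _ => Finset.sum_congr rfl fun x hx => ?_
        rw [(Finset.mem_filter.1 hx).2]
      rw [hcomm, Finset.card_filter]
      push_cast
      rw [Finset.mul_sum, ← Finset.sum_add_distrib]
      refine Finset.sum_le_sum fun x hx => ?_
      have h8 : (8 : ℝ) ^ (8 * w) * (if EverBad step bad (2 ^ i) j s (G x) then 1 else 0) =
          ∑ y ∈ Finset.range (8 ^ (8 * w)),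
            (if EverBad step bad (2 ^ i) j s (G x) then (1 : ℝ) else 0) := by
        rw [Finset.sum_const, Finset.card_range, nsmul_eq_mul]; push_cast; rfl
      rw [h8, Finset.card_filter, Nat.cast_sum, ← Finset.sum_add_distrib]
      refine Finset.sum_le_sum fun y _ => ?_
      simp only [hdec x hx y]
      split_ifs with h1 h2 h3 h4 h5 <;> first | tauto | norm_num
    refine hbound.trans ?_
    set b : ℝ := ∑ j' ∈ Finset.range (2 ^ i), δ (j + 2 ^ i + j') + (2 ^ i - 1) * (1 / 2) ^ e with hb
    have hP : (0 : ℝ) < 2 ^ (2 * h) := by positivity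
    have h8 : (0 : ℝ) < 8 ^ (8 * w) := by positivity
    -- No sign of `δ` is assumed; `b` is nonnegative because by induction it bounds a cardinality.
    have hb0 : 0 ≤ b := by
      have := (Nat.cast_nonneg _).trans (ih (j + 2 ^ i) s)
      exact nonneg_of_mul_nonneg_right this hP
    have hv : ∀ v ∈ T, ∑ x ∈ (Finset.range (2 ^ (2 * h))).filter (A v),
        (((Finset.range (8 ^ (8 * w))).filter fun y => B v (numWalk h (8 * w) y x)).card : ℝ) ≤
        8 ^ (8 * w) * (b * ((Finset.range (2 ^ (2 * h))).filter (A v)).card +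
          (73 / 80) ^ (8 * w) * 2 ^ (2 * h)) := by
      intro v _
      refine (numWalk_mixing h (8 * w) (A v) (B v)).trans ?_
      gcongr
      rw [div_le_iff₀ hP]
      calc _ ≤ (((Finset.range (2 ^ (2 * h))).filter (A v)).card : ℝ) * (2 ^ (2 * h) * b) :=
            mul_le_mul_of_nonneg_left (ih (j + 2 ^ i) v) (Nat.cast_nonneg _)
        _ = _ := by ring
    have hsum := Finset.sum_le_sum hv
    rw [← Finset.mul_sum, Finset.sum_add_distrib, ← Finset.mul_sum, Finset.sum_const,
      nsmul_eq_mul] at hsum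
    have hfirst := mul_le_mul_of_nonneg_left (ih j s) h8.le
    have hrest : b * ∑ v ∈ T, (((Finset.range (2 ^ (2 * h))).filter (A v)).card : ℝ) +
        T.card * ((73 / 80) ^ (8 * w) * 2 ^ (2 * h)) ≤ 2 ^ (2 * h) * (b + (1 / 2) ^ e) := by
      have q1 := mul_le_mul_of_nonneg_left hdisj hb0
      have q2 := mul_le_mul_of_nonneg_right hη hP.le
      linarith
    have hrest' := mul_le_mul_of_nonneg_left hrest h8.le
    have hpow : (2 : ℝ) ^ (2 * halfLength D e h₀ (i + 1)) = 2 ^ (2 * h) * 8 ^ (8 * w) := by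
      exact_mod_cast two_pow_halfLength_succ D e h₀ i
    rw [hpow, pow_succ 2 i, mul_two, Finset.sum_range_add]
    simp only [← add_assoc] at *
    rw [pow_succ (2 : ℝ) i]
    rw [hb] at hsum hrest'
    linarith

/-! ### Shifting and rounding -/

/-- `x` rounded down to a multiple of `y`. -/
def roundTo (x y : ℝ) : ℝ := (⌊x / y⌋ : ℝ) * y

/-- The width of the cells to which coordinates are rounded. -/
def cellWidth (ε : ℝ) (d₀ : ℕ) : ℝ := ((d₀ + 1 : ℕ) : ℝ) * (2 * ε)

/-- After the shift with index `D`, none of the `ε`-neighbourhoods of the coordinates of `W` in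
`[b, e)` meets two cells. -/
def GoodShift (ε : ℝ) (d₀ : ℕ) (W : ℕ → ℝ) (b e D : ℕ) : Prop :=
  ∀ j, b ≤ j → j < e → ¬ roundTo (W j - ε + D * (2 * ε)) (cellWidth ε d₀) <
    roundTo (W j + ε + D * (2 * ε)) (cellWidth ε d₀)

open Classical in
/-- The last number below `m` that satisfies `P`, or `0`. -/
def lastBelow (P : ℕ → Prop) : ℕ → ℕ
  | 0 => 0
  | m + 1 => if P m then m else lastBelow P m

theorem lastBelow_spec {P : ℕ → Prop} {m : ℕ} (h : ∃ i < m, P i) :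
    lastBelow P m < m ∧ P (lastBelow P m) := by
  induction m with
  | zero => simp at h
  | succ m ih =>
    rw [lastBelow]
    split_ifs with hm
    · exact ⟨Nat.lt_succ_self m, hm⟩
    · obtain ⟨i, hi, hP⟩ := h
      have : i ≠ m := fun h => hm (h ▸ hP)
      have := ih ⟨i, by omega, hP⟩
      exact ⟨by omega, this.2⟩

/-- The first coordinate after the block that begins at `b`. -/
def blockEnd (d d₀ b : ℕ) : ℕ := min (b + d₀) d

/-- The index of the shift of the block that begins at `b`. -/
def blockShift (ε : ℝ) (d d₀ : ℕ) (W : ℕ → ℝ) (b : ℕ) : ℕ :=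
  lastBelow (GoodShift ε d₀ W b (blockEnd d d₀ b)) (d₀ + 1)

/-- The coordinate `x`, shifted and rounded. -/
def shiftRound (ε : ℝ) (d₀ D : ℕ) (x : ℝ) : ℝ := roundTo (x + D * (2 * ε)) (cellWidth ε d₀)

/-- `W`, with each block of coordinates shifted and rounded. -/
def roundSeq (ε : ℝ) (d d₀ : ℕ) (W : ℕ → ℝ) (j : ℕ) : ℝ :=
  shiftRound ε d₀ (blockShift ε d d₀ W (j / d₀ * d₀)) (W j)

theorem cellWidth_pos {ε : ℝ} (hε : 0 < ε) (d₀ : ℕ) : 0 < cellWidth ε d₀ := by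
  unfold cellWidth; positivity

theorem roundTo_lt_roundTo {x y c : ℝ} (hc : 0 < c) :
    roundTo x c < roundTo y c ↔ ⌊x / c⌋ < ⌊y / c⌋ := by
  unfold roundTo
  rw [mul_lt_mul_iff_left₀ hc]
  exact_mod_cast Iff.rfl

theorem roundTo_le {x c : ℝ} (hc : 0 < c) : roundTo x c ≤ x := by
  unfold roundTo
  have := Int.floor_le (x / c)
  rwa [le_div_iff₀ hc] at this

theorem lt_roundTo_add {x c : ℝ} (hc : 0 < c) : x < roundTo x c + c := by
  unfold roundTo
  have := Int.lt_floor_add_one (x / c)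
  rw [div_lt_iff₀ hc] at this
  linarith

/-- A bad shift puts a cell boundary into the half-open interval of length `2 * ε` around the
shifted point. Intervals of different shifts are disjoint, so the two boundaries would be at least a
cell width apart. Both, however, lie in a half-open interval of length `2ε(D' - D + 1)`, which is at
most that width. -/
theorem not_two_bad_shifts {ε x : ℝ} (hε : 0 < ε) {d₀ D D' : ℕ} (h : D < D') (hD' : D' ≤ d₀)
    (h1 : roundTo (x - ε + D * (2 * ε)) (cellWidth ε d₀) <
      roundTo (x + ε + D * (2 * ε)) (cellWidth ε d₀))
    (h2 : roundTo (x - ε + D' * (2 * ε)) (cellWidth ε d₀) <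
      roundTo (x + ε + D' * (2 * ε)) (cellWidth ε d₀)) : False := by
  have hc := cellWidth_pos hε d₀
  set c := cellWidth ε d₀ with hcd
  rw [roundTo_lt_roundTo hc, Int.floor_lt, div_lt_iff₀ hc] at h1
  rw [roundTo_lt_roundTo hc, ← Int.add_one_le_iff, Int.le_floor, le_div_iff₀ hc] at h2
  have hDD : (D : ℝ) + 1 ≤ D' := by exact_mod_cast h
  have hm : ⌊(x + ε + D * (2 * ε)) / c⌋ ≤ ⌊(x - ε + D' * (2 * ε)) / c⌋ := by
    refine Int.floor_le_floor (div_le_div_of_nonneg_right ?_ hc.le)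
    nlinarith [mul_le_mul_of_nonneg_right hDD hε.le]
  have hm' : (⌊(x + ε + D * (2 * ε)) / c⌋ : ℝ) ≤ ⌊(x - ε + D' * (2 * ε)) / c⌋ := by
    exact_mod_cast hm
  have hmul := mul_le_mul_of_nonneg_right hm' hc.le
  push_cast at h2
  have hd : (D' : ℝ) ≤ d₀ := by exact_mod_cast hD'
  have hcv : c = (d₀ + 1) * (2 * ε) := by rw [hcd, cellWidth]; push_cast; ring
  have hD0 : (0 : ℝ) ≤ D := Nat.cast_nonneg D
  nlinarith [mul_le_mul_of_nonneg_right hd hε.le, mul_nonneg hD0 hε.le]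

theorem exists_goodShift {ε : ℝ} (hε : 0 < ε) {d₀ b e : ℕ} (he : e ≤ b + d₀) (W : ℕ → ℝ) :
    ∃ D < d₀ + 1, GoodShift ε d₀ W b e D := by
  by_contra! hcon
  have hbad : ∀ D, ∃ j, D < d₀ + 1 → (b ≤ j ∧ j < e) ∧
      roundTo (W j - ε + D * (2 * ε)) (cellWidth ε d₀) <
        roundTo (W j + ε + D * (2 * ε)) (cellWidth ε d₀) := by
    intro D
    by_cases hD : D < d₀ + 1
    · have := hcon D hD
      unfold GoodShift at this
      push Not at this
      obtain ⟨j, h1, h2, h3⟩ := this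
      exact ⟨j, fun _ => ⟨⟨h1, h2⟩, h3⟩⟩
    · exact ⟨0, fun h => absurd h hD⟩
  choose F hF using hbad
  -- Otherwise the `d₀ + 1` shifts would be mapped to at most `d₀` coordinates that they spoil, and
  -- two of them would share a coordinate.
  obtain ⟨D, hD, D', hD', hne, heq⟩ := Finset.exists_ne_map_eq_of_card_lt_of_maps_to
    (s := Finset.range (d₀ + 1)) (t := Finset.Ico b e) (f := F)
    (by rw [Finset.card_range, Nat.card_Ico]; omega)
    (fun D hD => by
      have := hF D (by simpa using hD)
      simpa using this.1)
  rw [Finset.mem_range] at hD hD'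
  have h1 := (hF D hD).2
  have h2 := (hF D' hD').2
  rcases lt_or_gt_of_ne hne with h | h
  · rw [← heq] at h2
    exact not_two_bad_shifts hε h (by omega) h1 h2
  · rw [heq] at h1
    exact not_two_bad_shifts hε h (by omega) h2 h1

theorem blockShift_spec {ε : ℝ} (hε : 0 < ε) (d d₀ : ℕ) (W : ℕ → ℝ) (b : ℕ) :
    blockShift ε d d₀ W b < d₀ + 1 ∧
      GoodShift ε d₀ W b (blockEnd d d₀ b) (blockShift ε d d₀ W b) :=
  lastBelow_spec (exists_goodShift hε (min_le_left _ _) W)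

theorem mem_block {d d₀ j : ℕ} (hd₀ : 0 < d₀) (hj : j < d) :
    j / d₀ * d₀ ≤ j ∧ j < blockEnd d d₀ (j / d₀ * d₀) := by
  refine ⟨Nat.div_mul_le_self j d₀, lt_min ?_ hj⟩
  have := Nat.lt_div_mul_add hd₀ (a := j)
  omega

theorem shiftRound_eq {ε x y : ℝ} (hε : 0 < ε) {d₀ D : ℕ} (hxy : |x - y| ≤ ε)
    (h : ¬ roundTo (x - ε + D * (2 * ε)) (cellWidth ε d₀) <
      roundTo (x + ε + D * (2 * ε)) (cellWidth ε d₀)) :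
    shiftRound ε d₀ D x = shiftRound ε d₀ D y := by
  have hc := cellWidth_pos hε d₀
  rw [roundTo_lt_roundTo hc, not_lt] at h
  obtain ⟨h1, h2⟩ := abs_le.1 hxy
  have key : ∀ v, x - ε ≤ v → v ≤ x + ε → ⌊(v + D * (2 * ε)) / cellWidth ε d₀⌋ =
      ⌊(x - ε + D * (2 * ε)) / cellWidth ε d₀⌋ := by
    intro v hv1 hv2
    apply le_antisymm
    · refine le_trans (Int.floor_le_floor ?_) h
      gcongr
    · apply Int.floor_le_floor
      gcongr
  unfold shiftRound roundTo
  rw [key x (by linarith) (by linarith), key y (by linarith) (by linarith)]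

/-- The shift raises `x` by at most `2εd₀`, and rounding lowers it by less than `2ε(d₀ + 1) ≤ 4εd₀`.
-/
theorem abs_shiftRound_sub_le {ε : ℝ} (hε : 0 < ε) {d₀ D : ℕ} (hd₀ : 1 ≤ d₀) (hD : D ≤ d₀) (x : ℝ) :
    |shiftRound ε d₀ D x - x| ≤ 6 * (ε * d₀) := by
  have hc := cellWidth_pos hε d₀
  have h1 := roundTo_le (x := x + D * (2 * ε)) hc
  have h2 := lt_roundTo_add (x := x + D * (2 * ε)) hc
  have hcv : cellWidth ε d₀ = (d₀ + 1) * (2 * ε) := by rw [cellWidth]; push_cast; ring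
  have hd : (D : ℝ) ≤ d₀ := by exact_mod_cast hD
  have hd1 : (1 : ℝ) ≤ d₀ := by exact_mod_cast hd₀
  have := mul_le_mul_of_nonneg_right hd hε.le
  have := mul_le_mul_of_nonneg_right hd1 hε.le
  have : 0 ≤ (D : ℝ) * ε := by positivity
  unfold shiftRound
  rw [abs_le]
  constructor <;> nlinarith

/-- A vector, continued by zeros. -/
def extendVec {d : ℕ} (v : Fin d → ℝ) (j : ℕ) : ℝ := if h : j < d then v ⟨j, h⟩ else 0

/-- The answer to the value `v` of the current function. -/
def roundVec (ε : ℝ) (d₀ : ℕ) {d : ℕ} (v : Fin d → ℝ) : Fin d → ℝ :=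
  fun j => roundSeq ε d d₀ (extendVec v) j

/-- `μ` shifted and rounded, with the shifts that are chosen for `v`. -/
def roundLike (ε : ℝ) (d₀ : ℕ) {d : ℕ} (v μ : Fin d → ℝ) : Fin d → ℝ :=
  fun j => shiftRound ε d₀ (blockShift ε d d₀ (extendVec v) (j / d₀ * d₀)) (μ j)

/-- The shifts are computed from the observed `v` alone, but they are good on its whole
`ε`-neighbourhood, which contains the unknown `μ`. This removes the dependence of a good answer on
`v`, apart from the shifts. -/
theorem roundVec_eq_roundLike {ε : ℝ} (hε : 0 < ε) {d₀ d : ℕ} (hd₀ : 1 ≤ d₀) {v μ : Fin d → ℝ}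
    (h : ‖v - μ‖ ≤ ε) : roundVec ε d₀ v = roundLike ε d₀ v μ := by
  funext j
  have hj : |v j - μ j| ≤ ε := by
    rw [pi_norm_le_iff_of_nonneg hε.le] at h
    simpa using h j
  have hb := mem_block hd₀ j.2
  have hg := (blockShift_spec hε d d₀ (extendVec v) (j / d₀ * d₀)).2 j hb.1 hb.2
  have hv : extendVec v j = v j := by simp [extendVec]
  rw [hv] at hg
  simp only [roundVec, roundSeq, roundLike, hv]
  exact shiftRound_eq hε hj hg

theorem norm_roundLike_sub_le {ε : ℝ} (hε : 0 < ε) {d₀ d : ℕ} (hd₀ : 1 ≤ d₀) (v μ : Fin d → ℝ) :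
    ‖roundLike ε d₀ v μ - μ‖ ≤ 6 * (ε * d₀) := by
  rw [pi_norm_le_iff_of_nonneg (by positivity)]
  intro j
  have hg := (blockShift_spec hε d d₀ (extendVec v) (j / d₀ * d₀)).1
  simpa [roundLike] using abs_shiftRound_sub_le hε hd₀ (by omega) (μ j)

/-- The number of blocks. -/
def numBlocks (d d₀ : ℕ) : ℕ := (d + d₀ - 1) / d₀

open Classical in
-- Once `μ` is fixed, `v` enters only through one of `d₀ + 1` shifts for each block.
theorem exists_roundLike_range {ε : ℝ} (hε : 0 < ε) {d₀ d : ℕ} (hd₀ : 1 ≤ d₀) (μ : Fin d → ℝ) :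
    ∃ T : Finset (Fin d → ℝ), T.card ≤ (d₀ + 1) ^ numBlocks d d₀ ∧ ∀ v, roundLike ε d₀ v μ ∈ T := by
  have hlt : ∀ j : Fin d, j / d₀ < numBlocks d d₀ := by
    intro j
    have := j.2
    rw [numBlocks, Nat.div_lt_iff_lt_mul hd₀]
    have h1 := Nat.lt_div_mul_add (a := d + d₀ - 1) hd₀
    omega
  let F : (Fin (numBlocks d d₀) → Fin (d₀ + 1)) → Fin d → ℝ := fun s j =>
    shiftRound ε d₀ (s ⟨j / d₀, hlt j⟩) (μ j)
  refine ⟨Finset.univ.image F, ?_, fun v => ?_⟩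
  · refine Finset.card_image_le.trans ?_
    simp
  · rw [Finset.mem_image]
    exact ⟨fun q => ⟨blockShift ε d d₀ (extendVec v) (q * d₀), (blockShift_spec hε _ _ _ _).1⟩,
      Finset.mem_univ _, rfl⟩

/-! ### The answers of the steward and their correctness -/

/-- The bit string whose entries are the binary digits of `v`. -/
def bitsOf (n v : ℕ) : Bits n := fun j => v.testBit j

/-- The first `r` answers to functions chosen by `f`, queried at `x 0, x 1, …`. -/
def answersTo {n d : ℕ} (ε : ℝ) (d₀ : ℕ) (f : List (Fin d → ℝ) → Bits n → Fin d → ℝ)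
    (x : ℕ → Bits n) : ℕ → List (Fin d → ℝ)
  | 0 => []
  | r + 1 => answersTo ε d₀ f x r ++ [roundVec ε d₀ (f (answersTo ε d₀ f x r) (x r))]

theorem length_answersTo {n d : ℕ} (ε : ℝ) (d₀ : ℕ) (f : List (Fin d → ℝ) → Bits n → Fin d → ℝ)
    (x : ℕ → Bits n) (r : ℕ) : (answersTo ε d₀ f x r).length = r := by
  induction r with
  | zero => rfl
  | succ r ih => simp [answersTo, ih]

theorem take_answersTo {n d : ℕ} (ε : ℝ) (d₀ : ℕ) (f : List (Fin d → ℝ) → Bits n → Fin d → ℝ)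
    (x : ℕ → Bits n) {i r : ℕ} (h : i ≤ r) :
    (answersTo ε d₀ f x r).take i = answersTo ε d₀ f x i := by
  induction r with
  | zero => obtain rfl : i = 0 := by omega
            rfl
  | succ r ih =>
    rcases Nat.lt_or_ge r i with hi | hi
    · obtain rfl : i = r + 1 := by omega
      exact List.take_of_length_le (length_answersTo ε d₀ f x (r + 1)).le
    · rw [answersTo, List.take_append_of_le_length (by rw [length_answersTo]; exact hi), ih hi]

section Owner

variable {n d : ℕ} {ε δ : ℝ}

/-- The answer list after a further round in which the shifts are chosen as for the query `x` but
applied to the point of concentration. -/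
def idealStep (ε : ℝ) (d₀ : ℕ) (O : Owner n d ε δ) (s : List (Fin d → ℝ)) (x : Bits n) :
    List (Fin d → ℝ) :=
  s ++ [roundLike ε d₀ (O.func s x) (O.point s)]

/-- The query `x` in round `j < k` misses the point of concentration. -/
def BadQuery (ε : ℝ) (k : ℕ) (O : Owner n d ε δ) (j : ℕ) (s : List (Fin d → ℝ)) (x : Bits n) : Prop :=
  j < k ∧ ε < ‖O.func s x - O.point s‖

/-- As long as every query is good, the ideal and the real answer coincide in each round, so the
owner sees the same history in both processes. The generator can therefore be analysed on the ideal
process, whose branching is small in every round. -/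
theorem endState_eq_answersTo (hε : 0 < ε) {d₀ k : ℕ} (hd₀ : 1 ≤ d₀) (O : Owner n d ε δ)
    (x : ℕ → Bits n) (r : ℕ) (hr : r ≤ k)
    (h : ¬ EverBad (idealStep ε d₀ O) (BadQuery ε k O) r 0 [] x) :
    endState (idealStep ε d₀ O) r [] x = answersTo ε d₀ O.func x r ∧
      ∀ i < r, ‖O.func (answersTo ε d₀ O.func x i) (x i) -
        O.point (answersTo ε d₀ O.func x i)‖ ≤ ε := by
  -- `endState` recurses on the first input whereas `answersTo` appends the last answer.
  have hend : ∀ r s (x : ℕ → Bits n), endState (idealStep ε d₀ O) (r + 1) s x =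
      idealStep ε d₀ O (endState (idealStep ε d₀ O) r s x) (x r) := by
    intro r
    induction r with
    | zero => intro s x; rfl
    | succ r ih => intro s x; rw [endState, ih, endState]
  induction r with
  | zero => exact ⟨rfl, by simp⟩
  | succ r ih =>
    rw [everBad_add, not_or] at h
    obtain ⟨h1, h2⟩ := ih (by omega) h.1
    have h3 : ‖O.func (answersTo ε d₀ O.func x r) (x r) -
        O.point (answersTo ε d₀ O.func x r)‖ ≤ ε := by
      have h4 := h.2
      simp only [EverBad, BadQuery, or_false, h1, add_zero, zero_add] at h4
      by_contra hc
      exact h4 ⟨by omega, not_le.1 hc⟩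
    refine ⟨?_, fun i hi => ?_⟩
    · rw [hend, h1, answersTo, idealStep, roundVec_eq_roundLike hε hd₀ h3]
    · rcases Nat.lt_succ_iff_lt_or_eq.1 hi with hi | rfl
      · exact h2 i hi
      · exact h3

open Classical in
-- Only the lowest `n` bits matter. The slack between `n` and `h` is needed because generator blocks
-- have even length.
theorem card_filter_bitsOf_le (n h : ℕ) (hn : n ≤ h) (E : Set (Bits n)) :
    (((Finset.range (2 ^ h)).filter fun v => bitsOf n v ∈ E).card : ℝ) ≤
      2 ^ h * uniformProb E := by
  obtain ⟨q, rfl⟩ := Nat.exists_eq_add_of_le hn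
  have hinj : Set.InjOn (bitsOf n) (Finset.range (2 ^ n) : Set ℕ) := by
    intro u hu v hv huv
    simp only [Finset.coe_range, Set.mem_Iio] at hu hv
    apply Nat.eq_of_testBit_eq
    intro i
    rcases Nat.lt_or_ge i n with hi | hi
    · exact congrFun huv ⟨i, hi⟩
    · have : 2 ^ n ≤ 2 ^ i := Nat.pow_le_pow_right (by norm_num) hi
      rw [Nat.testBit_lt_two_pow (by omega), Nat.testBit_lt_two_pow (by omega)]
  have h1 : ((Finset.range (2 ^ n)).filter fun v => bitsOf n v ∈ E).card ≤ E.ncard := by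
    rw [Set.ncard_eq_toFinset_card']
    refine Finset.card_le_card_of_injOn (bitsOf n) ?_ ?_
    · intro v hv
      have := (Finset.mem_filter.1 hv).2
      simpa using this
    · exact hinj.mono (by intro v hv; exact (Finset.mem_filter.1 hv).1)
  have h2 : ((Finset.range (2 ^ (n + q))).filter fun v => bitsOf n v ∈ E).card =
      2 ^ q * ((Finset.range (2 ^ n)).filter fun v => bitsOf n v ∈ E).card := by
    rw [Finset.card_filter, pow_add, sum_range_mul_eq, Finset.card_filter, Finset.mul_sum]
    refine Finset.sum_congr rfl fun u hu => ?_
    rw [Finset.mem_range] at hu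
    have : ∀ y, bitsOf n (2 ^ n * y + u) = bitsOf n u := by
      intro y
      funext j
      simp only [bitsOf]
      rw [Nat.testBit_two_pow_mul_add _ hu, if_pos j.2]
    simp only [this, Finset.sum_const, Finset.card_range, smul_eq_mul]
  rw [h2, uniformProb, Fintype.card_fun, Fintype.card_bool, Fintype.card_fin]
  have h3 : (((Finset.range (2 ^ n)).filter fun v => bitsOf n v ∈ E).card : ℝ) ≤ E.ncard := by
    exact_mod_cast h1
  push_cast
  rw [pow_add]
  have : (2 : ℝ) ^ n * 2 ^ q * (E.ncard / 2 ^ n) = 2 ^ q * E.ncard := by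
    field_simp
  rw [this]
  gcongr

open Classical in
theorem card_wrong_answers_le (hε : 0 < ε) {d₀ k D e h₀ l : ℕ} {γ : ℝ} (hd₀ : 1 ≤ d₀)
    (hD : (d₀ + 1) ^ numBlocks d d₀ ≤ 2 ^ D) (hl : k ≤ 2 ^ l) (hn : n ≤ 2 * h₀)
    (he : 2 ^ l * (1 / 2 : ℝ) ^ e ≤ γ) (O : Owner n d ε δ) :
    (((Finset.range (2 ^ (2 * halfLength D e h₀ l))).filter fun z =>
      ∃ i < k, 6 * (ε * d₀) <
        ‖roundVec ε d₀ (O.func (answersTo ε d₀ O.func (fun r => bitsOf n (generator D e h₀ l z r)) i)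
            (bitsOf n (generator D e h₀ l z i))) -
          O.point (answersTo ε d₀ O.func (fun r => bitsOf n (generator D e h₀ l z r)) i)‖).card : ℝ) ≤
      2 ^ (2 * halfLength D e h₀ l) * (k * δ + γ) := by
  have hmain := generator_everBad_card_le (step := idealStep ε d₀ O) (bad := BadQuery ε k O) e h₀ hD
    (by
      intro s
      obtain ⟨T, hT, hmem⟩ := exists_roundLike_range hε hd₀ (O.point s)
      exact ⟨T.image fun y => s ++ [y], Finset.card_image_le.trans hT,
        fun x => Finset.mem_image_of_mem _ (hmem _)⟩)
    -- The generator supplies `2 ^ l ≥ k` blocks; rounds from `k` on are never bad and contribute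
    -- nothing.
    (bitsOf n) (fun j => if j < k then δ else 0)
    (by
      intro j s
      by_cases hj : j < k
      · simp only [BadQuery, hj, true_and, if_true]
        refine (card_filter_bitsOf_le n (2 * h₀) hn {x | ε < ‖O.func s x - O.point s‖}).trans ?_
        exact mul_le_mul_of_nonneg_left (O.concentrated s) (by positivity)
      · simp [BadQuery, hj])
    l 0 []
  refine le_trans (Nat.cast_le.2 (Finset.card_le_card ?_)) (hmain.trans ?_)
  · intro z hz
    rw [Finset.mem_filter] at hz ⊢
    refine ⟨hz.1, ?_⟩
    by_contra hgood
    obtain ⟨i, hi, hlt⟩ := hz.2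
    obtain ⟨q, hq⟩ := Nat.exists_eq_add_of_le hl
    rw [hq, everBad_add, not_or] at hgood
    have := (endState_eq_answersTo hε hd₀ O _ k le_rfl hgood.1).2 i hi
    rw [roundVec_eq_roundLike hε hd₀ this] at hlt
    exact absurd hlt (not_lt.2 (norm_roundLike_sub_le hε hd₀ _ _))
  · have hsum : ∑ j' ∈ Finset.range (2 ^ l), (if 0 + j' < k then δ else 0) = k * δ := by
      obtain ⟨q, hq⟩ := Nat.exists_eq_add_of_le hl
      rw [hq, Finset.sum_range_add]
      have h1 : ∑ j' ∈ Finset.range k, (if 0 + j' < k then δ else 0) = k * δ := by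
        rw [Finset.sum_congr rfl (g := fun _ => δ)]
        · simp
        · intro j' hj'
          simp [Finset.mem_range.1 hj']
      rw [h1]
      simp
    rw [hsum]
    have : (2 ^ l - 1) * (1 / 2 : ℝ) ^ e ≤ γ := by
      have : 0 < (1 / 2 : ℝ) ^ e := by positivity
      linarith
    gcongr

end Owner

/-! ### Numbers from coins -/

/-- The number with the binary digits `l`, the last one being the least significant. -/
def coinNumber (l : List Bool) (a : ℕ) : ℕ := l.foldl (fun a b => 2 * a + b.toNat) a

theorem coinNumber_inj {l l' : List Bool} (h : l.length = l'.length) {a a' : ℕ}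
    (heq : coinNumber l a = coinNumber l' a') : a = a' ∧ l = l' := by
  induction l generalizing l' a a' with
  | nil =>
    obtain rfl : l' = [] := by simpa using h.symm
    exact ⟨heq, rfl⟩
  | cons b l ih =>
    cases l' with
    | nil => simp at h
    | cons b' l' =>
      obtain ⟨h1, rfl⟩ := ih (by simpa using h) (show coinNumber l (2 * a + b.toNat) =
        coinNumber l' (2 * a' + b'.toNat) from heq)
      have := Bool.toNat_lt b
      have := Bool.toNat_lt b'
      refine ⟨by omega, ?_⟩
      cases b <;> cases b' <;> simp_all <;> omega

theorem coinNumber_lt (l : List Bool) (a : ℕ) : coinNumber l a < (a + 1) * 2 ^ l.length := by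
  induction l generalizing a with
  | nil => simp [coinNumber]
  | cons b l ih =>
    have := Bool.toNat_lt b
    calc coinNumber (b :: l) a < (2 * a + b.toNat + 1) * 2 ^ l.length := ih (2 * a + b.toNat)
      _ ≤ (2 * (a + 1)) * 2 ^ l.length := Nat.mul_le_mul_right _ (by omega)
      _ = _ := by rw [List.length_cons]; ring

open Classical in
-- Coin strings of length `m` inject into the numbers below `2 ^ m`; for an upper bound that is
-- enough.
theorem uniformProb_coinNumber_le {m : ℕ} {p : ℝ} (P : ℕ → Prop)
    (h : (((Finset.range (2 ^ m)).filter P).card : ℝ) ≤ 2 ^ m * p) :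
    uniformProb {z : Bits m | P (coinNumber (List.ofFn z) 0)} ≤ p := by
  rw [uniformProb, Fintype.card_fun, Fintype.card_bool, Fintype.card_fin]
  push_cast
  rw [div_le_iff₀ (by positivity), mul_comm p]
  refine le_trans (Nat.cast_le.2 ?_) h
  rw [Set.ncard_eq_toFinset_card']
  refine Finset.card_le_card_of_injOn (fun z => coinNumber (List.ofFn z) 0) ?_ ?_
  · intro z hz
    have hz' : P (coinNumber (List.ofFn z) 0) := by simpa using hz
    have := coinNumber_lt (List.ofFn z) 0
    rw [List.length_ofFn, zero_add, one_mul] at this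
    simpa using ⟨this, hz'⟩
  · intro z _ z' _ hzz
    exact List.ofFn_injective (coinNumber_inj (by simp) hzz).2

/-! ### Rules for programs -/

/-- Started in `s`, the program halts within `N ^ e` steps in a state that satisfies `Q`. -/
def Runs {n d : ℕ} (k : ℕ) (f : List (Fin d → ℝ) → Bits n → Fin d → ℝ) (N e : ℕ) (p : Prog)
    (Q : State d → Prop) (s : State d) : Prop :=
  ∃ t s', Exec k f p s t s' ∧ t ≤ N ^ e ∧ Q s'

section Rules

variable {n d k : ℕ} {f : List (Fin d → ℝ) → Bits n → Fin d → ℝ} {N e : ℕ} {s : State d}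
  {Q Q' : State d → Prop}

theorem Runs.mono {e' : ℕ} {p : Prog} (hN : 3 ≤ N) (h : Runs k f N e p Q s) (he : e ≤ e')
    (hQ : ∀ s', Q s' → Q' s') : Runs k f N e' p Q' s := by
  obtain ⟨t, s', hx, ht, hq⟩ := h
  exact ⟨t, s', hx, ht.trans (Nat.pow_le_pow_right (by omega) he), hQ s' hq⟩

theorem Runs.skip (hN : 3 ≤ N) (h : Q s) : Runs k f N e .skip Q s :=
  ⟨1, s, .skip s, Nat.one_le_pow _ _ (by omega), h⟩

theorem Runs.setN {a x : NExpr} (hN : 3 ≤ N)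
    (h : Q { s with nat := Function.update s.nat (a.val s) (x.val s) }) :
    Runs k f N e (.setN a x) Q s :=
  ⟨1, _, .setN s a x, Nat.one_le_pow _ _ (by omega), h⟩

theorem Runs.setR {a : NExpr} {x : RExpr} (hN : 3 ≤ N)
    (h : Q { s with real := Function.update s.real (a.val s) (x.val s) }) :
    Runs k f N e (.setR a x) Q s :=
  ⟨1, _, .setR s a x, Nat.one_le_pow _ _ (by omega), h⟩

theorem Runs.coin {a : NExpr} {b : Bool} {l : List Bool} (hN : 3 ≤ N) (hs : s.coins = b :: l)
    (h : Q { s with nat := Function.update s.nat (a.val s) b.toNat, coins := l }) :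
    Runs k f N e (.coin a) Q s :=
  ⟨1, _, .coin s a b l hs, Nat.one_le_pow _ _ (by omega), h⟩

theorem Runs.query {a b : NExpr} (hN : n + d + 1 ≤ N) (hk : s.answers.length < k)
    (hq : s.queried = false)
    (h : Q { s with
      real := s.storeVec (b.val s) (f s.answers (s.readBits n (a.val s))), queried := true }) :
    Runs k f N (e + 1) (.query a b) Q s :=
  ⟨_, _, .query s a b hk hq, hN.trans (Nat.le_self_pow (by omega) N), h⟩

theorem Runs.answer {a : NExpr} (hN : n + d + 1 ≤ N) (hk : s.answers.length < k)
    (hq : s.queried = true)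
    (h : Q { s with answers := s.answers ++ [s.readVec (a.val s)], queried := false }) :
    Runs k f N (e + 1) (.answer a) Q s :=
  ⟨_, _, .answer s a hk hq, (by omega : d + 1 ≤ N).trans (Nat.le_self_pow (by omega) N), h⟩

/-- Running times are never added up exactly. Since `N ≥ 3`, a sequence or a branch raises the
exponent by one and a loop of at most `N` rounds by two. -/
theorem Runs.seq {p q : Prog} (hN : 3 ≤ N)
    (h : Runs k f N e p (fun s₁ => Runs k f N e q Q s₁) s) :
    Runs k f N (e + 1) (.seq p q) Q s := by
  obtain ⟨t₁, s₁, h₁, ht₁, t₂, s₂, h₂, ht₂, hq⟩ := h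
  refine ⟨_, s₂, .seq p q s s₁ s₂ t₁ t₂ h₁ h₂, ?_, hq⟩
  have : 3 * N ^ e ≤ N ^ (e + 1) := by rw [pow_succ']; exact Nat.mul_le_mul_right _ hN
  omega

theorem Runs.ite {b : Test} {p q : Prog} (hN : 3 ≤ N) (h₁ : b.Holds s → Runs k f N e p Q s)
    (h₂ : ¬ b.Holds s → Runs k f N e q Q s) : Runs k f N (e + 1) (.ite b p q) Q s := by
  have h1 : 3 * N ^ e ≤ N ^ (e + 1) := by rw [pow_succ']; exact Nat.mul_le_mul_right _ hN
  have h2 : 1 ≤ N ^ e := Nat.one_le_pow _ _ (by omega)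
  by_cases hb : b.Holds s
  · obtain ⟨t, s', hx, ht, hq⟩ := h₁ hb
    exact ⟨_, s', .iteTrue b p q s s' t hb hx, by omega, hq⟩
  · obtain ⟨t, s', hx, ht, hq⟩ := h₂ hb
    exact ⟨_, s', .iteFalse b p q s s' t hb hx, by omega, hq⟩

/-- The invariant is indexed by the number of completed rounds, so correctness and termination after
exactly `c` rounds are proved together. -/
theorem Runs.loop {b : Test} {p : Prog} (I : ℕ → State d → Prop) (c : ℕ) (hN : 3 ≤ N) (hc : c ≤ N)
    (h0 : I 0 s)
    (hstep : ∀ j < c, ∀ s, I j s → b.Holds s ∧ Runs k f N e p (I (j + 1)) s)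
    (hend : ∀ s, I c s → ¬ b.Holds s ∧ Q s) : Runs k f N (e + 2) (.loop b p) Q s := by
  have key : ∀ j ≤ c, ∀ s, I (c - j) s →
      ∃ t s', Exec k f (.loop b p) s t s' ∧ t ≤ j * (N ^ e + 1) + 1 ∧ Q s' := by
    intro j
    induction j with
    | zero =>
      intro _ s hs
      exact ⟨1, s, .loopFalse b p s (hend s hs).1, by omega, (hend s hs).2⟩
    | succ j ih =>
      intro hj s hs
      obtain ⟨hb, t₁, s₁, hx₁, ht₁, hI⟩ := hstep (c - (j + 1)) (by omega) s hs
      rw [show c - (j + 1) + 1 = c - j by omega] at hI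
      obtain ⟨t₂, s₂, hx₂, ht₂, hq⟩ := ih (by omega) s₁ hI
      refine ⟨_, s₂, .loopTrue b p s s₁ s₂ t₁ t₂ hb hx₁ hx₂, ?_, hq⟩
      rw [add_mul, one_mul]
      omega
  obtain ⟨t, s', hx, ht, hq⟩ := key c le_rfl s (by rwa [Nat.sub_self])
  refine ⟨t, s', hx, ht.trans ?_, hq⟩
  have h1 : 1 ≤ N ^ e := Nat.one_le_pow _ _ (by omega)
  calc c * (N ^ e + 1) + 1 ≤ N * (2 * N ^ e) + N * N ^ e := by
        refine add_le_add (Nat.mul_le_mul hc (by omega)) ?_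
        nlinarith
    _ = 3 * N * N ^ e := by ring
    _ ≤ N * N * N ^ e := by gcongr
    _ = N ^ (e + 2) := by ring

/-- The state is `s`, except that its natural memory satisfies `R`. -/
def NatPost (s : State d) (R : (ℕ → ℕ) → Prop) (s' : State d) : Prop :=
  ∃ g, s' = { s with nat := g } ∧ R g

/-- The natural memories agree on the registers below `c` and from `64` on. -/
def AgreesOff (c : ℕ) (g g' : ℕ → ℕ) : Prop := ∀ a, a < c ∨ 64 ≤ a → g' a = g a

theorem Runs.natLoop {g : ℕ → ℕ} {b : Test} {p : Prog} (I : ℕ → (ℕ → ℕ) → Prop) (c : ℕ)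
    (hN : 3 ≤ N) (hc : c ≤ N) (h0 : I 0 g)
    (hstep : ∀ j < c, ∀ g, I j g → b.Holds { s with nat := g } ∧
      Runs k f N e p (NatPost s (I (j + 1))) { s with nat := g })
    (hend : ∀ g, I c g → ¬ b.Holds { s with nat := g } ∧ Q { s with nat := g }) :
    Runs k f N (e + 2) (.loop b p) Q { s with nat := g } := by
  refine Runs.loop (fun j => NatPost s (I j)) c hN hc ⟨g, rfl, h0⟩ ?_ ?_
  · rintro j hj _ ⟨g, rfl, hg⟩
    exact hstep j hj g hg
  · rintro _ ⟨g, rfl, hg⟩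
    exact hend g hg

theorem Runs.bindNat {e' : ℕ} {p : Prog} {R : (ℕ → ℕ) → Prop} {s' : State d} (hN : 3 ≤ N)
    (h : Runs k f N e p (NatPost s R) s') (he : e ≤ e') (hQ : ∀ g, R g → Q { s with nat := g }) :
    Runs k f N e' p Q s' := by
  refine h.mono hN he ?_
  rintro _ ⟨g, rfl, hg⟩
  exact hQ g hg

theorem Runs.assign {g : ℕ → ℕ} {a : ℕ} {x : NExpr} (hN : 3 ≤ N)
    (h : Q { s with nat := Function.update g a (x.val { s with nat := g }) }) :
    Runs k f N e (.setN (.const a) x) Q { s with nat := g } :=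
  Runs.setN hN h

theorem Runs.assign_seq {g : ℕ → ℕ} {a : ℕ} {x : NExpr} {q : Prog} (hN : 3 ≤ N)
    (h : Runs k f N e q Q { s with nat := Function.update g a (x.val { s with nat := g }) }) :
    Runs k f N (e + 1) (.seq (.setN (.const a) x) q) Q { s with nat := g } :=
  Runs.seq hN (Runs.assign hN h)

end Rules

/-! ### Arithmetic programs -/

/-- The constant `c`. -/
abbrev num (c : ℕ) : NExpr := .const c

/-- The content of the natural register `a`. -/
abbrev reg (a : ℕ) : NExpr := .mem (.const a)

/-- Store the value of `x` in the natural register `a`. -/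
abbrev assign (a : ℕ) (x : NExpr) : Prog := .setN (.const a) x

/-- The content of the real register `a`. -/
abbrev realReg (a : ℕ) : RExpr := .mem (.const a)

/-- Store the value of `x` in the real register `a`. -/
abbrev assignReal (a : ℕ) (x : RExpr) : Prog := .setR (.const a) x

instance : Add NExpr := ⟨.add⟩
instance : Sub NExpr := ⟨.sub⟩
instance : Add RExpr := ⟨.add⟩
instance : Sub RExpr := ⟨.sub⟩

infixr:50 " ;; " => Prog.seq

section Values

variable {d : ℕ} (s : State d)

@[simp] theorem val_add (x y : NExpr) : (x + y).val s = x.val s + y.val s := rfl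
@[simp] theorem val_sub (x y : NExpr) : (x - y).val s = x.val s - y.val s := rfl
@[simp] theorem val_mem (x : NExpr) : (NExpr.mem x).val s = s.nat (x.val s) := rfl
@[simp] theorem val_const (c : ℕ) : (NExpr.const c).val s = c := rfl
@[simp] theorem realVal_add (x y : RExpr) : (x + y).val s = x.val s + y.val s := rfl
@[simp] theorem realVal_sub (x y : RExpr) : (x - y).val s = x.val s - y.val s := rfl
@[simp] theorem realVal_mem (x : NExpr) : (RExpr.mem x).val s = s.real (x.val s) := rfl
@[simp] theorem realVal_const (c : ℕ) : (RExpr.const c).val s = c := rfl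
@[simp] theorem realVal_roundDown (x y : RExpr) :
    (RExpr.roundDown x y).val s = roundTo (x.val s) (y.val s) := rfl
@[simp] theorem holds_ltN (x y : NExpr) : (Test.ltN x y).Holds s ↔ x.val s < y.val s := Iff.rfl
@[simp] theorem holds_ltR (x y : RExpr) : (Test.ltR x y).Holds s ↔ x.val s < y.val s := Iff.rfl
@[simp] theorem holds_not (b : Test) : (Test.not b).Holds s ↔ ¬ b.Holds s := Iff.rfl

end Values

/-- Register 60 is doubled as many times as register 61 says. -/
def shiftProg : Prog :=
  .loop (.ltN (num 0) (reg 61)) (assign 60 (reg 60 + reg 60) ;; assign 61 (reg 61 - num 1))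

/-- Divide register 50 by 2 to the power in register 51; the quotient, which goes to register 53,
has at most as many bits as register 52 says, and the remainder goes to register 50. -/
def divProg : Prog :=
  assign 53 (num 0) ;;
  .loop (.ltN (num 0) (reg 52))
    (assign 52 (reg 52 - num 1) ;; assign 60 (num 1) ;; assign 61 (reg 51 + reg 52) ;; shiftProg ;;
      assign 53 (reg 53 + reg 53) ;;
      .ite (.ltN (reg 50) (reg 60)) .skip (assign 50 (reg 50 - reg 60) ;; assign 53 (reg 53 + num 1)))

section Arithmetic

variable {n d k : ℕ} {f : List (Fin d → ℝ) → Bits n → Fin d → ℝ} {N : ℕ}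

/-- Scratch registers are nested: shifting uses those from 60, division those from 50, the walk
those from 40 and the generator those from 30, all below 64. A caller's data are therefore safe by
`AgreesOff`. Loop counts are exponents and bit lengths, never the large numbers themselves. -/
theorem shiftProg_runs (s : State d) (u : ℕ → ℕ) (hN : 3 ≤ N) (h : u 61 ≤ N) :
    Runs k f N 3 shiftProg
      (NatPost s fun g => g 60 = u 60 * 2 ^ u 61 ∧ AgreesOff 60 u g) { s with nat := u } := by
  refine Runs.natLoop (fun j g => g 60 = u 60 * 2 ^ j ∧ g 61 = u 61 - j ∧
    AgreesOff 60 u g) (u 61) hN h ⟨by simp, by simp, fun a _ => rfl⟩ ?_ ?_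
  · rintro j hj g ⟨h1, h2, h3⟩
    refine ⟨by simp [h2]; omega, Runs.assign_seq hN (Runs.assign hN ⟨_, rfl, ?_⟩)⟩
    simp only [val_add, val_sub, val_mem, val_const, h1]
    refine ⟨by simp; ring, by simp [h2]; omega, fun a ha => ?_⟩
    rw [Function.update_of_ne (by omega), Function.update_of_ne (by omega), h3 a ha]
  · rintro g ⟨h1, h2, h3⟩
    exact ⟨by simp [h2], g, rfl, h1, h3⟩

theorem div_mod_two_pow_succ (v c : ℕ) :
    v / 2 ^ c = 2 * (v / 2 ^ (c + 1)) + v / 2 ^ c % 2 ∧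
      v % 2 ^ (c + 1) = v % 2 ^ c + 2 ^ c * (v / 2 ^ c % 2) := by
  rw [pow_succ, Nat.mod_mul, ← Nat.div_div_eq_div_mul]
  exact ⟨(Nat.div_add_mod _ _).symm, rfl⟩

theorem div_mod_two_pow_of_lt {v c : ℕ} (h : v % 2 ^ (c + 1) < 2 ^ c) :
    v / 2 ^ c = v / 2 ^ (c + 1) + v / 2 ^ (c + 1) ∧ v % 2 ^ c = v % 2 ^ (c + 1) := by
  obtain ⟨h1, h2⟩ := div_mod_two_pow_succ v c
  rcases Nat.mod_two_eq_zero_or_one (v / 2 ^ c) with h3 | h3 <;> rw [h3] at h1 h2 <;> omega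

theorem div_mod_two_pow_of_le {v c : ℕ} (h : 2 ^ c ≤ v % 2 ^ (c + 1)) :
    v / 2 ^ c = v / 2 ^ (c + 1) + v / 2 ^ (c + 1) + 1 ∧
      v % 2 ^ c = v % 2 ^ (c + 1) - 2 ^ c := by
  obtain ⟨h1, h2⟩ := div_mod_two_pow_succ v c
  have := Nat.mod_lt v (show 0 < 2 ^ c by positivity)
  rcases Nat.mod_two_eq_zero_or_one (v / 2 ^ c) with h3 | h3 <;> rw [h3] at h1 h2 <;> omega

/-- Binary long division from the top: after `j` rounds the registers hold quotient and remainder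
for the divisor `2 ^ (u 51 + u 52 - j)`. By `hv` this starts with quotient zero. -/
theorem divProg_runs (s : State d) (u : ℕ → ℕ) (hN : 3 ≤ N) (h : u 51 + u 52 ≤ N)
    (hv : u 50 < 2 ^ (u 51 + u 52)) :
    Runs k f N 12 divProg (NatPost s fun g => g 50 = u 50 % 2 ^ u 51 ∧
      g 53 = u 50 / 2 ^ u 51 ∧ AgreesOff 50 u g) { s with nat := u } := by
  refine Runs.assign_seq hN ?_
  simp only [val_const]
  refine Runs.natLoop (e := 9) (fun j g => g 50 = u 50 % 2 ^ (u 51 + u 52 - j) ∧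
    g 53 = u 50 / 2 ^ (u 51 + u 52 - j) ∧ g 51 = u 51 ∧ g 52 = u 52 - j ∧
    AgreesOff 50 u g) (u 52) hN (by omega) ?_ ?_ ?_
  · refine ⟨?_, ?_, by simp, by simp, fun a ha => ?_⟩
    · simp [Nat.mod_eq_of_lt hv]
    · simp [Nat.div_eq_of_lt hv]
    · rw [Function.update_of_ne (by omega)]
  · rintro j hj g ⟨h50, h53, h51, h52, hag⟩
    refine ⟨by simp [h52]; omega, ?_⟩
    refine Runs.assign_seq hN (Runs.assign_seq hN (Runs.assign_seq hN (Runs.seq hN ?_)))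
    simp only [val_add, val_sub, val_mem, val_const]
    refine Runs.bindNat hN (shiftProg_runs _ _ hN ?_) (by norm_num) ?_
    · simp [h51, h52]; omega
    rintro g' ⟨h60, hag'⟩
    simp [h51, h52] at h60
    have g50 : g' 50 = g 50 := by rw [hag' 50 (by norm_num)]; simp
    have g51 : g' 51 = g 51 := by rw [hag' 51 (by norm_num)]; simp
    have g52 : g' 52 = g 52 - 1 := by rw [hag' 52 (by norm_num)]; simp
    have g53 : g' 53 = g 53 := by rw [hag' 53 (by norm_num)]; simp
    obtain ⟨c, hc⟩ : ∃ c, u 51 + u 52 - j = c + 1 := ⟨_, (by omega :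
      u 51 + u 52 - j = (u 51 + u 52 - j - 1) + 1)⟩
    rw [show u 51 + (u 52 - j - 1) = c by omega] at h60
    rw [hc] at h50 h53
    have gag : AgreesOff 50 u g' := by
      intro a ha
      rw [hag' a (by omega), Function.update_of_ne (by omega), Function.update_of_ne (by omega),
        Function.update_of_ne (by omega), hag a ha]
    rw [show u 51 + u 52 - (j + 1) = c by omega]
    refine Runs.assign_seq hN (Runs.ite hN ?_ ?_)
    · intro hlt
      simp [g50, h60, h50] at hlt
      obtain ⟨e1, e2⟩ := div_mod_two_pow_of_lt hlt
      refine Runs.skip hN ⟨_, rfl, ?_⟩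
      simp only [val_add, val_mem, val_const]
      refine ⟨by simp [g50, h50, e2], by simp [g53, h53, e1], by simp [g51, h51],
        by simp [g52, h52]; omega, fun a ha => ?_⟩
      rw [Function.update_of_ne (by omega), gag a ha]
    · intro hlt
      simp [g50, h60, h50] at hlt
      obtain ⟨e1, e2⟩ := div_mod_two_pow_of_le hlt
      refine Runs.assign_seq (e := 2) hN (Runs.assign hN ⟨_, rfl, ?_⟩)
      simp only [val_add, val_sub, val_mem, val_const]
      refine ⟨by simp [g50, h50, h60, e2], by simp [g53, h53, e1], by simp [g51, h51],
        by simp [g52, h52]; omega, fun a ha => ?_⟩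
      rw [Function.update_of_ne (by omega), Function.update_of_ne (by omega),
        Function.update_of_ne (by omega), gag a ha]
  · rintro g ⟨h50, h53, h51, h52, hag⟩
    refine ⟨by simp [h52], g, rfl, ?_, ?_, hag⟩
    · rw [h50]; congr 2; omega
    · rw [h53]; congr 2; omega

end Arithmetic

/-! ### The program for the generator -/

/-- Register 46 becomes the displacement for the label in register 45, the other coordinate in
register 47 and the modulus in register 44. -/
def displacementProg : Prog :=
  .ite (.ltN (reg 45) (num 1)) (assign 46 (reg 47 + reg 47))
    (.ite (.ltN (reg 45) (num 2)) (assign 46 (reg 47 + reg 47 + num 1))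
      (.ite (.ltN (reg 45) (num 3)) (assign 46 (reg 44 + reg 44 - (reg 47 + reg 47)))
        (assign 46 (reg 44 + reg 44 - (reg 47 + reg 47 + num 1)))))

/-- Reduce register `a` modulo register 44. -/
def reduceProg (a : ℕ) : Prog :=
  .loop (.not (.ltN (reg a) (reg 44))) (assign a (reg a - reg 44))

/-- One step, with the label in register 45, on the vertex in registers 40 and 41. -/
def stepProg : Prog :=
  .ite (.ltN (reg 45) (num 4))
    (assign 47 (reg 41) ;; displacementProg ;; assign 40 (reg 40 + reg 46) ;; reduceProg 40)
    (assign 45 (reg 45 - num 4) ;; assign 47 (reg 40) ;; displacementProg ;;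
      assign 41 (reg 41 + reg 46) ;; reduceProg 41)

/-- The walk with as many steps as register 43 says and the labels in register 42. -/
def walkProg : Prog :=
  .loop (.ltN (num 0) (reg 43))
    (assign 43 (reg 43 - num 1) ;; assign 50 (reg 42) ;; assign 51 (num 3) ;;
      assign 52 (reg 43 + reg 43 + reg 43) ;; divProg ;; assign 42 (reg 53) ;;
      assign 45 (reg 50) ;; stepProg)

/-- `numWalk` on register 30, with half of the bit length in register 33. -/
def numWalkProg : Prog :=
  assign 50 (reg 30) ;; assign 51 (reg 33) ;; assign 52 (reg 33) ;; divProg ;;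
    assign 40 (reg 53) ;; assign 41 (reg 50) ;; assign 60 (num 1) ;; assign 61 (reg 33) ;;
    shiftProg ;; assign 44 (reg 60) ;; walkProg ;; assign 60 (reg 40) ;; assign 61 (reg 33) ;;
    shiftProg ;; assign 30 (reg 60 + reg 41)

/-- Compute block number (register 11) of the output of the generator in register 30. -/
def generatorProg : Prog :=
  assign 30 (reg 10) ;; assign 31 (reg 4) ;; assign 32 (reg 11) ;; assign 33 (reg 9) ;;
    .loop (.ltN (num 0) (reg 31))
      (assign 31 (reg 31 - num 1) ;; assign 60 (reg 6) ;; assign 61 (reg 31) ;; shiftProg ;;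
        assign 34 (reg 60 + reg 7) ;; assign 35 (reg 34 + reg 34 + reg 34) ;;
        assign 35 (reg 35 + reg 35) ;; assign 35 (reg 35 + reg 35) ;; assign 33 (reg 33 - reg 35) ;;
        assign 50 (reg 30) ;; assign 51 (reg 33 + reg 33) ;; assign 52 (reg 35 + reg 35) ;;
        divProg ;; assign 30 (reg 50) ;; assign 60 (num 1) ;; assign 61 (reg 31) ;; shiftProg ;;
        .ite (.ltN (reg 32) (reg 60)) .skip
          (assign 32 (reg 32 - reg 60) ;; assign 42 (reg 53) ;; assign 43 (reg 34 + reg 34) ;;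
            assign 43 (reg 43 + reg 43) ;; assign 43 (reg 43 + reg 43) ;; numWalkProg))

/-- Store the bits of register 30 in the registers from 64 on. -/
def bitsProg : Prog :=
  assign 36 (reg 8 + reg 8) ;;
    .loop (.ltN (num 0) (reg 36))
      (assign 36 (reg 36 - num 1) ;; assign 60 (num 1) ;; assign 61 (reg 36) ;; shiftProg ;;
        .ite (.ltN (reg 30) (reg 60)) (.setN (num 64 + reg 36) (num 0))
          (assign 30 (reg 30 - reg 60) ;; .setN (num 64 + reg 36) (num 1)))

section Generator

variable {n d k : ℕ} {f : List (Fin d → ℝ) → Bits n → Fin d → ℝ} {N : ℕ}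

theorem AgreesOff.refl (c : ℕ) (u : ℕ → ℕ) : AgreesOff c u u := fun _ _ => rfl

theorem displacementProg_runs (s : State d) (u : ℕ → ℕ) (hN : 3 ≤ N) :
    Runs k f N 3 displacementProg
      (NatPost s fun g => g = Function.update u 46 (natDisplacement (u 44) (u 45) (u 47)))
      { s with nat := u } := by
  have h2 : ∀ x, x + x = 2 * x := fun x => (two_mul x).symm
  refine Runs.ite hN (fun h => Runs.assign hN ⟨_, rfl, ?_⟩) fun h => Runs.ite hN
    (fun h' => Runs.assign hN ⟨_, rfl, ?_⟩) fun h' => Runs.ite (e := 0) hN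
    (fun h'' => Runs.assign hN ⟨_, rfl, ?_⟩) (fun h'' => Runs.assign hN ⟨_, rfl, ?_⟩)
  all_goals
    congr 1
    simp only [holds_ltN, val_add, val_sub, val_mem, val_const, h2] at *
  · rw [show u 45 = 0 by omega]; rfl
  · rw [show u 45 = 1 by omega]; rfl
  · rw [show u 45 = 2 by omega]; rfl
  · obtain ⟨c, hc⟩ : ∃ c, u 45 = c + 3 := ⟨u 45 - 3, by omega⟩
    rw [hc]; rfl

/-- A coordinate plus a displacement is below three times the modulus, so at most two subtractions
are needed, however large the modulus is. -/
theorem reduceProg_runs (s : State d) (u : ℕ → ℕ) (a : ℕ) (ha : a < 44) (hN : 3 ≤ N)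
    (h44 : 0 < u 44) (h : u a < 3 * u 44) :
    Runs k f N 2 (reduceProg a)
      (NatPost s fun g => g = Function.update u a (u a % u 44)) { s with nat := u } := by
  have hdm := Nat.div_add_mod (u a) (u 44)
  have hlt := Nat.mod_lt (u a) h44
  refine Runs.natLoop (fun j g => g = Function.update u a (u a - u 44 * j)) (u a / u 44) hN ?_
    (by simp) ?_ ?_
  · have : u a / u 44 < 3 := by rw [Nat.div_lt_iff_lt_mul h44]; exact h
    omega
  · rintro j hj _ rfl
    have hle : u 44 * (j + 1) ≤ u 44 * (u a / u 44) := Nat.mul_le_mul_left _ hj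
    rw [mul_add, mul_one] at hle
    have e44 : Function.update u a (u a - u 44 * j) 44 = u 44 := Function.update_of_ne (by omega) _ _
    refine ⟨?_, Runs.assign hN ⟨_, rfl, ?_⟩⟩
    · simp only [holds_not, holds_ltN, val_mem, val_const, e44, Function.update_self]
      omega
    · simp only [val_sub, val_mem, val_const, e44, Function.update_self, Function.update_idem]
      congr 1
      rw [mul_add, mul_one]; omega
  · rintro _ rfl
    have e44 : Function.update u a (u a - u 44 * (u a / u 44)) 44 = u 44 :=
      Function.update_of_ne (by omega) _ _
    refine ⟨?_, _, rfl, ?_⟩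
    · simp only [holds_not, holds_ltN, val_mem, val_const, e44, Function.update_self]
      omega
    · congr 1; omega

theorem natDisplacement_le {N l y : ℕ} (hy : y < N) : natDisplacement N l y ≤ 2 * N := by
  unfold natDisplacement; split <;> omega

theorem stepProg_runs (s : State d) (u : ℕ → ℕ) (hN : 3 ≤ N) (h40 : u 40 < u 44)
    (h41 : u 41 < u 44) :
    Runs k f N 8 stepProg (NatPost s fun g => (g 40, g 41) = natStep (u 44) (u 45) (u 40, u 41) ∧
      (∀ a, a < 40 ∨ 42 ≤ a ∧ a < 45 ∨ 64 ≤ a → g a = u a)) { s with nat := u } := by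
  have hd1 := natDisplacement_le (l := u 45) h41
  have hd2 := natDisplacement_le (l := u 45 - 4) h40
  refine Runs.ite hN (fun h => ?_) (fun h => ?_)
  · simp only [holds_ltN, val_mem, val_const] at h
    refine Runs.assign_seq hN (Runs.seq hN ?_)
    refine Runs.bindNat hN (displacementProg_runs s _ hN) (by norm_num) ?_
    rintro _ rfl
    refine Runs.assign_seq hN ?_
    refine Runs.bindNat hN (reduceProg_runs s _ 40 (by norm_num) hN ?_ ?_) (by norm_num) ?_
    · simp; omega
    · simp; omega
    rintro _ rfl
    refine ⟨_, rfl, ?_, fun a ha => ?_⟩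
    · simp [natStep, h]
    · rw [Function.update_of_ne (by omega), Function.update_of_ne (by omega),
        Function.update_of_ne (by omega), Function.update_of_ne (by omega)]
  · simp only [holds_ltN, val_mem, val_const] at h
    refine Runs.assign_seq hN (Runs.assign_seq hN (Runs.seq hN ?_))
    refine Runs.bindNat hN (displacementProg_runs s _ hN) (by norm_num) ?_
    rintro _ rfl
    refine Runs.assign_seq hN ?_
    refine Runs.bindNat hN (reduceProg_runs s _ 41 (by norm_num) hN ?_ ?_) (by norm_num) ?_
    · simp; omega
    · simp; omega
    rintro _ rfl
    refine ⟨_, rfl, ?_, fun a ha => ?_⟩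
    · simp [natStep, h]
    · rw [Function.update_of_ne (by omega), Function.update_of_ne (by omega),
        Function.update_of_ne (by omega), Function.update_of_ne (by omega),
        Function.update_of_ne (by omega)]

theorem walkProg_runs (s : State d) (u : ℕ → ℕ) (hN : 3 ≤ N) (h40 : u 40 < u 44)
    (h41 : u 41 < u 44) (h43 : 3 * u 43 ≤ N) (h42 : u 42 < 8 ^ u 43) :
    Runs k f N 22 walkProg (NatPost s fun g =>
      (g 40, g 41) = natWalk (u 44) (u 43) (u 42) (u 40, u 41) ∧ AgreesOff 40 u g)
      { s with nat := u } := by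
  -- The rest of the walk from the current vertex has the same endpoint as the whole walk. The bound
  -- on register 42 is what the division by 8 in the next round needs.
  refine Runs.natLoop (fun j g => g 43 = u 43 - j ∧ g 44 = u 44 ∧ g 42 < 8 ^ (u 43 - j) ∧
    g 40 < u 44 ∧ g 41 < u 44 ∧
    natWalk (u 44) (u 43 - j) (g 42) (g 40, g 41) = natWalk (u 44) (u 43) (u 42) (u 40, u 41) ∧
    AgreesOff 40 u g) (u 43) hN (by omega) ?_ ?_ ?_
  · simp [h40, h41, h42, AgreesOff.refl]
  · rintro j hj g ⟨g43, g44, g42, g40, g41, hw, hag⟩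
    refine ⟨by simp [g43]; omega, ?_⟩
    obtain ⟨t, ht⟩ : ∃ t, u 43 - j = t + 1 := ⟨u 43 - j - 1, by omega⟩
    rw [ht] at g43 g42 hw
    rw [show u 43 - (j + 1) = t by omega]
    have h8 : (8 : ℕ) ^ (t + 1) = 2 ^ (3 + (t + t + t)) := by
      rw [show (8 : ℕ) = 2 ^ 3 by norm_num, ← pow_mul]; congr 1; ring
    refine Runs.assign_seq hN (Runs.assign_seq hN (Runs.assign_seq hN (Runs.assign_seq hN
      (Runs.seq hN ?_))))
    simp only [val_add, val_sub, val_mem, val_const]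
    refine Runs.bindNat hN (divProg_runs s _ hN ?_ ?_) (by norm_num) ?_
    · simp [g43]; omega
    · simpa [g43, ← h8] using g42
    rintro g' ⟨g50, g53, hag'⟩
    simp at g50 g53
    refine Runs.assign_seq hN (Runs.assign_seq hN ?_)
    simp only [val_mem, val_const]
    have e40 : g' 40 = g 40 := by rw [hag' 40 (by norm_num)]; simp
    have e41 : g' 41 = g 41 := by rw [hag' 41 (by norm_num)]; simp
    have e43 : g' 43 = t := by rw [hag' 43 (by norm_num)]; simp [g43]
    have e44 : g' 44 = u 44 := by rw [hag' 44 (by norm_num)]; simp [g44]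
    refine Runs.bindNat hN (stepProg_runs s _ hN ?_ ?_) (by norm_num) ?_
    · simpa [e40, e44] using g40
    · simpa [e41, e44] using g41
    rintro g'' ⟨hstep, hag''⟩
    simp [e40, e41, e44, g50] at hstep
    have f42 : g'' 42 = g 42 / 8 := by rw [hag'' 42 (by norm_num)]; simp [g53]
    have f43 : g'' 43 = t := by rw [hag'' 43 (by norm_num)]; simp [e43]
    have f44 : g'' 44 = u 44 := by rw [hag'' 44 (by norm_num)]; simp [e44]
    have hlt := natStep_lt (N := u 44) (l := g 42 % 8) (p := (g 40, g 41)) ⟨g40, g41⟩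
    rw [← hstep] at hlt
    refine ⟨g'', rfl, f43, f44, ?_, hlt.1, hlt.2, ?_, ?_⟩
    · rw [f42]
      rw [pow_succ'] at g42
      exact Nat.div_lt_of_lt_mul g42
    · rw [f42, hstep, ← hw, natWalk]
    · intro a ha
      rw [hag'' a (by omega), Function.update_of_ne (by omega), Function.update_of_ne (by omega),
        hag' a (by omega), Function.update_of_ne (by omega), Function.update_of_ne (by omega),
        Function.update_of_ne (by omega), Function.update_of_ne (by omega), hag a ha]
  · rintro g ⟨g43, g44, g42, g40, g41, hw, hag⟩
    refine ⟨by simp [g43], g, rfl, ?_, hag⟩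
    rwa [Nat.sub_self, natWalk] at hw

theorem numWalkProg_runs (s : State d) (u : ℕ → ℕ) (hN : 3 ≤ N) (h30 : u 30 < 2 ^ (2 * u 33))
    (h33 : 2 * u 33 ≤ N) (h43 : 3 * u 43 ≤ N) (h42 : u 42 < 8 ^ u 43) :
    Runs k f N 36 numWalkProg (NatPost s fun g =>
      g 30 = numWalk (u 33) (u 43) (u 42) (u 30) ∧ ∀ a, a ≠ 30 → a < 40 ∨ 64 ≤ a → g a = u a)
      { s with nat := u } := by
  refine Runs.assign_seq hN (Runs.assign_seq hN (Runs.assign_seq hN (Runs.seq hN ?_)))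
  simp only [val_mem, val_const]
  refine Runs.bindNat hN (divProg_runs s _ hN ?_ ?_) (by norm_num) ?_
  · simp; omega
  · simpa [two_mul] using h30
  rintro g ⟨g50, g53, hag⟩
  simp at g50 g53
  have e33 : g 33 = u 33 := by rw [hag 33 (by norm_num)]; simp
  have e42 : g 42 = u 42 := by rw [hag 42 (by norm_num)]; simp
  have e43 : g 43 = u 43 := by rw [hag 43 (by norm_num)]; simp
  refine Runs.assign_seq hN (Runs.assign_seq hN (Runs.assign_seq hN (Runs.assign_seq hN
    (Runs.seq hN ?_))))
  simp only [val_mem, val_const]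
  refine Runs.bindNat hN (shiftProg_runs s _ hN ?_) (by norm_num) ?_
  · simp [e33]; omega
  rintro g' ⟨g60, hag'⟩
  simp [e33] at g60
  have e33' : g' 33 = u 33 := by rw [hag' 33 (by norm_num)]; simp [e33]
  have e42' : g' 42 = u 42 := by rw [hag' 42 (by norm_num)]; simp [e42]
  have e43' : g' 43 = u 43 := by rw [hag' 43 (by norm_num)]; simp [e43]
  have e40' : g' 40 = u 30 / 2 ^ u 33 := by rw [hag' 40 (by norm_num)]; simp [g53]
  have e41' : g' 41 = u 30 % 2 ^ u 33 := by rw [hag' 41 (by norm_num)]; simp [g50]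
  refine Runs.assign_seq hN (Runs.seq hN ?_)
  simp only [val_mem, val_const]
  refine Runs.bindNat hN (walkProg_runs s _ hN ?_ ?_ ?_ ?_) (by norm_num) ?_
  · simpa [e40', g60] using (div_mod_lt h30).1
  · simpa [e41', g60] using (div_mod_lt h30).2
  · simpa [e43'] using h43
  · simpa [e42', e43'] using h42
  rintro g'' ⟨hw, hag''⟩
  simp [e40', e41', e42', e43', g60] at hw
  have e33'' : g'' 33 = u 33 := by rw [hag'' 33 (by norm_num)]; simp [e33']
  refine Runs.assign_seq hN (Runs.assign_seq hN (Runs.seq hN ?_))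
  simp only [val_mem, val_const]
  refine Runs.bindNat hN (shiftProg_runs s _ hN ?_) (by norm_num) ?_
  · simp [e33'']; omega
  rintro v ⟨v60, hav⟩
  simp [e33''] at v60
  have v41 : v 41 = g'' 41 := by rw [hav 41 (by norm_num)]; simp
  refine Runs.assign hN ⟨_, rfl, ?_, fun a ha ha' => ?_⟩
  · simp [v60, v41, numWalk, ← hw]
  · rw [Function.update_of_ne ha, hav a (by omega), Function.update_of_ne (by omega),
      Function.update_of_ne (by omega), hag'' a (by omega), Function.update_of_ne (by omega),
      hag' a (by omega), Function.update_of_ne (by omega), Function.update_of_ne (by omega),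
      Function.update_of_ne (by omega), Function.update_of_ne (by omega), hag a (by omega),
      Function.update_of_ne (by omega), Function.update_of_ne (by omega),
      Function.update_of_ne (by omega)]

theorem halfLength_mono (D e h₀ : ℕ) {i j : ℕ}
    (h : i ≤ j) :
    halfLength D e h₀ i ≤ halfLength D e h₀ j :=
  monotone_nat_of_le_succ (f := halfLength D e h₀) (fun _ => Nat.le_add_right _ _) h

/-- The recursion of `generator` is a tail recursion: it descends one level at a time, keeping the
seed or replacing it by a walk endpoint. The invariant says that the block still to be computed is
the original one. A single block thus costs polynomial time, without the other blocks. -/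
theorem generatorProg_runs (s : State d) (u : ℕ → ℕ) (hN : 3 ≤ N) (h4 : u 4 ≤ N)
    (h9 : u 9 = halfLength (u 6) (u 7) (u 8) (u 4)) (h9N : 2 * u 9 ≤ N)
    (h10 : u 10 < 2 ^ (2 * u 9)) :
    Runs k f N 65 generatorProg (NatPost s fun g =>
      g 30 = generator (u 6) (u 7) (u 8) (u 4) (u 10) (u 11) ∧ AgreesOff 30 u g)
      { s with nat := u } := by
  refine Runs.assign_seq hN (Runs.assign_seq hN (Runs.assign_seq hN (Runs.assign_seq hN ?_)))
  simp only [val_mem, val_const]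
  refine Runs.natLoop (fun j g => g 31 = u 4 - j ∧
    g 33 = halfLength (u 6) (u 7) (u 8) (u 4 - j) ∧ g 30 < 2 ^ (2 * g 33) ∧
    generator (u 6) (u 7) (u 8) (u 4 - j) (g 30) (g 32) =
      generator (u 6) (u 7) (u 8) (u 4) (u 10) (u 11) ∧ AgreesOff 30 u g) (u 4) hN h4 ?_ ?_ ?_
  · refine ⟨by simp, by simp [h9], by simpa using h10, by simp, ?_⟩
    intro a ha
    rw [Function.update_of_ne (by omega), Function.update_of_ne (by omega),
      Function.update_of_ne (by omega), Function.update_of_ne (by omega)]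
  · rintro j hj g ⟨g31, g33, g30, hgen, hag⟩
    refine ⟨by simp [g31]; omega, ?_⟩
    obtain ⟨i, hi⟩ : ∃ i, u 4 - j = i + 1 := ⟨u 4 - j - 1, by omega⟩
    rw [hi] at g31 g33 hgen
    rw [show u 4 - (j + 1) = i by omega]
    have g6 : g 6 = u 6 := hag 6 (by norm_num)
    have g7 : g 7 = u 7 := hag 7 (by norm_num)
    set h := halfLength (u 6) (u 7) (u 8) i with hh
    set w := u 6 * 2 ^ i + u 7 with hw
    have hsucc : g 33 = h + 12 * w := g33
    have hle : 2 * (h + 12 * w) ≤ N := by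
      have := halfLength_mono (u 6) (u 7) (u 8) (show i + 1 ≤ u 4 by omega)
      rw [← h9] at this
      rw [← hsucc, g33]; omega
    refine Runs.assign_seq hN (Runs.assign_seq hN (Runs.assign_seq hN (Runs.seq hN ?_)))
    simp only [val_sub, val_mem, val_const]
    refine Runs.bindNat hN (shiftProg_runs s _ hN ?_) (by norm_num) ?_
    · simp [g31]; omega
    rintro v ⟨v60, hav⟩
    simp [g31, g6] at v60
    have v7 : v 7 = u 7 := by rw [hav 7 (by norm_num)]; simp [g7]
    have v33 : v 33 = h + 12 * w := by rw [hav 33 (by norm_num)]; simp [hsucc]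
    have v30 : v 30 = g 30 := by rw [hav 30 (by norm_num)]; simp
    have v31 : v 31 = i := by rw [hav 31 (by norm_num)]; simp [g31]
    have v32 : v 32 = g 32 := by rw [hav 32 (by norm_num)]; simp
    have hvag : AgreesOff 30 u v := by
      intro a ha
      rw [hav a (by omega), Function.update_of_ne (by omega), Function.update_of_ne (by omega),
        Function.update_of_ne (by omega), hag a ha]
    clear hav
    refine Runs.assign_seq hN (Runs.assign_seq hN (Runs.assign_seq hN (Runs.assign_seq hN
      (Runs.assign_seq hN (Runs.assign_seq hN (Runs.assign_seq hN (Runs.assign_seq hN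
      (Runs.seq hN ?_))))))))
    simp [v60, v7, v33, v30, ← hw]
    -- Tripling `w` and doubling twice gives the increment of `halfLength`; subtracting it recovers
    -- the half length of the lower level.
    rw [show h + 12 * w - (w + w + w + (w + w + w) + (w + w + w + (w + w + w))) = h by omega]
    have h8 : (2 : ℕ) ^ (h + h + (w + w + w + (w + w + w) + (w + w + w + (w + w + w)) +
        (w + w + w + (w + w + w) + (w + w + w + (w + w + w))))) = 2 ^ (2 * h) * 8 ^ (8 * w) := by
      rw [show (8 : ℕ) = 2 ^ 3 by norm_num, ← pow_mul, ← pow_add]; congr 1; ring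
    have hg30 : g 30 < 2 ^ (2 * h) * 8 ^ (8 * w) := by
      rw [← h8]
      refine lt_of_lt_of_eq g30 ?_
      rw [hsucc]; congr 1; ring
    refine Runs.bindNat hN (divProg_runs s _ hN ?_ ?_) (by norm_num) ?_
    · simp; omega
    · simpa [h8] using hg30
    rintro v' ⟨v50', v53', hav'⟩
    simp [← two_mul] at v50' v53'
    have v31' : v' 31 = i := by rw [hav' 31 (by norm_num)]; simp [v31]
    have v32' : v' 32 = g 32 := by rw [hav' 32 (by norm_num)]; simp [v32]
    have v33' : v' 33 = h := by rw [hav' 33 (by norm_num)]; simp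
    have v34' : v' 34 = w := by rw [hav' 34 (by norm_num)]; simp
    have hvag' : AgreesOff 30 u v' := by
      intro a ha
      rw [hav' a (by omega), Function.update_of_ne (by omega), Function.update_of_ne (by omega),
        Function.update_of_ne (by omega), Function.update_of_ne (by omega),
        Function.update_of_ne (by omega), Function.update_of_ne (by omega), hvag a ha]
    clear hav'
    refine Runs.assign_seq hN (Runs.assign_seq hN (Runs.assign_seq hN (Runs.seq hN ?_)))
    simp only [val_mem, val_const]
    refine Runs.bindNat hN (shiftProg_runs s _ hN ?_) (by norm_num) ?_
    · simp [v31']; omega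
    rintro x ⟨x60, hax⟩
    simp [v31'] at x60
    have x30 : x 30 = g 30 % 2 ^ (2 * h) := by rw [hax 30 (by norm_num)]; simp [v50']
    have x31 : x 31 = i := by rw [hax 31 (by norm_num)]; simp [v31']
    have x32 : x 32 = g 32 := by rw [hax 32 (by norm_num)]; simp [v32']
    have x33 : x 33 = h := by rw [hax 33 (by norm_num)]; simp [v33']
    have x34 : x 34 = w := by rw [hax 34 (by norm_num)]; simp [v34']
    have x53 : x 53 = g 30 / 2 ^ (2 * h) := by rw [hax 53 (by norm_num)]; simp [v53']
    have hxag : AgreesOff 30 u x := by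
      intro a ha
      rw [hax a (by omega), Function.update_of_ne (by omega), Function.update_of_ne (by omega),
        Function.update_of_ne (by omega), hvag' a ha]
    clear hax
    have hmod : g 30 % 2 ^ (2 * h) < 2 ^ (2 * h) := Nat.mod_lt _ (by positivity)
    rw [generator, ← hh, ← hw] at hgen
    refine Runs.ite (e := 41) hN (fun hlt => ?_) (fun hlt => ?_)
    · simp [x32, x60] at hlt
      rw [if_neg (not_le.2 hlt)] at hgen
      refine Runs.skip hN ⟨x, rfl, x31, x33, ?_, ?_, hxag⟩
      · rw [x30, x33]; exact hmod
      · rw [x30, x32]; exact hgen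
    · simp [x32, x60] at hlt
      rw [if_pos hlt] at hgen
      refine Runs.assign_seq hN (Runs.assign_seq hN (Runs.assign_seq hN (Runs.assign_seq hN
        (Runs.assign_seq hN ?_))))
      simp [x32, x60, x53, x34]
      rw [show w + w + (w + w) + (w + w + (w + w)) = 8 * w by ring]
      refine Runs.bindNat hN (numWalkProg_runs s _ hN ?_ ?_ ?_ ?_) (by norm_num) ?_
      · simpa [x30, x33] using hmod
      · simp [x33]; omega
      · simp; omega
      · simpa using Nat.div_lt_of_lt_mul hg30
      rintro y ⟨y30, hay⟩
      simp [x30, x33] at y30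
      have y31 : y 31 = i := by rw [hay 31 (by norm_num) (by norm_num)]; simp [x31]
      have y32 : y 32 = g 32 - 2 ^ i := by rw [hay 32 (by norm_num) (by norm_num)]; simp
      have y33 : y 33 = h := by rw [hay 33 (by norm_num) (by norm_num)]; simp [x33]
      refine ⟨y, rfl, y31, y33, ?_, ?_, ?_⟩
      · rw [y30, y33]; exact numWalk_lt hmod
      · rw [y30, y32]; exact hgen
      · intro a ha
        rw [hay a (by omega) (by omega), Function.update_of_ne (by omega),
          Function.update_of_ne (by omega), Function.update_of_ne (by omega), hxag a ha]
  · rintro g ⟨g31, g33, g30, hgen, hag⟩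
    refine ⟨by simp [g31], g, rfl, ?_, hag⟩
    rwa [Nat.sub_self, generator] at hgen

/-- Bits are extracted from the top by comparing with a power of two and subtracting it. The
remainder modulo the next power is what is left. -/
theorem bitsProg_runs (s : State d) (u : ℕ → ℕ) (hN : 3 ≤ N) (h8 : 2 * u 8 ≤ N)
    (h30 : u 30 < 2 ^ (2 * u 8)) :
    Runs k f N 12 bitsProg (NatPost s fun g =>
      (∀ q < 2 * u 8, g (64 + q) = ((u 30).testBit q).toNat) ∧ ∀ a < 30, g a = u a)
      { s with nat := u } := by
  refine Runs.assign_seq hN ?_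
  simp only [val_add, val_mem, val_const]
  refine Runs.natLoop (fun j g => g 36 = 2 * u 8 - j ∧ g 30 = u 30 % 2 ^ (2 * u 8 - j) ∧
    (∀ q, 2 * u 8 - j ≤ q → q < 2 * u 8 → g (64 + q) = ((u 30).testBit q).toNat) ∧
    ∀ a < 30, g a = u a) (2 * u 8) hN h8 ?_ ?_ ?_
  · refine ⟨by simp [two_mul], by simp [Nat.mod_eq_of_lt h30], fun q h1 h2 => by omega,
      fun a ha => ?_⟩
    rw [Function.update_of_ne (by omega)]
  · rintro j hj g ⟨g36, g30, hbits, hag⟩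
    refine ⟨by simp [g36]; omega, ?_⟩
    obtain ⟨c, hc⟩ : ∃ c, 2 * u 8 - j = c + 1 := ⟨2 * u 8 - j - 1, by omega⟩
    rw [hc] at g36 g30 hbits
    rw [show 2 * u 8 - (j + 1) = c by omega]
    refine Runs.assign_seq hN (Runs.assign_seq hN (Runs.assign_seq hN (Runs.seq hN ?_)))
    simp only [val_sub, val_mem, val_const]
    refine Runs.bindNat hN (shiftProg_runs s _ hN ?_) (by norm_num) ?_
    · simp [g36]; omega
    rintro v ⟨v60, hav⟩
    simp [g36] at v60
    have v36 : v 36 = c := by rw [hav 36 (by norm_num)]; simp [g36]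
    have v30 : v 30 = u 30 % 2 ^ (c + 1) := by rw [hav 30 (by norm_num)]; simp [g30]
    have vbits : ∀ q, c + 1 ≤ q → q < 2 * u 8 → v (64 + q) = ((u 30).testBit q).toNat := by
      intro q h1 h2
      rw [hav _ (by omega), Function.update_of_ne (by omega), Function.update_of_ne (by omega),
        Function.update_of_ne (by omega), hbits q h1 h2]
    have vag : ∀ a < 30, v a = u a := by
      intro a ha
      rw [hav _ (by omega), Function.update_of_ne (by omega), Function.update_of_ne (by omega),
        Function.update_of_ne (by omega), hag a ha]
    clear hav
    obtain ⟨m1, m2⟩ := div_mod_two_pow_succ (u 30) c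
    have hml := Nat.mod_lt (u 30) (show 0 < 2 ^ c by positivity)
    refine Runs.ite (e := 4) hN (fun hlt => ?_) (fun hlt => ?_)
    · simp [v30, v60] at hlt
      have ht : (u 30).testBit c = false := by
        rw [Nat.testBit_eq_decide_div_mod_eq, decide_eq_false_iff_not]
        intro h1
        rw [h1] at m2
        omega
      refine Runs.setN hN ⟨_, rfl, ?_⟩
      simp only [val_add, val_mem, val_const, v36]
      refine ⟨?_, ?_, fun q h1 h2 => ?_, fun a ha => ?_⟩
      · rw [Function.update_of_ne (by omega), v36]
      · rw [Function.update_of_ne (by omega), v30, (div_mod_two_pow_of_lt hlt).2]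
      · rcases Nat.lt_or_ge c q with h3 | h3
        · rw [Function.update_of_ne (by omega), vbits q h3 h2]
        · obtain rfl : q = c := by omega
          rw [Function.update_self, ht]; rfl
      · rw [Function.update_of_ne (by omega), vag a ha]
    · simp [v30, v60] at hlt
      have ht : (u 30).testBit c = true := by
        rw [Nat.testBit_eq_decide_div_mod_eq, decide_eq_true_iff]
        rcases Nat.mod_two_eq_zero_or_one (u 30 / 2 ^ c) with h1 | h1
        · rw [h1] at m2
          omega
        · exact h1
      refine Runs.assign_seq hN (Runs.setN hN ⟨_, rfl, ?_⟩)
      simp only [val_add, val_sub, val_mem, val_const]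
      rw [show Function.update v 30 (v 30 - v 60) 36 = c by simp [v36]]
      refine ⟨?_, ?_, fun q h1 h2 => ?_, fun a ha => ?_⟩
      · rw [Function.update_of_ne (by omega), Function.update_of_ne (by omega), v36]
      · rw [Function.update_of_ne (by omega), Function.update_self, v30, v60,
          (div_mod_two_pow_of_le hlt).2]
      · rcases Nat.lt_or_ge c q with h3 | h3
        · rw [Function.update_of_ne (by omega), Function.update_of_ne (by omega), vbits q h3 h2]
        · obtain rfl : q = c := by omega
          rw [Function.update_self, ht]; rfl
      · rw [Function.update_of_ne (by omega), Function.update_of_ne (by omega), vag a ha]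
  · rintro g ⟨g36, g30, hbits, hag⟩
    refine ⟨by simp [g36], g, rfl, fun q hq => hbits q (by omega) hq, hag⟩

end Generator

/-! ### The program for rounding -/

/-- Coordinate number (register 24) of the value of the current function. -/
abbrev coordinate : RExpr := .mem (num 8 + reg 24)

/-- Set register 23 to 0 if the shift in real register 5 is bad for a coordinate in the block from
register 20 to register 21. -/
def checkProg : Prog :=
  assign 24 (reg 20) ;;
    .loop (.ltN (reg 24) (reg 21))
      (.ite (.ltR (.roundDown (coordinate - realReg 0 + realReg 5) (realReg 4))
          (.roundDown (coordinate + realReg 0 + realReg 5) (realReg 4))) (assign 23 (num 0)) .skip ;;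
        assign 24 (reg 24 + num 1))

/-- Round the coordinates in the block with the shift in real register 5. -/
def writeProg : Prog :=
  assign 24 (reg 20) ;;
    .loop (.ltN (reg 24) (reg 21))
      (.setR (num 8 + reg 2 + reg 24) (.roundDown (coordinate + realReg 5) (realReg 4)) ;;
        assign 24 (reg 24 + num 1))

/-- Round the coordinates in the block with the last good shift. -/
def blockProg : Prog :=
  assign 22 (num 0) ;; assignReal 5 (.const 0) ;;
    .loop (.ltN (reg 22) (reg 3 + num 1))
      (assign 23 (num 1) ;; checkProg ;; .ite (.ltN (num 0) (reg 23)) writeProg .skip ;;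
        assignReal 5 (realReg 5 + (realReg 0 + realReg 0)) ;; assign 22 (reg 22 + num 1))

/-- Round all blocks. -/
def roundProg : Prog :=
  assign 20 (num 0) ;;
    .loop (.ltN (reg 20) (reg 2))
      (assign 21 (reg 20 + reg 3) ;; .ite (.ltN (reg 2) (reg 21)) (assign 21 (reg 2)) .skip ;;
        blockProg ;; assign 20 (reg 20 + reg 3))

section Rounding

variable {n d k : ℕ} {f : List (Fin d → ℝ) → Bits n → Fin d → ℝ} {N e : ℕ} {s : State d}
  {Q : State d → Prop}

/-- The state is `s`, except that its memories satisfy `R`. -/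
def MemPost (s : State d) (R : (ℕ → ℕ) → (ℕ → ℝ) → Prop) (s' : State d) : Prop :=
  ∃ g ρ, s' = { s with nat := g, real := ρ } ∧ R g ρ

theorem Runs.memLoop {g : ℕ → ℕ} {ρ : ℕ → ℝ} {b : Test} {p : Prog}
    (I : ℕ → (ℕ → ℕ) → (ℕ → ℝ) → Prop) (c : ℕ) (hN : 3 ≤ N) (hc : c ≤ N) (h0 : I 0 g ρ)
    (hstep : ∀ j < c, ∀ g ρ, I j g ρ → b.Holds { s with nat := g, real := ρ } ∧
      Runs k f N e p (MemPost s (I (j + 1))) { s with nat := g, real := ρ })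
    (hend : ∀ g ρ, I c g ρ → ¬ b.Holds { s with nat := g, real := ρ } ∧
      Q { s with nat := g, real := ρ }) :
    Runs k f N (e + 2) (.loop b p) Q { s with nat := g, real := ρ } := by
  refine Runs.loop (fun j => MemPost s (I j)) c hN hc ⟨g, ρ, rfl, h0⟩ ?_ ?_
  · rintro j hj _ ⟨g, ρ, rfl, hg⟩
    exact hstep j hj g ρ hg
  · rintro _ ⟨g, ρ, rfl, hg⟩
    exact hend g ρ hg

theorem Runs.bindMem {e' : ℕ} {p : Prog} {R : (ℕ → ℕ) → (ℕ → ℝ) → Prop} {s' : State d}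
    (hN : 3 ≤ N) (h : Runs k f N e p (MemPost s R) s') (he : e ≤ e')
    (hQ : ∀ g ρ, R g ρ → Q { s with nat := g, real := ρ }) : Runs k f N e' p Q s' := by
  refine h.mono hN he ?_
  rintro _ ⟨g, ρ, rfl, hg⟩
  exact hQ g ρ hg

theorem Runs.assignMem {g : ℕ → ℕ} {ρ : ℕ → ℝ} {a : ℕ} {x : NExpr} (hN : 3 ≤ N)
    (h : Q { s with
      nat := Function.update g a (x.val { s with nat := g, real := ρ }), real := ρ }) :
    Runs k f N e (.setN (.const a) x) Q { s with nat := g, real := ρ } :=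
  Runs.setN hN h

theorem Runs.assignMem_seq {g : ℕ → ℕ} {ρ : ℕ → ℝ} {a : ℕ} {x : NExpr} {q : Prog} (hN : 3 ≤ N)
    (h : Runs k f N e q Q { s with
      nat := Function.update g a (x.val { s with nat := g, real := ρ }), real := ρ }) :
    Runs k f N (e + 1) (.seq (.setN (.const a) x) q) Q { s with nat := g, real := ρ } :=
  Runs.seq hN (Runs.assignMem hN h)

theorem Runs.assignReal_seq {g : ℕ → ℕ} {ρ : ℕ → ℝ} {a : NExpr} {x : RExpr} {q : Prog}
    (hN : 3 ≤ N)
    (h : Runs k f N e q Q { s with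
      nat := g
      real := Function.update ρ (a.val { s with nat := g, real := ρ })
        (x.val { s with nat := g, real := ρ }) }) :
    Runs k f N (e + 1) (.seq (.setR a x) q) Q { s with nat := g, real := ρ } :=
  Runs.seq hN (Runs.setR hN h)

open Classical in
theorem checkProg_runs (s : State d) (g : ℕ → ℕ) (ρ : ℕ → ℝ) (hN : 3 ≤ N) (h20 : g 20 ≤ g 21)
    (h21 : g 21 ≤ N) :
    Runs k f N 5 checkProg (MemPost s fun g' ρ' => ρ = ρ' ∧
      g' 23 = (if ∀ j, g 20 ≤ j → j < g 21 → ¬ roundTo (ρ (8 + j) - ρ 0 + ρ 5) (ρ 4) <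
        roundTo (ρ (8 + j) + ρ 0 + ρ 5) (ρ 4) then g 23 else 0) ∧ ∀ a < 23, g' a = g a)
      { s with nat := g, real := ρ } := by
  refine Runs.assignMem_seq hN ?_
  simp only [val_mem, val_const]
  refine Runs.memLoop (fun i g' ρ' => ρ = ρ' ∧ g' 24 = g 20 + i ∧
    g' 23 = (if ∀ j, g 20 ≤ j → j < g 20 + i → ¬ roundTo (ρ (8 + j) - ρ 0 + ρ 5) (ρ 4) <
        roundTo (ρ (8 + j) + ρ 0 + ρ 5) (ρ 4) then g 23 else 0) ∧ ∀ a < 23, g' a = g a)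
    (g 21 - g 20) hN (by omega) ?_ ?_ ?_
  · refine ⟨rfl, by simp, ?_, fun a ha => ?_⟩
    · rw [if_pos (fun j h1 h2 => by omega)]; simp
    · rw [Function.update_of_ne (by omega)]
  · rintro i hi g' _ ⟨rfl, g24, g23, hag⟩
    have g21 := hag 21 (by norm_num)
    refine ⟨by simp [g24, g21]; omega, Runs.seq hN ?_⟩
    refine Runs.ite (e := 0) hN (fun hlt => ?_) (fun hlt => ?_)
    · simp [g24] at hlt
      refine Runs.assignMem hN (Runs.assignMem hN ⟨_, _, rfl, rfl, ?_, ?_, fun a ha => ?_⟩)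
      · simp [g24]; omega
      · rw [if_neg fun hall => hall (g 20 + i) (by omega) (by omega) hlt]; simp
      · rw [Function.update_of_ne (by omega), Function.update_of_ne (by omega), hag a ha]
    · simp only [holds_ltR, realVal_roundDown, realVal_add, realVal_sub, realVal_mem, val_add,
        val_mem, val_const, g24] at hlt
      refine Runs.skip hN (Runs.assignMem hN ⟨_, _, rfl, rfl, ?_, ?_, fun a ha => ?_⟩)
      · simp [g24]; omega
      · rw [Function.update_of_ne (by norm_num), g23]
        congr 1
        rw [eq_iff_iff]
        refine ⟨fun h j h1 h2 => ?_, fun h j h1 h2 => h j h1 (by omega)⟩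
        rcases Nat.lt_or_ge j (g 20 + i) with h3 | h3
        · exact h j h1 h3
        · obtain rfl : j = g 20 + i := by omega
          exact hlt
      · rw [Function.update_of_ne (by omega), hag a ha]
  · rintro g' _ ⟨rfl, g24, g23, hag⟩
    have g21 := hag 21 (by norm_num)
    rw [Nat.add_sub_cancel' h20] at g23 g24
    exact ⟨by simp [g24, g21], _, _, rfl, rfl, g23, hag⟩

theorem writeProg_runs (s : State d) (g : ℕ → ℕ) (ρ : ℕ → ℝ) (hN : 3 ≤ N) (h20 : g 20 ≤ g 21)
    (h21 : g 21 ≤ N) (h2 : g 21 ≤ g 2) :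
    Runs k f N 4 writeProg (MemPost s fun g' ρ' =>
      (∀ j, g 20 ≤ j → j < g 21 → ρ' (8 + g 2 + j) = roundTo (ρ (8 + j) + ρ 5) (ρ 4)) ∧
        (∀ a < 8 + g 2 + g 20, ρ' a = ρ a) ∧ ∀ a < 23, g' a = g a)
      { s with nat := g, real := ρ } := by
  refine Runs.assignMem_seq hN ?_
  simp only [val_mem, val_const]
  refine Runs.memLoop (fun i g' ρ' => g' 24 = g 20 + i ∧
      (∀ j, g 20 ≤ j → j < g 20 + i → ρ' (8 + g 2 + j) = roundTo (ρ (8 + j) + ρ 5) (ρ 4)) ∧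
        (∀ a < 8 + g 2 + g 20, ρ' a = ρ a) ∧ ∀ a < 23, g' a = g a)
    (g 21 - g 20) hN (by omega) ?_ ?_ ?_
  · refine ⟨by simp, fun j h1 h2 => by omega, fun a _ => rfl, fun a ha => ?_⟩
    rw [Function.update_of_ne (by omega)]
  · rintro i hi g' ρ' ⟨g24, hout, hρ, hag⟩
    have g21 := hag 21 (by norm_num)
    have g2 := hag 2 (by norm_num)
    refine ⟨by simp [g24, g21]; omega, Runs.assignReal_seq hN ?_⟩
    simp only [realVal_roundDown, realVal_add, realVal_mem, val_add, val_mem, val_const, g24, g2]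
    rw [hρ 4 (by omega), hρ 5 (by omega), hρ (8 + (g 20 + i)) (by omega)]
    refine Runs.assignMem hN ⟨_, _, rfl, ?_, fun j h1 h3 => ?_, fun a ha => ?_, fun a ha => ?_⟩
    · simp [g24]; omega
    · rcases Nat.lt_or_ge j (g 20 + i) with h4 | h4
      · rw [Function.update_of_ne (by omega), hout j h1 h4]
      · obtain rfl : j = g 20 + i := by omega
        rw [Function.update_self]
    · rw [Function.update_of_ne (by omega), hρ a ha]
    · rw [Function.update_of_ne (by omega), hag a ha]
  · rintro g' ρ' ⟨g24, hout, hρ, hag⟩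
    have g21 := hag 21 (by norm_num)
    rw [Nat.add_sub_cancel' h20] at hout g24
    exact ⟨by simp [g24, g21], _, _, rfl, hout, hρ, hag⟩

open Classical in
theorem blockProg_runs (s : State d) (g : ℕ → ℕ) (ρ : ℕ → ℝ) (W : ℕ → ℝ) {ε : ℝ} (hε : 0 < ε)
    (hN : 3 ≤ N) (h20 : g 20 ≤ g 21) (h21 : g 21 = blockEnd (g 2) (g 3) (g 20)) (h2 : g 2 ≤ N)
    (h3 : g 3 + 1 ≤ N) (hW : ∀ j < g 2, ρ (8 + j) = W j) (hρ0 : ρ 0 = ε)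
    (hρ4 : ρ 4 = cellWidth ε (g 3)) :
    Runs k f N 14 blockProg (MemPost s fun g' ρ' =>
      (∀ j, g 20 ≤ j → j < g 21 → ρ' (8 + g 2 + j) =
        shiftRound ε (g 3) (blockShift ε (g 2) (g 3) W (g 20)) (W j)) ∧
        (∀ a < 8 + g 2 + g 20, a ≠ 5 → ρ' a = ρ a) ∧ ∀ a < 22, g' a = g a)
      { s with nat := g, real := ρ } := by
  have h21le : g 21 ≤ g 2 := by rw [h21]; exact min_le_right _ _
  refine Runs.assignMem_seq hN (Runs.assignReal_seq hN ?_)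
  simp only [val_const, realVal_const, Nat.cast_zero]
  -- The loop tries all shifts without stopping, and each good one overwrites the output. After `D`
  -- rounds the output therefore belongs to the last good shift below `D`, and nothing is known
  -- before the first good one.
  refine Runs.memLoop (fun D g' ρ' => g' 22 = D ∧ ρ' 5 = D * (2 * ε) ∧
      ((∃ D' < D, GoodShift ε (g 3) W (g 20) (g 21) D') → ∀ j, g 20 ≤ j → j < g 21 →
        ρ' (8 + g 2 + j) = shiftRound ε (g 3)
          (lastBelow (GoodShift ε (g 3) W (g 20) (g 21)) D) (W j)) ∧
      (∀ a < 8 + g 2 + g 20, a ≠ 5 → ρ' a = ρ a) ∧ ∀ a < 22, g' a = g a)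
    (g 3 + 1) hN h3 ?_ ?_ ?_
  · refine ⟨by simp, by simp, ?_, fun a ha ha5 => ?_, fun a ha => ?_⟩
    · rintro ⟨D', hD', -⟩; omega
    · rw [Function.update_of_ne ha5]
    · rw [Function.update_of_ne (by omega)]
  · rintro D hD g' ρ' ⟨g22, r5, hout, hρ, hag⟩
    have f3 := hag 3 (by norm_num)
    have f2 := hag 2 (by norm_num)
    have f20 := hag 20 (by norm_num)
    have f21 := hag 21 (by norm_num)
    have r0 : ρ' 0 = ε := by rw [hρ 0 (by omega) (by norm_num), hρ0]
    have r4 : ρ' 4 = cellWidth ε (g 3) := by rw [hρ 4 (by omega) (by norm_num), hρ4]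
    have rW : ∀ j < g 2, ρ' (8 + j) = W j := fun j hj => by
      rw [hρ (8 + j) (by omega) (by omega), hW j hj]
    refine ⟨by simp [g22, f3]; omega, Runs.assignMem_seq hN (Runs.seq hN ?_)⟩
    simp only [val_const]
    refine Runs.bindMem hN (checkProg_runs s _ _ hN ?_ ?_) (by norm_num) ?_
    · simp [f20, f21, h20]
    · simp [f21]; omega
    rintro u _ ⟨rfl, u23, hu⟩
    have hgood : (∀ j, g 20 ≤ j → j < g 21 → ¬ roundTo (ρ' (8 + j) - ρ' 0 + ρ' 5) (ρ' 4) <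
        roundTo (ρ' (8 + j) + ρ' 0 + ρ' 5) (ρ' 4)) ↔ GoodShift ε (g 3) W (g 20) (g 21) D := by
      refine forall_congr' fun j => forall_congr' fun h1 => forall_congr' fun h2 => ?_
      rw [rW j (by omega), r0, r4, r5]
    have e20 : Function.update g' 23 1 20 = g 20 := by simp [f20]
    have e21 : Function.update g' 23 1 21 = g 21 := by simp [f21]
    replace u23 : u 23 = if GoodShift ε (g 3) W (g 20) (g 21) D then 1 else 0 := by
      rw [u23, e20, e21]
      exact if_congr hgood (by simp) rfl
    have u2 : u 2 = g 2 := by rw [hu 2 (by norm_num)]; simp [f2]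
    have u20 : u 20 = g 20 := by rw [hu 20 (by norm_num)]; simp [f20]
    have u21 : u 21 = g 21 := by rw [hu 21 (by norm_num)]; simp [f21]
    have u22 : u 22 = D := by rw [hu 22 (by norm_num)]; simp [g22]
    have hug : ∀ a < 22, u a = g a := fun a ha => by
      rw [hu a (by omega), Function.update_of_ne (by omega), hag a ha]
    clear hu
    refine Runs.seq hN (Runs.ite (e := 6) hN (fun hlt => ?_) (fun hlt => ?_))
    · have hG : GoodShift ε (g 3) W (g 20) (g 21) D := by
        by_contra hG
        rw [if_neg hG] at u23
        simp [u23] at hlt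
      refine Runs.bindMem hN (writeProg_runs s u ρ' hN (by omega) (by omega) (by omega))
        (by norm_num) ?_
      rintro v σ ⟨hσout, hσ, hv⟩
      rw [u2, u20] at hσ
      rw [u2, u20, u21] at hσout
      refine Runs.assignReal_seq hN (Runs.assignMem hN ⟨_, _, rfl, ?_⟩)
      simp only [val_add, val_mem, val_const, realVal_add, realVal_mem]
      refine ⟨by simp [hv, u22], ?_, fun _ j h1 h2 => ?_, fun a ha ha5 => ?_, fun a ha => ?_⟩
      · rw [Function.update_self, hσ 5 (by omega), hσ 0 (by omega), r5, r0]; push_cast; ring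
      · rw [Function.update_of_ne (by omega), hσout j h1 h2, rW j (by omega), r4, r5, lastBelow,
          if_pos hG]
        rfl
      · rw [Function.update_of_ne ha5, hσ a ha, hρ a ha ha5]
      · rw [Function.update_of_ne (by omega), hv a (by omega), hug a ha]
    · have hG : ¬ GoodShift ε (g 3) W (g 20) (g 21) D := by
        intro hG
        rw [if_pos hG] at u23
        simp [u23] at hlt
      refine Runs.skip hN (Runs.assignReal_seq hN (Runs.assignMem hN ⟨_, _, rfl, ?_⟩))
      simp only [val_add, val_mem, val_const, realVal_add, realVal_mem]
      refine ⟨by simp [u22], ?_, fun hex j h1 h2 => ?_, fun a ha ha5 => ?_, fun a ha => ?_⟩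
      · rw [Function.update_self, r5, r0]; push_cast; ring
      · rw [Function.update_of_ne (by omega), lastBelow, if_neg hG]
        refine hout ?_ j h1 h2
        obtain ⟨D', hD', hg'⟩ := hex
        have : D' ≠ D := fun h => hG (h ▸ hg')
        exact ⟨D', by omega, hg'⟩
      · rw [Function.update_of_ne ha5, hρ a ha ha5]
      · rw [Function.update_of_ne (by omega), hug a ha]
  · rintro g' ρ' ⟨g22, r5, hout, hρ, hag⟩
    have f3 := hag 3 (by norm_num)
    refine ⟨by simp [g22, f3], _, _, rfl, ?_, hρ, hag⟩
    have hex := exists_goodShift hε (d₀ := g 3) (b := g 20) (e := g 21)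
      (by rw [h21]; exact min_le_left _ _) W
    rw [blockShift, ← h21]
    exact hout hex

/-- The right side is the test of the loops that advance by `d₀`, so these make exactly `numBlocks d
d₀` rounds. -/
theorem lt_numBlocks {d d₀ q : ℕ} (hd₀ : 1 ≤ d₀) : q < numBlocks d d₀ ↔ q * d₀ < d := by
  rw [numBlocks, ← Nat.succ_le_iff, Nat.le_div_iff_mul_le hd₀, Nat.succ_mul]
  omega

theorem numBlocks_le {d d₀ : ℕ} (hd₀ : 1 ≤ d₀) : numBlocks d d₀ ≤ d := by
  by_contra h
  have := (lt_numBlocks hd₀).1 (not_le.1 h)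
  nlinarith

theorem roundProg_runs (s : State d) (g : ℕ → ℕ) (ρ : ℕ → ℝ) (W : ℕ → ℝ) {ε : ℝ} (hε : 0 < ε)
    (hN : 3 ≤ N) (h2 : g 2 ≤ N) (h31 : 1 ≤ g 3)
    (h3 : g 3 + 1 ≤ N) (hW : ∀ j < g 2, ρ (8 + j) = W j) (hρ0 : ρ 0 = ε)
    (hρ4 : ρ 4 = cellWidth ε (g 3)) :
    Runs k f N 20 roundProg (MemPost s fun g' ρ' =>
      (∀ j < g 2, ρ' (8 + g 2 + j) = roundSeq ε (g 2) (g 3) W j) ∧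
        (∀ a < 8 + g 2, a ≠ 5 → ρ' a = ρ a) ∧ ∀ a < 20, g' a = g a)
      { s with nat := g, real := ρ } := by
  refine Runs.assignMem_seq hN ?_
  simp only [val_const]
  refine Runs.memLoop (fun q g' ρ' => g' 20 = q * g 3 ∧
      (∀ j < g 2, j < q * g 3 → ρ' (8 + g 2 + j) = roundSeq ε (g 2) (g 3) W j) ∧
        (∀ a < 8 + g 2, a ≠ 5 → ρ' a = ρ a) ∧ ∀ a < 20, g' a = g a) (numBlocks (g 2) (g 3)) hN
      ((numBlocks_le h31).trans h2) ?_ ?_ ?_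
  · refine ⟨by simp, fun j _ hj => by omega, fun a _ _ => rfl, fun a ha => ?_⟩
    rw [Function.update_of_ne (by omega)]
  · rintro q hq g' ρ' ⟨g20, hout, hρ, hag⟩
    have hqd := (lt_numBlocks h31).1 hq
    have f2 := hag 2 (by norm_num)
    have f3 := hag 3 (by norm_num)
    refine ⟨by simp [g20, f2, hqd], Runs.assignMem_seq hN (Runs.seq hN ?_)⟩
    simp only [val_add, val_mem, val_const, g20, f3]
    -- The common continuation of the two branches that cut the block end off at `g 2`.
    have hend : ∀ u : ℕ → ℕ, u 20 = q * g 3 → u 21 = blockEnd (g 2) (g 3) (q * g 3) →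
        (∀ a < 20, u a = g a) → Runs k f N 15 (blockProg ;; assign 20 (reg 20 + reg 3))
        (MemPost s fun g' ρ' => g' 20 = (q + 1) * g 3 ∧
          (∀ j < g 2, j < (q + 1) * g 3 → ρ' (8 + g 2 + j) = roundSeq ε (g 2) (g 3) W j) ∧
          (∀ a < 8 + g 2, a ≠ 5 → ρ' a = ρ a) ∧ ∀ a < 20, g' a = g a)
        { s with nat := u, real := ρ' } := by
      intro u u20 u21 hu
      have u2 := hu 2 (by norm_num)
      have u3 := hu 3 (by norm_num)
      refine Runs.seq hN ?_
      refine Runs.bindMem hN (blockProg_runs s u ρ' W hε hN ?_ ?_ ?_ ?_ ?_ ?_ ?_) (by norm_num) ?_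
      · rw [u20, u21, blockEnd]; exact le_min (by omega) hqd.le
      · rw [u20, u21, u2, u3]
      · rw [u2]; exact h2
      · rw [u3]; exact h3
      · intro j hj
        rw [u2] at hj
        rw [hρ _ (by omega) (by omega), hW j hj]
      · rw [hρ 0 (by omega) (by norm_num), hρ0]
      · rw [hρ 4 (by omega) (by norm_num), hρ4, u3]
      rintro v σ ⟨hσout, hσ, hv⟩
      rw [u2, u20] at hσ
      rw [u2, u3, u20, u21] at hσout
      refine Runs.assignMem hN ⟨_, _, rfl, ?_⟩
      simp only [val_add, val_mem, val_const]
      refine ⟨?_, fun j h1 h2 => ?_, fun a ha ha5 => ?_, fun a ha => ?_⟩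
      · rw [Function.update_self, hv 20 (by norm_num), hv 3 (by norm_num), u20, u3]; ring
      · rcases Nat.lt_or_ge j (q * g 3) with h3 | h3
        · rw [hσ _ (by omega) (by omega), hout j h1 h3]
        · have hdiv : j / g 3 = q := by
            rw [Nat.div_eq_iff (by omega)]
            rw [add_mul] at h2
            constructor <;> omega
          rw [hσout j h3 (lt_min (by rw [add_mul] at h2; omega) h1), roundSeq, hdiv]
      · rw [hσ a (by omega) ha5, hρ a ha ha5]
      · rw [Function.update_of_ne (by omega), hv a (by omega), hu a ha]
    refine Runs.ite (e := 14) hN (fun hlt => ?_) (fun hlt => ?_)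
    · simp [hag] at hlt
      refine Runs.assignMem hN (hend _ ?_ ?_ fun a ha => ?_)
      · simp [g20]
      · simp [f2, blockEnd]; omega
      · rw [Function.update_of_ne (by omega), Function.update_of_ne (by omega), hag a ha]
    · simp [hag] at hlt
      refine Runs.skip hN (hend _ ?_ ?_ fun a ha => ?_)
      · simp [g20]
      · simp [blockEnd]; omega
      · rw [Function.update_of_ne (by omega), hag a ha]
  · rintro g' ρ' ⟨g20, hout, hρ, hag⟩
    have f2 := hag 2 (by norm_num)
    have hle : g 2 ≤ numBlocks (g 2) (g 3) * g 3 := by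
      by_contra h
      exact lt_irrefl _ ((lt_numBlocks h31).2 (not_le.1 h))
    refine ⟨by simp [g20, f2, hle], _, _, rfl, fun j hj => hout j hj (by omega), hρ, hag⟩

end Rounding

/-! ### The initialization -/

/-- The binary logarithm, rounded up, of register 12 goes to register 14. -/
def clogProg : Prog :=
  assign 14 (num 0) ;; assign 13 (num 1) ;;
    .loop (.ltN (reg 13) (reg 12)) (assign 13 (reg 13 + reg 13) ;; assign 14 (reg 14 + num 1))

/-- The number of blocks times register 5 goes to register 6. -/
def blocksProg : Prog :=
  assign 6 (num 0) ;; assign 12 (num 0) ;;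
    .loop (.ltN (reg 12) (reg 2)) (assign 6 (reg 6 + reg 5) ;; assign 12 (reg 12 + reg 3))

/-- The binary logarithm, rounded up, of the inverse of real register 2, plus register 4, goes to
register 7. -/
def logInvProg : Prog :=
  assign 7 (reg 4) ;; assignReal 3 (realReg 2) ;;
    .loop (.ltR (realReg 3) (.const 1))
      (assignReal 3 (realReg 3 + realReg 3) ;; assign 7 (reg 7 + num 1))

/-- Half of register 0, rounded up, goes to register 8. -/
def halfProg : Prog :=
  assign 8 (num 0) ;; .loop (.ltN (reg 8 + reg 8) (reg 0)) (assign 8 (reg 8 + num 1))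

/-- Half of the seed length of the generator goes to register 9. -/
def lengthProg : Prog :=
  assign 9 (reg 8) ;; assign 14 (reg 6) ;; assign 15 (num 0) ;;
    .loop (.ltN (reg 15) (reg 4))
      (assign 16 (reg 14 + reg 7) ;; assign 16 (reg 16 + reg 16 + reg 16) ;;
        assign 9 (reg 9 + (reg 16 + reg 16 + reg 16 + reg 16)) ;; assign 14 (reg 14 + reg 14) ;;
        assign 15 (reg 15 + num 1))

/-- Read the seed into register 10. -/
def coinsProg : Prog :=
  assign 10 (num 0) ;; assign 12 (num 0) ;;
    .loop (.ltN (reg 12) (reg 9 + reg 9))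
      (.coin (num 13) ;; assign 10 (reg 10 + reg 10 + reg 13) ;; assign 12 (reg 12 + num 1))

/-- The width of the cells goes to real register 4. -/
def cellProg : Prog :=
  assign 12 (num 0) ;; assignReal 4 (.const 0) ;;
    .loop (.ltN (reg 12) (reg 3 + num 1))
      (assignReal 4 (realReg 4 + (realReg 0 + realReg 0)) ;; assign 12 (reg 12 + num 1))

/-- The binary logarithm of `1 / γ`, rounded up. -/
def logInvCeil (γ : ℝ) : ℕ := ⌈Real.logb 2 (1 / γ)⌉₊

section Initialization

variable {n d k : ℕ} {f : List (Fin d → ℝ) → Bits n → Fin d → ℝ} {N : ℕ}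

theorem clogProg_runs (s : State d) (u : ℕ → ℕ) (hN : 3 ≤ N) (h : u 12 ≤ N) :
    Runs k f N 5 clogProg (NatPost s fun g => g 14 = Nat.clog 2 (u 12) ∧ ∀ a < 12, g a = u a)
      { s with nat := u } := by
  have hle : Nat.clog 2 (u 12) ≤ u 12 :=
    Nat.clog_le_of_le_pow (Nat.lt_two_pow_self).le
  refine Runs.assign_seq hN (Runs.assign_seq hN ?_)
  simp only [val_const]
  refine Runs.natLoop (fun j g => g 14 = j ∧ g 13 = 2 ^ j ∧ g 12 = u 12 ∧ ∀ a < 12, g a = u a)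
    (Nat.clog 2 (u 12)) hN (by omega) ?_ ?_ ?_
  · refine ⟨by simp, by simp, by simp, fun a ha => ?_⟩
    rw [Function.update_of_ne (by omega), Function.update_of_ne (by omega)]
  · rintro j hj g ⟨g14, g13, g12, hag⟩
    rw [Nat.lt_clog_iff_pow_lt (by norm_num)] at hj
    refine ⟨by simpa [g13, g12] using hj, Runs.assign_seq hN (Runs.assign hN ⟨_, rfl, ?_⟩)⟩
    simp only [val_add, val_mem, val_const]
    refine ⟨by simp [g14], by simp [g13, pow_succ]; ring, by simp [g12], fun a ha => ?_⟩
    rw [Function.update_of_ne (by omega), Function.update_of_ne (by omega), hag a ha]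
  · rintro g ⟨g14, g13, g12, hag⟩
    refine ⟨?_, g, rfl, g14, hag⟩
    simpa [g13, g12] using Nat.le_pow_clog (by norm_num) (u 12)

theorem blocksProg_runs (s : State d) (u : ℕ → ℕ) (hN : 3 ≤ N) (h2 : u 2 ≤ N) (h3 : 1 ≤ u 3) :
    Runs k f N 5 blocksProg
      (NatPost s fun g => g 6 = numBlocks (u 2) (u 3) * u 5 ∧ ∀ a < 12, a ≠ 6 → g a = u a)
      { s with nat := u } := by
  refine Runs.assign_seq hN (Runs.assign_seq hN ?_)
  simp only [val_const]
  refine Runs.natLoop (fun q g => g 6 = q * u 5 ∧ g 12 = q * u 3 ∧ ∀ a < 12, a ≠ 6 → g a = u a)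
    (numBlocks (u 2) (u 3)) hN ((numBlocks_le h3).trans h2) ?_ ?_ ?_
  · refine ⟨by simp, by simp, fun a ha ha6 => ?_⟩
    rw [Function.update_of_ne (by omega), Function.update_of_ne (by omega)]
  · rintro q hq g ⟨g6, g12, hag⟩
    have f2 := hag 2 (by norm_num) (by norm_num)
    have f3 := hag 3 (by norm_num) (by norm_num)
    have f5 := hag 5 (by norm_num) (by norm_num)
    rw [lt_numBlocks h3] at hq
    refine ⟨by simpa [g12, f2] using hq, Runs.assign_seq hN (Runs.assign hN ⟨_, rfl, ?_⟩)⟩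
    simp only [val_add, val_mem, val_const]
    refine ⟨by simp [g6, f5]; ring, by simp [g12, f3]; ring, fun a ha ha6 => ?_⟩
    rw [Function.update_of_ne (by omega), Function.update_of_ne (by omega), hag a ha ha6]
  · rintro g ⟨g6, g12, hag⟩
    have f2 := hag 2 (by norm_num) (by norm_num)
    refine ⟨?_, g, rfl, g6, hag⟩
    simp only [holds_ltN, val_mem, val_const, g12, f2, ← lt_numBlocks h3]
    exact lt_irrefl _

/-- This lets the machine find the logarithm by doubling `γ` until it reaches 1. For `γ ≥ 1` both
sides are false. -/
theorem lt_logInvCeil {γ : ℝ} (hγ : 0 < γ) (j : ℕ) : j < logInvCeil γ ↔ γ * 2 ^ j < 1 := by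
  rw [logInvCeil, Nat.lt_ceil, Real.lt_logb_iff_rpow_lt (by norm_num) (by positivity),
    Real.rpow_natCast, lt_div_iff₀ hγ, mul_comm]

theorem logInvProg_runs (s : State d) (g : ℕ → ℕ) (ρ : ℕ → ℝ) (hN : 3 ≤ N) (hγ : 0 < ρ 2)
    (hg : logInvCeil (ρ 2) ≤ N) :
    Runs k f N 5 logInvProg (MemPost s fun g' ρ' => g' 7 = g 4 + logInvCeil (ρ 2) ∧
      (∀ a, a ≠ 3 → ρ' a = ρ a) ∧ ∀ a < 12, a ≠ 7 → g' a = g a)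
      { s with nat := g, real := ρ } := by
  refine Runs.assignMem_seq hN (Runs.assignReal_seq hN ?_)
  simp only [val_mem, val_const, realVal_mem]
  refine Runs.memLoop (fun j g' ρ' => g' 7 = g 4 + j ∧ ρ' 3 = ρ 2 * 2 ^ j ∧
    (∀ a, a ≠ 3 → ρ' a = ρ a) ∧ ∀ a < 12, a ≠ 7 → g' a = g a) (logInvCeil (ρ 2)) hN hg ?_ ?_ ?_
  · refine ⟨by simp, by simp, fun a ha => ?_, fun a ha ha7 => ?_⟩
    · rw [Function.update_of_ne (by omega)]
    · rw [Function.update_of_ne (by omega)]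
  · rintro j hj g' ρ' ⟨g7, r3, hρ, hag⟩
    rw [lt_logInvCeil hγ] at hj
    refine ⟨by simpa [r3] using hj, Runs.assignReal_seq hN (Runs.assignMem hN ⟨_, _, rfl, ?_⟩)⟩
    simp only [val_add, val_mem, val_const, realVal_add, realVal_mem]
    refine ⟨by simp [g7]; ring, by simp [r3, pow_succ]; ring, fun a ha => ?_, fun a ha ha7 => ?_⟩
    · rw [Function.update_of_ne (by omega), hρ a ha]
    · rw [Function.update_of_ne (by omega), hag a ha ha7]
  · rintro g' ρ' ⟨g7, r3, hρ, hag⟩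
    refine ⟨?_, _, _, rfl, g7, hρ, hag⟩
    have := (lt_logInvCeil hγ (logInvCeil (ρ 2))).not.1 (lt_irrefl _)
    simpa [r3] using this

theorem halfProg_runs (s : State d) (u : ℕ → ℕ) (hN : 3 ≤ N) (h0 : u 0 ≤ N) :
    Runs k f N 4 halfProg
      (NatPost s fun g => g 8 = (u 0 + 1) / 2 ∧ ∀ a < 12, a ≠ 8 → g a = u a)
      { s with nat := u } := by
  refine Runs.assign_seq hN ?_
  simp only [val_const]
  refine Runs.natLoop (fun j g => g 8 = j ∧ ∀ a < 12, a ≠ 8 → g a = u a)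
    ((u 0 + 1) / 2) hN (by omega) ?_ ?_ ?_
  · refine ⟨by simp, fun a ha ha8 => ?_⟩
    rw [Function.update_of_ne (by omega)]
  · rintro j hj g ⟨g8, hag⟩
    have f0 := hag 0 (by norm_num) (by norm_num)
    refine ⟨by simp [g8, f0]; omega, Runs.assign hN ⟨_, rfl, ?_⟩⟩
    simp only [val_add, val_mem, val_const]
    refine ⟨by simp [g8], fun a ha ha8 => ?_⟩
    rw [Function.update_of_ne (by omega), hag a ha ha8]
  · rintro g ⟨g8, hag⟩
    have f0 := hag 0 (by norm_num) (by norm_num)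
    exact ⟨by simp [g8, f0]; omega, g, rfl, g8, hag⟩

theorem lengthProg_runs (s : State d) (u : ℕ → ℕ) (hN : 3 ≤ N) (h4 : u 4 ≤ N) :
    Runs k f N 9 lengthProg (NatPost s fun g =>
      g 9 = halfLength (u 6) (u 7) (u 8) (u 4) ∧ ∀ a < 12, a ≠ 9 → g a = u a)
      { s with nat := u } := by
  refine Runs.assign_seq hN (Runs.assign_seq hN (Runs.assign_seq hN ?_))
  simp only [val_mem, val_const]
  refine Runs.natLoop (fun j g => g 9 = halfLength (u 6) (u 7) (u 8) j ∧ g 14 = u 6 * 2 ^ j ∧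
    g 15 = j ∧ ∀ a < 12, a ≠ 9 → g a = u a) (u 4) hN h4 ?_ ?_ ?_
  · refine ⟨by simp [halfLength], by simp, by simp, fun a ha ha9 => ?_⟩
    rw [Function.update_of_ne (by omega), Function.update_of_ne (by omega),
      Function.update_of_ne (by omega)]
  · rintro j hj g ⟨g9, g14, g15, hag⟩
    have f4 := hag 4 (by norm_num) (by norm_num)
    have f7 := hag 7 (by norm_num) (by norm_num)
    refine ⟨by simpa [g15, f4] using hj, Runs.assign_seq hN (Runs.assign_seq hN (Runs.assign_seq hN
      (Runs.assign_seq hN (Runs.assign hN ⟨_, rfl, ?_⟩))))⟩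
    simp only [val_add, val_mem, val_const]
    refine ⟨?_, ?_, by simp [g15], fun a ha ha9 => ?_⟩
    · simp [g9, g14, f7, halfLength]; ring
    · simp [g14, pow_succ]; ring
    · rw [Function.update_of_ne (by omega), Function.update_of_ne (by omega),
        Function.update_of_ne (by omega), Function.update_of_ne (by omega),
        Function.update_of_ne (by omega), hag a ha ha9]
  · rintro g ⟨g9, g14, g15, hag⟩
    have f4 := hag 4 (by norm_num) (by norm_num)
    exact ⟨by simp [g15, f4], g, rfl, g9, hag⟩

theorem coinsProg_runs (s : State d) (hN : 3 ≤ N) (h9 : 2 * s.nat 9 ≤ N)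
    (hc : s.coins.length = 2 * s.nat 9) :
    Runs k f N 6 coinsProg (fun s' => ∃ g, s' = { s with nat := g, coins := [] } ∧
      g 10 = coinNumber s.coins 0 ∧ ∀ a < 10, g a = s.nat a) s := by
  refine Runs.seq hN (Runs.setN hN (Runs.seq hN (Runs.setN hN ?_)))
  simp only [val_const]
  refine Runs.loop (fun j s' => ∃ g, s' = { s with nat := g, coins := s.coins.drop j } ∧
      g 10 = coinNumber (s.coins.take j) 0 ∧ g 12 = j ∧ ∀ a < 10, g a = s.nat a) (2 * s.nat 9)
      hN h9 ?_ ?_ ?_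
  · refine ⟨Function.update (Function.update s.nat 10 0) 12 0, by simp, by simp [coinNumber], by simp, fun a ha => ?_⟩
    rw [Function.update_of_ne (by omega), Function.update_of_ne (by omega)]
  · rintro j hj _ ⟨g, rfl, g10, g12, hag⟩
    have f9 := hag 9 (by norm_num)
    have hjl : j < s.coins.length := by omega
    refine ⟨by simp [g12, f9]; omega, Runs.seq hN ?_⟩
    refine Runs.coin hN (List.drop_eq_getElem_cons hjl) (Runs.seq (e := 0) hN
      (Runs.setN hN (Runs.setN hN ⟨_, rfl, ?_⟩)))
    simp only [val_add, val_mem, val_const]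
    refine ⟨?_, by simp [g12], fun a ha => ?_⟩
    · rw [List.take_succ_eq_append_getElem hjl, coinNumber, List.foldl_append]
      simp [g10, coinNumber, two_mul]
    · rw [Function.update_of_ne (by omega), Function.update_of_ne (by omega),
        Function.update_of_ne (by omega), hag a ha]
  · rintro _ ⟨g, rfl, g10, g12, hag⟩
    have f9 := hag 9 (by norm_num)
    refine ⟨by simp [g12, f9]; omega, g, ?_, ?_, hag⟩
    · rw [← hc, List.drop_length]
    · rw [g10, ← hc, List.take_length]

theorem cellProg_runs (s : State d) (g : ℕ → ℕ) (ρ : ℕ → ℝ) (hN : 3 ≤ N) (h3 : g 3 + 1 ≤ N) :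
    Runs k f N 5 cellProg (MemPost s fun g' ρ' => ρ' 4 = cellWidth (ρ 0) (g 3) ∧
      (∀ a, a ≠ 4 → ρ' a = ρ a) ∧ ∀ a < 12, g' a = g a)
      { s with nat := g, real := ρ } := by
  refine Runs.assignMem_seq hN (Runs.assignReal_seq hN ?_)
  simp only [val_const, realVal_const, Nat.cast_zero]
  refine Runs.memLoop (fun j g' ρ' => g' 12 = j ∧ ρ' 4 = j * (2 * ρ 0) ∧
    (∀ a, a ≠ 4 → ρ' a = ρ a) ∧ ∀ a < 12, g' a = g a) (g 3 + 1) hN h3 ?_ ?_ ?_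
  · refine ⟨by simp, by simp, fun a ha => ?_, fun a ha => ?_⟩
    · rw [Function.update_of_ne (by omega)]
    · rw [Function.update_of_ne (by omega)]
  · rintro j hj g' ρ' ⟨g12, r4, hρ, hag⟩
    have f3 := hag 3 (by norm_num)
    have r0 := hρ 0 (by norm_num)
    refine ⟨by simpa [g12, f3] using hj,
      Runs.assignReal_seq hN (Runs.assignMem hN ⟨_, _, rfl, ?_⟩)⟩
    simp only [val_add, val_mem, val_const, realVal_add, realVal_mem]
    refine ⟨by simp [g12], by simp [r4, r0]; ring, fun a ha => ?_, fun a ha => ?_⟩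
    · rw [Function.update_of_ne (by omega), hρ a ha]
    · rw [Function.update_of_ne (by omega), hag a ha]
  · rintro g' ρ' ⟨g12, r4, hρ, hag⟩
    have f3 := hag 3 (by norm_num)
    exact ⟨by simp [g12, f3], _, _, rfl, r4, hρ, hag⟩

end Initialization

/-! ### The steward -/

/-- The initialization of the steward. -/
def initProg : Prog :=
  assign 12 (reg 1) ;; clogProg ;; assign 4 (reg 14) ;; assign 12 (reg 3 + num 1) ;; clogProg ;;
    assign 5 (reg 14) ;; blocksProg ;; logInvProg ;; halfProg ;; lengthProg ;; coinsProg ;;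
    cellProg ;; assign 11 (num 0)

/-- The rounds of the steward. -/
def roundsProg : Prog :=
  .loop (.ltN (reg 11) (reg 1))
    (generatorProg ;; bitsProg ;; .query (num 64) (num 8) ;; roundProg ;;
      .answer (num 8 + reg 2) ;; assign 11 (reg 11 + num 1))

/-- The one-query steward. -/
def stewardProg : Prog :=
  .ite (.ltN (num 0) (reg 1)) (initProg ;; roundsProg) .skip

section Steward

variable {n d k : ℕ} {f : List (Fin d → ℝ) → Bits n → Fin d → ℝ} {N : ℕ}

/-- Between rounds only the parameters, the seed, the counter and two real constants have to
survive, since each query is recomputed from the seed. The observed vector starts at real register 8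
and the rounded one follows it. -/
theorem roundsProg_runs (s : State d) {ε : ℝ} (hε : 0 < ε) (hnd : n + d + 2 ≤ N) (hN : 3 ≤ N)
    (h1 : s.nat 1 = k) (hk : k ≤ N) (h2 : s.nat 2 = d) (h31 : 1 ≤ s.nat 3) (h3 : s.nat 3 ≤ d)
    (h4 : s.nat 4 ≤ N) (h8 : n ≤ 2 * s.nat 8)
    (h9 : s.nat 9 = halfLength (s.nat 6) (s.nat 7) (s.nat 8) (s.nat 4)) (h9N : 2 * s.nat 9 ≤ N)
    (h10 : s.nat 10 < 2 ^ (2 * s.nat 9)) (h11 : s.nat 11 = 0) (hρ0 : s.real 0 = ε)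
    (hρ4 : s.real 4 = cellWidth ε (s.nat 3)) (hans : s.answers = []) (hq : s.queried = false) :
    Runs k f N 68 roundsProg (fun s' => s'.answers = answersTo ε (s.nat 3) f
      (fun r => bitsOf n
        (generator (s.nat 6) (s.nat 7) (s.nat 8) (s.nat 4) (s.nat 10) r)) k) s := by
  set x : ℕ → Bits n := fun r => bitsOf n
    (generator (s.nat 6) (s.nat 7) (s.nat 8) (s.nat 4) (s.nat 10) r) with hx
  refine Runs.loop (fun r s' => s'.answers = answersTo ε (s.nat 3) f x r ∧ s'.queried = false ∧
    s'.nat 11 = r ∧ (∀ a < 11, s'.nat a = s.nat a) ∧ s'.real 0 = ε ∧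
    s'.real 4 = cellWidth ε (s.nat 3)) k hN hk ⟨hans, hq, h11, fun _ _ => rfl, hρ0, hρ4⟩ ?_ ?_
  · rintro r hr s' ⟨ans, queried, n11, hag, r0, r4⟩
    have f1 := hag 1 (by norm_num)
    have f2 := hag 2 (by norm_num)
    have f3 := hag 3 (by norm_num)
    have f4 := hag 4 (by norm_num)
    have f6 := hag 6 (by norm_num)
    have f7 := hag 7 (by norm_num)
    have f8 := hag 8 (by norm_num)
    have f9 := hag 9 (by norm_num)
    have f10 := hag 10 (by norm_num)
    refine ⟨by simp [n11, f1, h1, hr], ?_⟩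
    refine Runs.seq hN (Runs.bindNat hN (generatorProg_runs s' s'.nat hN ?_ ?_ ?_ ?_) le_rfl ?_)
    · rw [f4]; exact h4
    · rw [f9, f6, f7, f8, f4, h9]
    · rw [f9]; exact h9N
    · rw [f10, f9]; exact h10
    rw [f6, f7, f8, f4, f10, n11]
    rintro g ⟨g30, hg⟩
    have h8le : 2 * s.nat 8 ≤ N := by
      have := halfLength_mono (s.nat 6) (s.nat 7) (s.nat 8) (Nat.zero_le (s.nat 4))
      rw [← h9, halfLength] at this
      omega
    have g8 : g 8 = s.nat 8 := by rw [hg 8 (by norm_num), f8]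
    refine Runs.seq hN (Runs.bindNat hN (bitsProg_runs s' g hN ?_ ?_) (by norm_num) ?_)
    · rw [g8]; exact h8le
    · rw [g30, g8]
      refine generator_lt _ _ _ _ _ _ ?_
      rw [← h9]; exact h10
    rintro u ⟨ubits, hu⟩
    rw [g8, g30] at ubits
    have hug : ∀ a < 12, u a = s'.nat a := fun a ha => by rw [hu a (by omega), hg a (by omega)]
    have hread : (State.readBits { s' with nat := u } n 64 : Bits n) = x r := by
      funext j
      simp only [State.readBits, hx, bitsOf]
      have hj := ubits j (by omega)
      rw [Bool.eq_iff_iff, decide_eq_true_iff, hj]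
      cases Nat.testBit _ _ <;> simp
    refine Runs.seq hN (Runs.query (by omega) ?_ queried ?_)
    · show s'.answers.length < k
      rw [ans, length_answersTo]; exact hr
    simp only [val_const, hread]
    set w := f s'.answers (x r) with hw
    set ρ := State.storeVec { s' with nat := u } 8 w with hρd
    have hρlt : ∀ a < 8, ρ a = s'.real a := by
      intro a ha
      simp only [hρd, State.storeVec]
      rw [dif_neg (by omega)]
    refine Runs.seq hN (Runs.bindMem hN (roundProg_runs { s' with queried := true } u ρ
      (extendVec w) hε hN ?_ ?_ ?_ ?_ ?_ ?_) (by norm_num) ?_)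
    · rw [hug 2 (by norm_num), f2, h2]; omega
    · rw [hug 3 (by norm_num), f3]; exact h31
    · rw [hug 3 (by norm_num), f3]; omega
    · intro j hj
      rw [hug 2 (by norm_num), f2, h2] at hj
      simp only [hρd, State.storeVec, extendVec]
      rw [dif_pos (by omega), dif_pos hj]
      congr 2
      omega
    · rw [hρlt 0 (by norm_num), r0]
    · rw [hρlt 4 (by norm_num), r4, hug 3 (by norm_num), f3]
    rw [hug 2 (by norm_num), hug 3 (by norm_num), f2, f3, h2]
    rintro v σ ⟨hσ, hσρ, hv⟩
    have hvag : ∀ a < 12, v a = s'.nat a := fun a ha => by rw [hv a (by omega), hug a ha]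
    refine Runs.seq hN (Runs.answer (by omega) ?_ rfl ?_)
    · show s'.answers.length < k
      rw [ans, length_answersTo]; exact hr
    refine Runs.setN hN ⟨?_, rfl, ?_, fun a ha => ?_, ?_, ?_⟩
    · show s'.answers ++ [_] = _
      rw [answersTo, ← ans, ← hw]
      congr 2
      funext j
      simp only [State.readVec, val_add, val_mem, val_const, hvag 2 (by norm_num), f2, h2]
      exact hσ j j.2
    · simp [hvag, n11]
    · show Function.update v 11 _ a = _
      rw [Function.update_of_ne (by omega), hvag a (by omega), hag a ha]
    · show σ 0 = ε
      rw [hσρ 0 (by omega) (by norm_num), hρlt 0 (by norm_num), r0]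
    · show σ 4 = _
      rw [hσρ 4 (by omega) (by norm_num), hρlt 4 (by norm_num), r4]
  · rintro s' ⟨ans, queried, n11, hag, r0, r4⟩
    exact ⟨by simp [n11, hag, h1], ans⟩

/-- The logarithm, rounded up, of the number of possible shifts of all blocks. -/
def shiftBits (d d₀ : ℕ) : ℕ := numBlocks d d₀ * Nat.clog 2 (d₀ + 1)

/-- The logarithm, rounded up, of the inverse of the error of the generator. -/
def errorExponent (k : ℕ) (γ : ℝ) : ℕ := Nat.clog 2 k + logInvCeil γ

/-- Half of the number of coins of the steward. -/
def halfCoins (n k d d₀ : ℕ) (γ : ℝ) : ℕ :=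
  halfLength (shiftBits d d₀) (errorExponent k γ) ((n + 1) / 2) (Nat.clog 2 k)

/-- The query of the steward in round `r` when the seed is `v`. -/
def stewardQuery (n k d d₀ : ℕ) (γ : ℝ) (v r : ℕ) : Bits n :=
  bitsOf n (generator (shiftBits d d₀) (errorExponent k γ) ((n + 1) / 2) (Nat.clog 2 k) v r)

theorem initProg_runs (s : State d) {ε γ : ℝ} {d₀ : ℕ} (hγ : 0 < γ) (hN : 3 ≤ N)
    (hnd : n + d + 2 ≤ N) (hk : k ≤ N) (hd₀ : 1 ≤ d₀) (hd : d₀ ≤ d) (hg : logInvCeil γ ≤ N)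
    (hH : 2 * halfCoins n k d d₀ γ ≤ N) (h0 : s.nat 0 = n) (h1 : s.nat 1 = k) (h2 : s.nat 2 = d)
    (h3 : s.nat 3 = d₀) (hρ0 : s.real 0 = ε) (hρ2 : s.real 2 = γ)
    (hc : s.coins.length = 2 * halfCoins n k d d₀ γ) :
    Runs k f N 67 initProg (fun s' => ∃ g ρ, s' = { s with nat := g, real := ρ, coins := [] } ∧
      g 1 = k ∧ g 2 = d ∧ g 3 = d₀ ∧ g 4 = Nat.clog 2 k ∧ g 6 = shiftBits d d₀ ∧
      g 7 = errorExponent k γ ∧ g 8 = (n + 1) / 2 ∧ g 9 = halfCoins n k d d₀ γ ∧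
      g 10 = coinNumber s.coins 0 ∧ g 11 = 0 ∧ ρ 0 = ε ∧ ρ 4 = cellWidth ε d₀) s := by
  have hkle : Nat.clog 2 k ≤ k := Nat.clog_le_of_le_pow (Nat.lt_two_pow_self).le
  refine Runs.assign_seq (s := s) (g := s.nat) hN (Runs.seq hN ?_)
  simp only [val_mem, val_const]
  refine Runs.bindNat hN (clogProg_runs s _ hN ?_) (by norm_num) ?_
  · simp [h1, hk]
  rintro u ⟨u14, hu⟩
  simp [h1] at u14
  have hu' : ∀ a < 12, u a = s.nat a := fun a ha => by
    rw [hu a ha, Function.update_of_ne (by omega)]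
  clear hu
  refine Runs.assign_seq hN (Runs.assign_seq hN (Runs.seq hN ?_))
  simp only [val_add, val_mem, val_const]
  refine Runs.bindNat hN (clogProg_runs s _ hN ?_) (by norm_num) ?_
  · simp [hu', h3]; omega
  rintro v ⟨v14, hv⟩
  simp [hu', h3] at v14
  have v4 : v 4 = Nat.clog 2 k := by rw [hv 4 (by norm_num)]; simp [u14]
  have hv' : ∀ a < 4, v a = s.nat a := fun a ha => by
    rw [hv a (by omega), Function.update_of_ne (by omega), Function.update_of_ne (by omega),
      hu' a (by omega)]
  clear hv hu'
  refine Runs.assign_seq hN (Runs.seq hN ?_)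
  simp only [val_mem, val_const]
  refine Runs.bindNat hN (blocksProg_runs s _ hN ?_ ?_) (by norm_num) ?_
  · simp [hv', h2]; omega
  · simp [hv', h3, hd₀]
  rintro g ⟨g6, hg'⟩
  simp [hv', h2, h3, v14] at g6
  have g4 : g 4 = Nat.clog 2 k := by rw [hg' 4 (by norm_num) (by norm_num)]; simp [v4]
  have hgs : ∀ a < 4, g a = s.nat a := fun a ha => by
    rw [hg' a (by omega) (by omega), Function.update_of_ne (by omega), hv' a ha]
  clear hg' hv'
  refine Runs.seq hN ?_
  refine Runs.bindMem hN (logInvProg_runs s g s.real hN ?_ ?_) (by norm_num) ?_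
  · rw [hρ2]; exact hγ
  · rw [hρ2]; exact hg
  rw [hρ2]
  rintro u ρ ⟨u7, hρ, hu⟩
  rw [g4] at u7
  have u4 := hu 4 (by norm_num) (by norm_num)
  have u6 := hu 6 (by norm_num) (by norm_num)
  rw [g4] at u4
  rw [g6] at u6
  have hus : ∀ a < 4, u a = s.nat a := fun a ha => by rw [hu a (by omega) (by omega), hgs a ha]
  clear hu hgs
  refine Runs.seq hN ?_
  refine Runs.bindNat hN (halfProg_runs { s with real := ρ } u hN ?_) (by norm_num) ?_
  · rw [hus 0 (by norm_num), h0]; omega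
  rintro v ⟨v8, hv⟩
  rw [hus 0 (by norm_num), h0] at v8
  have hvs : ∀ a < 4, v a = s.nat a := fun a ha => by rw [hv a (by omega) (by omega), hus a ha]
  have v4 := hv 4 (by norm_num) (by norm_num)
  have v6 := hv 6 (by norm_num) (by norm_num)
  have v7 := hv 7 (by norm_num) (by norm_num)
  rw [u4] at v4
  rw [u6] at v6
  rw [u7] at v7
  clear hv hus
  refine Runs.seq hN ?_
  refine Runs.bindNat hN (lengthProg_runs { s with real := ρ } v hN ?_) (by norm_num) ?_
  · rw [v4]; omega
  rintro g ⟨g9, hg'⟩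
  have hgs : ∀ a < 4, g a = s.nat a := fun a ha => by rw [hg' a (by omega) (by omega), hvs a ha]
  have g4 := hg' 4 (by norm_num) (by norm_num)
  have g6 := hg' 6 (by norm_num) (by norm_num)
  have g7 := hg' 7 (by norm_num) (by norm_num)
  have g8 := hg' 8 (by norm_num) (by norm_num)
  rw [v4] at g4
  rw [v6] at g6
  rw [v7] at g7
  rw [v8] at g8
  have g9' : g 9 = halfCoins n k d d₀ γ := by rw [g9, v4, v6, v7, v8]; rfl
  refine Runs.seq hN ?_
  refine (coinsProg_runs { s with nat := g, real := ρ } hN ?_ ?_).mono hN (by norm_num) ?_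
  · simp only [g9']; exact hH
  · simp only [g9']; exact hc
  rintro _ ⟨u, rfl, u10, hu⟩
  simp only at u10 hu
  refine Runs.seq hN ?_
  refine Runs.bindMem hN (cellProg_runs { s with coins := [] } u ρ hN ?_) (by norm_num) ?_
  · rw [hu 3 (by norm_num), hgs 3 (by norm_num), h3]; omega
  rintro w σ ⟨σ4, hσ, hw⟩
  have hwu : ∀ a < 10, w a = g a := fun a ha => by rw [hw a (by omega), hu a ha]
  refine Runs.setN hN ⟨_, σ, rfl, ?_⟩
  refine ⟨?_, ?_, ?_, ?_, ?_, ?_, ?_, ?_, ?_, ?_, ?_, ?_⟩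
  · simp [hwu, hgs, h1]
  · simp [hwu, hgs, h2]
  · simp [hwu, hgs, h3]
  · simp [hwu, g4]
  · simp [hwu, g6, shiftBits]
  · simp [hwu, g7, errorExponent]
  · simp [hwu, g8]
  · simp [hwu, g9']
  · simp [hw, u10]
  · simp
  · rw [hσ 0 (by norm_num), hρ 0 (by norm_num), hρ0]
  · rw [σ4, hρ 0 (by norm_num), hρ0, hu 3 (by norm_num), hgs 3 (by norm_num), h3]

theorem stewardProg_runs {ε δ γ : ℝ} {d₀ : ℕ} (hε : 0 < ε) (hγ : 0 < γ) (hN : 3 ≤ N)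
    (hnd : n + d + 2 ≤ N) (hk : k ≤ N) (hk1 : 1 ≤ k) (hd₀ : 1 ≤ d₀) (hd : d₀ ≤ d)
    (hg : logInvCeil γ ≤ N) (hH : 2 * halfCoins n k d d₀ γ ≤ N)
    (z : Bits (2 * halfCoins n k d d₀ γ)) :
    Runs k f N 70 stewardProg (fun s => s.answers = answersTo ε d₀ f
      (stewardQuery n k d d₀ γ (coinNumber (List.ofFn z) 0)) k)
      (State.init d [n, k, d, d₀] [ε, δ, γ] z) := by
  have hkle : Nat.clog 2 k ≤ k := Nat.clog_le_of_le_pow (Nat.lt_two_pow_self).le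
  refine Runs.ite hN (fun _ => Runs.seq hN ?_) (fun hlt => ?_)
  · refine (initProg_runs (ε := ε) (State.init d [n, k, d, d₀] [ε, δ, γ] z) hγ hN hnd hk hd₀ hd hg
      hH rfl rfl rfl rfl rfl rfl (by simp [State.init])).mono hN (by norm_num) ?_
    rintro _ ⟨g, ρ, rfl, g1, g2, g3, g4, g6, g7, g8, g9, g10, g11, ρ0, ρ4⟩
    have hlt := coinNumber_lt (List.ofFn z) 0
    rw [List.length_ofFn, zero_add, one_mul] at hlt
    refine (roundsProg_runs _ hε hnd hN g1 hk g2 ?_ ?_ ?_ ?_ ?_ ?_ ?_ g11 ρ0 ?_ rfl rfl).mono hN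
      le_rfl ?_
    all_goals simp only [g3, g4, g6, g7, g8, g9, g10]
    · exact hd₀
    · exact hd
    · omega
    · omega
    · rfl
    · exact hH
    · exact hlt
    · exact ρ4
    · exact fun s' h => h
  · exact absurd (show 0 < k from hk1) hlt

end Steward

/-! ### Execution is deterministic -/

/-- The failure event refers to any transcript, while `Runs` exhibits only one. Uniqueness of the
final state closes the gap. -/
theorem Exec.deterministic {n d k : ℕ} {f : List (Fin d → ℝ) → Bits n → Fin d → ℝ} {p : Prog}
    {s s' s'' : State d} {t t' : ℕ} (h : Exec k f p s t s') (h' : Exec k f p s t' s'') :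
    s' = s'' := by
  induction h generalizing t' s'' with
  | skip s => cases h'; rfl
  | setN s a e => cases h'; rfl
  | setR s a x => cases h'; rfl
  | coin s a b l hs =>
    cases h' with
    | coin _ _ b' l' hs' =>
      obtain ⟨rfl, rfl⟩ := List.cons.inj (hs.symm.trans hs')
      rfl
  | query s a b hk hq => cases h'; rfl
  | answer s a hk hq => cases h'; rfl
  | seq p q s s₁ s₂ t₁ t₂ h₁ h₂ ih₁ ih₂ =>
    cases h' with
    | seq _ _ _ s₁' _ _ _ h₁' h₂' =>
      obtain rfl := ih₁ h₁'
      exact ih₂ h₂'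
  | iteTrue b p q s s₁ t hb h ih =>
    cases h' with
    | iteTrue _ _ _ _ _ _ _ h' => exact ih h'
    | iteFalse _ _ _ _ _ _ hb' _ => exact absurd hb hb'
  | iteFalse b p q s s₁ t hb h ih =>
    cases h' with
    | iteTrue _ _ _ _ _ _ hb' _ => exact absurd hb' hb
    | iteFalse _ _ _ _ _ _ _ h' => exact ih h'
  | loopTrue b p s s₁ s₂ t₁ t₂ hb h₁ h₂ ih₁ ih₂ =>
    cases h' with
    | loopTrue _ _ _ s₁' _ _ _ _ h₁' h₂' =>
      obtain rfl := ih₁ h₁'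
      exact ih₂ h₂'
    | loopFalse _ _ _ hb' => exact absurd hb hb'
  | loopFalse b p s hb =>
    cases h' with
    | loopTrue _ _ _ _ _ _ _ hb' _ _ => exact absurd hb' hb
    | loopFalse _ _ _ _ => rfl

/-! ### Bounds on the parameters -/

theorem logInv_nonneg (x : ℝ) : 0 ≤ logInv x := le_max_left _ _

theorem logInvCeil_le (γ : ℝ) : (logInvCeil γ : ℝ) ≤ logInv γ + 1 := by
  rw [logInvCeil]
  rcases le_total (Real.logb 2 (1 / γ)) 0 with h | h
  · rw [Nat.ceil_eq_zero.2 h]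
    have := logInv_nonneg γ
    push_cast
    linarith
  · have := (Nat.ceil_lt_add_one h).le
    have : Real.logb 2 (1 / γ) ≤ logInv γ := le_max_right _ _
    linarith

/-- The summand `Nat.clog 2 k` in the exponent cancels the number of joins of the generator, and the
other summand leaves at most `γ`. -/
theorem two_pow_mul_errorExponent_le {k : ℕ} {γ : ℝ} (hγ : 0 < γ) :
    (2 : ℝ) ^ Nat.clog 2 k * (1 / 2) ^ errorExponent k γ ≤ γ := by
  have h := not_lt.1 ((lt_logInvCeil hγ (logInvCeil γ)).not.1 (lt_irrefl _))
  rw [errorExponent, pow_add, ← mul_assoc, ← mul_pow]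
  rw [show (2 * (1 / 2) : ℝ) = 1 by norm_num, one_pow, one_mul, one_div, inv_pow,
    inv_le_iff_one_le_mul₀ (by positivity)]
  exact h

theorem pow_numBlocks_le (d d₀ : ℕ) : (d₀ + 1) ^ numBlocks d d₀ ≤ 2 ^ shiftBits d d₀ := by
  rw [shiftBits, mul_comm, pow_mul]
  exact Nat.pow_le_pow_left (Nat.le_pow_clog (by norm_num) _) _

theorem clog_two_le_self (k : ℕ) : Nat.clog 2 k ≤ k :=
  Nat.clog_le_of_le_pow Nat.lt_two_pow_self.le

theorem two_pow_clog_le {k : ℕ} (hk : 1 ≤ k) : 2 ^ Nat.clog 2 k ≤ 2 * k := by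
  rcases Nat.eq_or_lt_of_le hk with rfl | hk
  · simp
  · have h := Nat.pow_pred_clog_lt_self (b := 2) (by norm_num) hk
    have h1 := Nat.clog_pos (b := 2) (by norm_num) hk
    obtain ⟨l, hl⟩ := Nat.exists_eq_succ_of_ne_zero h1.ne'
    rw [hl] at h ⊢
    simp only [Nat.pred_succ, Nat.succ_eq_add_one, pow_succ] at h ⊢
    omega

/-- The seed length contains the square of the number of levels; this lets the term for the shifts
absorb it. -/
theorem sq_clog_two_le {k : ℕ} (hk : 1 ≤ k) : Nat.clog 2 k ^ 2 ≤ 4 * k := by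
  have h : ∀ l : ℕ, l ^ 2 ≤ 2 * 2 ^ l := by
    intro l
    rcases Nat.lt_or_ge l 4 with hl | hl
    · interval_cases l <;> norm_num
    · induction l, hl using Nat.le_induction with
      | base => norm_num
      | succ l hl ih => rw [pow_succ 2 l]; nlinarith
  have := h (Nat.clog 2 k)
  have := two_pow_clog_le hk
  omega

/-- Rounding up adds less than 1, which is at most the logarithm once `k ≥ 2`; for `k = 1` both
sides vanish. -/
theorem clog_two_le_logb {k : ℕ} (hk : 1 ≤ k) : (Nat.clog 2 k : ℝ) ≤ 2 * Real.logb 2 k := by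
  rcases Nat.eq_or_lt_of_le hk with rfl | hk
  · simp
  · have h : Nat.clog 2 k - 1 < Real.logb 2 k := by
      have h := Nat.pow_pred_clog_lt_self (b := 2) (by norm_num) hk
      have h1 := Nat.clog_pos (b := 2) (by norm_num) hk
      obtain ⟨l, hl⟩ := Nat.exists_eq_succ_of_ne_zero h1.ne'
      rw [hl] at h ⊢
      rw [Real.lt_logb_iff_rpow_lt (by norm_num) (by positivity)]
      simp only [Nat.pred_succ] at h
      push_cast
      rw [add_sub_cancel_right, Real.rpow_natCast]
      exact_mod_cast h
    have h1 : 1 ≤ Real.logb 2 k := by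
      rw [Real.le_logb_iff_rpow_le (by norm_num) (by positivity), Real.rpow_one]
      exact_mod_cast hk
    linarith

theorem halfLength_le (D e h₀ l : ℕ) : halfLength D e h₀ l ≤ h₀ + 12 * (D * 2 ^ l + e * l) := by
  -- The geometric sum is exact with `2 ^ l - 1`; moving the 1 to the left avoids subtraction.
  have : halfLength D e h₀ l + 12 * D = h₀ + 12 * (D * 2 ^ l + e * l) := by
    induction l with
    | zero => simp [halfLength]
    | succ l ih => rw [halfLength, pow_succ]; linarith
  omega

theorem shiftBits_le {d d₀ : ℕ} (hd₀ : 1 ≤ d₀) (hd : d₀ ≤ d) :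
    (shiftBits d d₀ : ℝ) ≤ 4 * (d * Real.logb 2 (d₀ + 1) / d₀) := by
  have h1 : (numBlocks d d₀ : ℝ) ≤ 2 * (d / d₀) := by
    rw [← mul_div_assoc, le_div_iff₀ (by exact_mod_cast hd₀)]
    have : numBlocks d d₀ * d₀ ≤ d + d₀ - 1 := Nat.div_mul_le_self _ _
    have : numBlocks d d₀ * d₀ ≤ 2 * d := by omega
    exact_mod_cast this
  have h2 := clog_two_le_logb (k := d₀ + 1) (by omega)
  push_cast at h2
  rw [shiftBits]
  push_cast
  calc (numBlocks d d₀ : ℝ) * Nat.clog 2 (d₀ + 1)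
      ≤ 2 * (d / d₀) * (2 * Real.logb 2 (d₀ + 1)) := by gcongr
    _ = _ := by ring

theorem halfCoins_le {n k d d₀ : ℕ} (γ : ℝ) (hk : 1 ≤ k) (hd₀ : 1 ≤ d₀) (hd : d₀ ≤ d) :
    ((2 * halfCoins n k d d₀ γ : ℕ) : ℝ) ≤ n + 385 * (k * d * Real.logb 2 (d₀ + 1) / d₀ +
      Real.logb 2 k * logInv γ) := by
  set A : ℝ := k * d * Real.logb 2 (d₀ + 1) / d₀ with hA
  set l := Nat.clog 2 k with hl
  have hG := logInv_nonneg γ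
  have hL : 0 ≤ Real.logb 2 k := Real.logb_nonneg (by norm_num) (by exact_mod_cast hk)
  -- Both `d / d₀` and the logarithm of `d₀ + 1` are at least 1, so every term of order `k` can be
  -- charged to `A`.
  have hkA : (k : ℝ) ≤ A := by
    have h1 : 1 ≤ Real.logb 2 (d₀ + 1) := by
      rw [Real.le_logb_iff_rpow_le (by norm_num) (by positivity), Real.rpow_one]
      have : (1 : ℝ) ≤ d₀ := by exact_mod_cast hd₀
      linarith
    rw [hA, le_div_iff₀ (by exact_mod_cast hd₀), mul_assoc]
    have h2 : (d₀ : ℝ) ≤ d := by exact_mod_cast hd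
    gcongr
    nlinarith [Nat.cast_nonneg (α := ℝ) d]
  have hD : (shiftBits d d₀ * 2 ^ l : ℝ) ≤ 8 * A := by
    have h1 := shiftBits_le hd₀ hd
    have h0 : 0 ≤ 4 * (d * Real.logb 2 (d₀ + 1) / d₀) := (Nat.cast_nonneg _).trans h1
    have h2 : (2 ^ l : ℝ) ≤ 2 * k := by exact_mod_cast two_pow_clog_le hk
    calc (shiftBits d d₀ * 2 ^ l : ℝ) ≤ 4 * (d * Real.logb 2 (d₀ + 1) / d₀) * (2 * k) := by gcongr
      _ = 8 * A := by rw [hA]; ring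
  have hl2 : (l : ℝ) ^ 2 ≤ 4 * k := by exact_mod_cast sq_clog_two_le hk
  have hl1 : (l : ℝ) ≤ 4 * k := by
    have : l ≤ k := clog_two_le_self k
    have : l ≤ 4 * k := by omega
    exact_mod_cast this
  have hlg : (l : ℝ) * logInvCeil γ ≤ 2 * (Real.logb 2 k * logInv γ) + 4 * k := by
    calc (l : ℝ) * logInvCeil γ ≤ l * (logInv γ + 1) := by gcongr; exact logInvCeil_le γ
      _ = l * logInv γ + l := by ring
      _ ≤ 2 * Real.logb 2 k * logInv γ + 4 * k := by gcongr; exact clog_two_le_logb hk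
      _ = _ := by ring
  have hm : 2 * halfCoins n k d d₀ γ ≤
      n + 1 + 24 * (shiftBits d d₀ * 2 ^ l + (l + logInvCeil γ) * l) := by
    have := halfLength_le (shiftBits d d₀) (errorExponent k γ) ((n + 1) / 2) l
    rw [errorExponent, ← hl] at this
    rw [halfCoins, errorExponent, ← hl]
    omega
  have hm' : ((2 * halfCoins n k d d₀ γ : ℕ) : ℝ) ≤
      n + 1 + 24 * (shiftBits d d₀ * 2 ^ l + (l + logInvCeil γ) * l) := by exact_mod_cast hm
  have h1 : (1 : ℝ) ≤ k := by exact_mod_cast hk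
  have h2 : 0 ≤ Real.logb 2 k * logInv γ := by positivity
  -- The constant is `1 + 24 * (8 + 4 + 4)`: one for the parity of `n`, then the shifts, the squared
  -- number of levels, and the rounding of the logarithm of `1 / γ`.
  nlinarith

/-- A bound for all numbers that occur in the loops of the steward. -/
def sizeBound (n k d : ℕ) (γ : ℝ) : ℕ := 100 * (n + k + d + logInvCeil γ + 1) ^ 3

theorem le_sizeBound {n k d a : ℕ} {γ : ℝ} (h : a ≤ 100 * (n + k + d + logInvCeil γ + 1)) :
    a ≤ sizeBound n k d γ :=
  h.trans (Nat.mul_le_mul_left _ (Nat.le_self_pow (by norm_num) _))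

/-- The seed length is itself a loop count, so it must fit under `N`. With `M` the sum of the sizes,
`shiftBits` is at most `M ^ 2` and the number of blocks at most `2 * M`, hence a cubic bound. -/
theorem halfCoins_le_sizeBound {n k d d₀ : ℕ} (γ : ℝ) (hk : 1 ≤ k) (hd₀ : 1 ≤ d₀) (hd : d₀ ≤ d) :
    2 * halfCoins n k d d₀ γ ≤ sizeBound n k d γ := by
  set M := n + k + d + logInvCeil γ + 1 with hM
  have hD : shiftBits d d₀ ≤ M * M := by
    have h1 := numBlocks_le hd₀ (d := d)
    have h2 : Nat.clog 2 (d₀ + 1) ≤ d₀ := Nat.clog_le_of_le_pow Nat.lt_two_pow_self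
    exact Nat.mul_le_mul (by omega) (by omega)
  have h2 : 2 ^ Nat.clog 2 k ≤ 2 * M := (two_pow_clog_le hk).trans (by omega)
  have h3 := clog_two_le_self k
  have h4 := halfLength_le (shiftBits d d₀) (errorExponent k γ) ((n + 1) / 2) (Nat.clog 2 k)
  have h5 : shiftBits d d₀ * 2 ^ Nat.clog 2 k ≤ M * M * (2 * M) := Nat.mul_le_mul hD h2
  have h6 : errorExponent k γ * Nat.clog 2 k ≤ M * M :=
    Nat.mul_le_mul (by rw [errorExponent]; omega) (by omega)
  have h7 : M * M ≤ M ^ 3 := by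
    rw [pow_succ, sq]
    exact Nat.le_mul_of_pos_right _ (by omega)
  have h8 : M ≤ M ^ 3 := Nat.le_self_pow (by norm_num) _
  have h9 : M * M * (2 * M) = 2 * M ^ 3 := by ring
  rw [halfCoins, sizeBound, ← hM]
  omega

theorem sizeBound_le (n k d : ℕ) (ε γ : ℝ) :
    (sizeBound n k d γ : ℝ) ≤ 800 * (n + k + d + logInv ε + logInv γ + 1) ^ 3 := by
  have h1 := logInvCeil_le γ
  have h2 := logInv_nonneg γ
  have h3 := logInv_nonneg ε
  rw [sizeBound]
  push_cast
  have : (n + k + d + logInvCeil γ + 1 : ℝ) ≤ 2 * (n + k + d + logInv ε + logInv γ + 1) := by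
    have := Nat.cast_nonneg (α := ℝ) n
    have := Nat.cast_nonneg (α := ℝ) k
    have := Nat.cast_nonneg (α := ℝ) d
    linarith
  calc (100 * (n + k + d + logInvCeil γ + 1) ^ 3 : ℝ)
      ≤ 100 * (2 * (n + k + d + logInv ε + logInv γ + 1)) ^ 3 := by gcongr
    _ = _ := by ring

/-! ### The main properties of the steward -/

theorem uniformProb_mono {α : Type} [Fintype α] {E F : Set α} (h : E ⊆ F) :
    uniformProb E ≤ uniformProb F := by
  rw [uniformProb, uniformProb]
  gcongr
  exact Set.toFinite F

/-- The bound holds for every fixed `ω`, so monotonicity of the integral suffices and the owner's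
choices need not be measurable. -/
theorem lintegral_uniformProb_le {Ω : Type} [MeasurableSpace Ω] (P : Measure Ω)
    [IsProbabilityMeasure P] {α : Type} [Fintype α] (E : Ω → Set α) {p : ℝ}
    (h : ∀ ω, uniformProb (E ω) ≤ p) :
    ∫⁻ ω, ENNReal.ofReal (uniformProb (E ω)) ∂P ≤ ENNReal.ofReal p := by
  refine (lintegral_mono fun ω => ENNReal.ofReal_le_ofReal (h ω)).trans ?_
  rw [lintegral_const, measure_univ, mul_one]

section Main

variable {n k d d₀ : ℕ} {ε δ γ : ℝ}

theorem stewardProg_runs_sizeBound (hk : 1 ≤ k) (hd₀ : 1 ≤ d₀) (hd : d₀ ≤ d) (hε : 0 < ε)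
    (hγ : 0 < γ) (f : List (Fin d → ℝ) → Bits n → Fin d → ℝ)
    (z : Bits (2 * halfCoins n k d d₀ γ)) :
    Runs k f (sizeBound n k d γ) 70 stewardProg (fun s => s.answers = answersTo ε d₀ f
      (stewardQuery n k d d₀ γ (coinNumber (List.ofFn z) 0)) k)
      (State.init d [n, k, d, d₀] [ε, δ, γ] z) :=
  stewardProg_runs hε hγ (le_sizeBound (by omega)) (le_sizeBound (by omega))
    (le_sizeBound (by omega)) hk hd₀ hd (le_sizeBound (by omega))
    (halfCoins_le_sizeBound γ hk hd₀ hd) z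

theorem answers_eq_answersTo (hk : 1 ≤ k) (hd₀ : 1 ≤ d₀) (hd : d₀ ≤ d) (hε : 0 < ε) (hγ : 0 < γ)
    (O : Owner n d ε δ) {z : Bits (2 * halfCoins n k d d₀ γ)} {t : ℕ} {Y : Fin k → Fin d → ℝ}
    (h : Transcript stewardProg [n, k, d, d₀] [ε, δ, γ] O z t Y) :
    List.ofFn Y = answersTo ε d₀ O.func
      (stewardQuery n k d d₀ γ (coinNumber (List.ofFn z) 0)) k := by
  obtain ⟨s, hs, hY⟩ := h
  obtain ⟨t', s', hs', -, ans⟩ :=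
    stewardProg_runs_sizeBound (δ := δ) hk hd₀ hd hε hγ O.func z
  rw [← hY, hs.deterministic hs', ans]

/-- One of the first `k` answers to `O` is far from the point of concentration if the queries
are `x 0, x 1, …`. -/
def HasWrongAnswer (k d₀ : ℕ) (O : Owner n d ε δ) (x : ℕ → Bits n) : Prop :=
  ∃ i < k, 6 * (ε * d₀) < ‖roundVec ε d₀ (O.func (answersTo ε d₀ O.func x i) (x i)) -
    O.point (answersTo ε d₀ O.func x i)‖

theorem hasWrongAnswer_of_fails {O : Owner n d ε δ} {x : ℕ → Bits n} {Y : Fin k → Fin d → ℝ}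
    (hY : List.ofFn Y = answersTo ε d₀ O.func x k) (hε : 0 < ε) {C : ℝ} (hC : 6 ≤ C)
    (h : Fails (C * (ε * d₀)) O Y) : HasWrongAnswer k d₀ O x := by
  obtain ⟨i, hi⟩ := h
  refine ⟨i, i.2, lt_of_le_of_lt (b := C * (ε * d₀)) (by gcongr) ?_⟩
  have h1 := take_answersTo ε d₀ O.func x i.2.le
  have h2 := take_answersTo ε d₀ O.func x (Nat.succ_le_of_lt i.2)
  rw [← hY] at h1 h2
  rw [h1] at hi
  rw [Nat.succ_eq_add_one, List.take_add_one, h1, answersTo, List.append_cancel_left_eq] at h2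
  have h3 : Y i = roundVec ε d₀ (O.func (answersTo ε d₀ O.func x i) (x i)) := by simpa using h2
  rwa [h3] at hi

open Classical in
theorem card_hasWrongAnswer_le (hd₀ : 1 ≤ d₀) (hε : 0 < ε) (hγ : 0 < γ) (O : Owner n d ε δ) :
    (((Finset.range (2 ^ (2 * halfCoins n k d d₀ γ))).filter fun v =>
      HasWrongAnswer k d₀ O (stewardQuery n k d d₀ γ v)).card : ℝ) ≤
      2 ^ (2 * halfCoins n k d d₀ γ) * (k * δ + γ) := by
  have h := card_wrong_answers_le hε hd₀ (pow_numBlocks_le d d₀)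
    (Nat.le_pow_clog (by norm_num) k) (show n ≤ 2 * ((n + 1) / 2) by omega)
    (two_pow_mul_errorExponent_le hγ) O
  rw [← halfCoins] at h
  refine le_trans (Nat.cast_le.2 (Finset.card_le_card fun v hv => ?_)) h
  rw [Finset.mem_filter] at hv ⊢
  exact hv

theorem uniformProb_fails_le (hk : 1 ≤ k) (hd₀ : 1 ≤ d₀) (hd : d₀ ≤ d) (hε : 0 < ε) (hγ : 0 < γ)
    {C : ℝ} (hC : 6 ≤ C) (O : Owner n d ε δ) :
    uniformProb {z : Bits (2 * halfCoins n k d d₀ γ) | ∃ (t : ℕ) (Y : Fin k → Fin d → ℝ),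
      Transcript stewardProg [n, k, d, d₀] [ε, δ, γ] O z t Y ∧ Fails (C * (ε * d₀)) O Y} ≤
      k * δ + γ := by
  refine (uniformProb_mono ?_).trans (uniformProb_coinNumber_le (m := 2 * halfCoins n k d d₀ γ)
    (fun v => HasWrongAnswer k d₀ O (stewardQuery n k d d₀ γ v))
    (card_hasWrongAnswer_le hd₀ hε hγ O))
  rintro z ⟨t, Y, hY, hfails⟩
  exact hasWrongAnswer_of_fails (answers_eq_answersTo hk hd₀ hd hε hγ O hY) hε hC hfails

theorem stewardProg_isOneQuerySteward (hk : 1 ≤ k) (hd₀ : 1 ≤ d₀) (hd : d₀ ≤ d) (hε : 0 < ε)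
    (hγ : 0 < γ) {C T : ℝ} (hC : 6 ≤ C) (hT : (sizeBound n k d γ : ℝ) ^ 70 ≤ T) :
    IsOneQuerySteward stewardProg [n, k, d, d₀] [ε, δ, γ] n k d ε δ (C * (ε * d₀)) (k * δ + γ)
      (2 * halfCoins n k d d₀ γ) T where
  halts O z := by
    obtain ⟨t, s, hs, ht, ans⟩ := stewardProg_runs_sizeBound (δ := δ) hk hd₀ hd hε hγ O.func z
    have hlen : s.answers.length = k := by rw [ans, length_answersTo]
    refine ⟨t, fun i => s.answers.get (i.cast hlen.symm), ⟨s, hs, ?_⟩, ?_⟩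
    · refine List.ext_get (by simp [hlen]) fun i h1 h2 => ?_
      simp
    · refine le_trans ?_ hT
      exact_mod_cast ht
  correct _ _ P _ O := lintegral_uniformProb_le P _ fun ω =>
    uniformProb_fails_le hk hd₀ hd hε hγ hC (O ω)

/-- Without rounds the program must not draw a seed: for odd `n` its length, `n` rounded up to an
even number, would exceed the allowed `n`. The initial test skips to the end in two steps. -/
theorem stewardProg_isOneQuerySteward_zero (hγ : 0 < γ) {ε' T : ℝ} (hT : 2 ≤ T) :
    IsOneQuerySteward stewardProg [n, 0, d, d₀] [ε, δ, γ] n 0 d ε δ ε' ((0 : ℕ) * δ + γ) 0 T where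
  halts O z := by
    refine ⟨2, Fin.elim0, ⟨_, .iteFalse _ _ _ _ _ 1 ?_ (.skip _), rfl⟩, by exact_mod_cast hT⟩
    exact lt_irrefl 0
  correct _ _ P _ O := lintegral_uniformProb_le P _ fun ω => by
    refine (uniformProb_mono (F := ∅) ?_).trans ?_
    · rintro z ⟨_, _, _, i, _⟩
      exact i.elim0
    · simp [uniformProb, hγ.le]

end Main

end RandomnessSteward

end

theorem mainTheorem8 :
    ∃ (S : RandomnessSteward.Prog) (C : ℝ) (c : ℕ),
      ∀ (n k d d₀ : ℕ) (ε δ γ : ℝ), 1 ≤ d₀ → d₀ ≤ d → 0 < ε → 0 < δ → 0 < γ →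
        ∃ m : ℕ,
          (m : ℝ) ≤ n + C * (k * d * Real.logb 2 (d₀ + 1) / d₀ +
            Real.logb 2 k * RandomnessSteward.logInv γ) ∧
          RandomnessSteward.IsOneQuerySteward S [n, k, d, d₀] [ε, δ, γ] n k d ε δ
            (C * (ε * d₀)) (k * δ + γ) m
            (C * (n + k + d + RandomnessSteward.logInv ε + RandomnessSteward.logInv γ + 1) ^ c) := by
  -- The time is at most `N ^ 70`, where `N` is at most 800 times a cube. The resulting constant far
  -- exceeds the 6 and the 385 needed for accuracy and coins.
  refine ⟨RandomnessSteward.stewardProg, 800 ^ 70, 210, ?_⟩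
  intro n k d d₀ ε δ γ hd₀ hd hε _ hγ
  have hlogε := RandomnessSteward.logInv_nonneg ε
  have hlogγ := RandomnessSteward.logInv_nonneg γ
  rcases Nat.eq_zero_or_pos k with rfl | hk
  · refine ⟨0, by simp, RandomnessSteward.stewardProg_isOneQuerySteward_zero hγ ?_⟩
    have h : (1 : ℝ) ≤ (n + (0 : ℕ) + d + RandomnessSteward.logInv ε +
        RandomnessSteward.logInv γ + 1) ^ 210 :=
      one_le_pow₀ (by push_cast; linarith [Nat.cast_nonneg (α := ℝ) n, Nat.cast_nonneg (α := ℝ) d])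
    refine le_trans (by norm_num) (mul_le_mul_of_nonneg_left h (by positivity))
  · refine ⟨_, (RandomnessSteward.halfCoins_le γ hk hd₀ hd).trans ?_,
      RandomnessSteward.stewardProg_isOneQuerySteward hk hd₀ hd hε hγ (by norm_num) ?_⟩
    · have h : 0 ≤ Real.logb 2 (d₀ + 1) :=
        Real.logb_nonneg (by norm_num) (by linarith [Nat.cast_nonneg (α := ℝ) d₀])
      have h' : 0 ≤ Real.logb 2 k := Real.logb_nonneg (by norm_num) (by exact_mod_cast hk)
      gcongr
      norm_num
    · refine (pow_le_pow_left₀ (Nat.cast_nonneg _)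
        (RandomnessSteward.sizeBound_le n k d ε γ) 70).trans (le_of_eq ?_)
      rw [mul_pow, ← pow_mul]
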